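/- **Setting.** Let $S$ be a countable set with the discrete topology and, for every $i\in S$, let $U_i$ be a non-empty compact metric space. For $i\ne j$ let $\lambda_{ij}:U_i\to[0,\infty)$, and put $\lambda_{ii}(u)=-\sum_{j\neq i}\lambda_{ij}(u)$. Assume * (A1) the functions $\lambda_{ij}$, $i\ne j$, are continuous; * (A2) $\sup_{i}\sup_{u\in U_i}\{-\lambda_{ii}(u)\}\le M<\infty$; * (A3) for every $i$ the series $\sum_{j\ne i}\lambda_{ij}(u)$ converges uniformly in $u\in U_i$. A *Markov control* is a map $\mathbf u$ on $[0,\infty)\times S$ with $\mathbf u(t,i)\in U_i$ such that $\mathbf u(\cdot,i)$ is Borel measurable for every $i$; let $\mathcal U$ be the set of Markov controls. For bounded $f:S\to\mathbb R$ put $\Lambda^{\mathbf u}_tf(i)=\sum_{j\in S}\lambda_{ij}(\mathbf u(t,i))f(j)$. Let $X$ be the canonical process on the space $\mathcal D([0,\infty),S)$ of right-continuous paths with left limits, with the $\sigma$-algebra generated by the coordinates and the filtration $\mathcal F_t=\sigma(X_r;r\le t)$. A probability measure $P$ on $\mathcal D([0,\infty),S)$ solves the martingale problem for $\mathbf u$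 started at $(s,i)$ if $P(X_r=i\text{ for all }r\le s)=1$ and, for every bounded $f:S\to\mathbb R$, the process $f(X_t)-\int_s^{s\vee t}\Lambda^{\mathbf u}_rf(X_r)\,dr$, $t\ge0$, is a $P$-martingale with respect to $(\mathcal F_t)$. Let $\theta\in(0,1)$, $0<T<\infty$, let $g:S\to[0,\infty)$ be bounded, and let $c(t,i,u)\ge0$ ($t\ge0$, $i\in S$, $u\in U_i$) be bounded with $c(\cdot,i,\cdot)$ continuous on $[0,\infty)\times U_i$ for every $i$. **Theorem.** For all $\mathbf u\in\mathcal U$, $s\ge0$, $i\in S$ the martingale problem for $\mathbf u$ started at $(s,i)$ has exactly one solution $P^{\mathbf u}_{s,i}$; write $E^{\mathbf u}_{s,i}$ for its expectation, and for $t\in[0,T]$ put $$\hat J^{\mathbf u}_T(t,i)=E^{\mathbf u}_{t,i}\Big[\exp\Big(\theta\Big[\int_t^Tc(s,X_s,\mathbf u(s,X_s))\,ds+g(X_T)\Big]\Big)\Big],\qquad V_T(t,i)=\inf_{\mathbf u\in\mathcal U}\hat J^{\mathbf u}_T(t,i).$$ 1. $V_T$ is the unique function $\varphi\in C_b([0,T]\times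 S)\cap C^1([0,T)\times S)$ (that is, bounded and continuous on $[0,T]\times S$ and continuously differentiable in time on $[0,T)$, one-sidedly at $0$) such that $$\frac{d\varphi}{dt}(t,i)+\inf_{u\in U_i}\Big[\theta c(t,i,u)\varphi(t,i)+\sum_{j\in S}\lambda_{ij}(u)\varphi(t,j)\Big]=0\quad\text{on }[0,T)\times S,\qquad \varphi(T,i)=e^{\theta g(i)}.$$ 2. There is a Markov control $\mathbf u^*$ such that, for all $(t,i)\in[0,T)\times S$, the action $\mathbf u^*(t,i)$ attains $\inf_{u\in U_i}\big[\theta c(t,i,u)V_T(t,i)+\sum_{j}\lambda_{ij}(u)V_T(t,j)\big]$. Every such Markov control is optimal: $\hat J^{\mathbf u^*}_T(t,i)=V_T(t,i)$ for all $(t,i)\in[0,T]\times S$. 3. For the risk-sensitive cost, $\theta^{-1}\log V_T(t,i)=\inf_{\mathbf u\in\mathcal U}\theta^{-1}\log\hat J^{\mathbf u}_T(t,i)$ for all $(t,i)\in[0,T]\times S$, and every $\mathbf u^*$ as in 2 attains this infimum. -/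

import Mathlib

open Set Filter Topology MeasureTheory ProbabilityTheory
open scoped NNReal

/-- Right-continuous functions `[0, ∞) → S` that have left limits in `S`. -/
def IsCadlag {S : Type*} [TopologicalSpace S] (ω : ℝ≥0 → S) : Prop :=
  (∀ t, ContinuousWithinAt ω (Ici t) t) ∧
    ∀ t, 0 < t → ∃ l, Tendsto ω (𝓝[<] t) (𝓝 l)

/-- The path space `D([0, ∞), S)`. As a subtype of the product `ℝ≥0 → S` it carries the
σ-algebra generated by the coordinate maps, which is the Borel σ-algebra of the Skorokhod
topology. The canonical process is `X t ω = ω.1 t`. -/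
abbrev PathSpace (S : Type*) [TopologicalSpace S] : Type _ := {ω : ℝ≥0 → S // IsCadlag ω}

/-- The filtration `F t = σ(X r ; r ≤ t)` generated by the canonical process. -/
def canonicalFiltration (S : Type*) [TopologicalSpace S] [MeasurableSpace S] :
    Filtration ℝ≥0 (inferInstance : MeasurableSpace (PathSpace S)) where
  seq t := ⨆ r : ℝ≥0, ⨆ _ : r ≤ t,
    MeasurableSpace.comap (fun ω : PathSpace S => ω.1 r) inferInstance
  mono' _ _ hst := iSup_mono fun _ => iSup_le fun h =>
    le_iSup_of_le (h.trans hst) le_rfl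
  le' _ := iSup_le fun r => iSup_le fun _ =>
    ((measurable_pi_apply r).comp measurable_subtype_coe).comap_le

/-- Markov controls: maps `u` on `[0, ∞) × S` with `u (t, i) ∈ U i`, measurable in `t`
for every `i`. -/
structure MarkovControl {S : Type*} (U : S → Type*) [∀ i, MeasurableSpace (U i)] where
  /-- The action `u (t, i)`. -/
  act : ℝ≥0 → (i : S) → U i
  measurable_act : ∀ i, Measurable fun t => act t i

/-- The transition rates `lam i j u = λ_{ij}(u)`: non-negative off the diagonal, continuous
(A1), with bounded total jump rate (A2), and with `λ_{ii}(u) = - ∑_{j ≠ i} λ_{ij}(u)`, where for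
every `i` the series converges uniformly in `u` (A3). -/
structure RateAssumptions {S : Type*} {U : S → Type*} [∀ i, MetricSpace (U i)]
    (lam : (i : S) → S → U i → ℝ) : Prop where
  nonneg : ∀ i j, j ≠ i → ∀ u, 0 ≤ lam i j u
  continuous : ∀ i j, j ≠ i → Continuous (lam i j)
  bounded : ∃ M : ℝ, ∀ i u, -lam i i u ≤ M
  conservative : ∀ i, TendstoUniformly
    (fun (F : Finset {j : S // j ≠ i}) (u : U i) => ∑ j ∈ F, lam i j.1 u)
    (fun u => -lam i i u) atTop

section Control

variable {S : Type*} [TopologicalSpace S] [MeasurableSpace S]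
  {U : S → Type*} [∀ i, MeasurableSpace (U i)]

/-- The generator `(Λ_t^u f)(i) = ∑_j λ_{ij}(u(t, i)) f(j)`, the sum running over all `j`. -/
noncomputable def generator (lam : (i : S) → S → U i → ℝ) (u : MarkovControl U)
    (t : ℝ≥0) (f : S → ℝ) (i : S) : ℝ :=
  ∑' j, lam i j (u.act t i) * f j

/-- `P` solves the martingale problem for `Λ^u` started at time `s` with law `μ`: under `P` the
path stays constant up to time `s`, `X s` has law `μ`, and after time `s` the process
`f (X t) - ∫_s^t Λ_r^u f (X r) dr` is a martingale for every bounded `f`. (For `t ≤ s` the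
integral below is over `[s, s]`, so that the process is `f (X t)`, which is constant
in time.) -/
structure SolvesMartingaleProblem (lam : (i : S) → S → U i → ℝ) (u : MarkovControl U)
    (s : ℝ≥0) (μ : Measure S) (P : Measure (PathSpace S)) : Prop where
  isProbabilityMeasure : IsProbabilityMeasure P
  frozen : ∀ᵐ ω ∂P, ∀ r ≤ s, ω.1 r = ω.1 s
  initial : P.map (fun ω => ω.1 s) = μ
  martingale : ∀ f : S → ℝ, (∃ C, ∀ i, |f i| ≤ C) →
    Martingale
      (fun (t : ℝ≥0) (ω : PathSpace S) =>
        f (ω.1 t) - ∫ r in (s : ℝ)..(max s t : ℝ≥0),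
          generator lam u r.toNNReal f (ω.1 r.toNNReal))
      (canonicalFiltration S) P

/-- The law `P^u_{s,i}` of the controlled chain started at time `s` in the state `i`: the
solution of the martingale problem with initial law `δ_i`. -/
noncomputable def controlledLaw (lam : (i : S) → S → U i → ℝ) (u : MarkovControl U)
    (s : ℝ≥0) (i : S) : Measure (PathSpace S) :=
  Classical.epsilon fun P => SolvesMartingaleProblem lam u s (Measure.dirac i) P

/-- The exponential cost
`E^u_{t,i} [exp (θ (∫_t^T c(s, X s, u(s, X s)) ds + g (X T)))]`. -/
noncomputable def expCost (lam : (i : S) → S → U i → ℝ) (c : ℝ≥0 → (i : S) → U i → ℝ)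
    (g : S → ℝ) (θ : ℝ) (T : ℝ≥0) (u : MarkovControl U) (t : ℝ≥0) (i : S) : ℝ :=
  ∫ ω, Real.exp (θ * ((∫ r in (t : ℝ)..T,
      c r.toNNReal (ω.1 r.toNNReal) (u.act r.toNNReal (ω.1 r.toNNReal))) + g (ω.1 T)))
    ∂(controlledLaw lam u t i)

/-- The value function: the infimum of the exponential cost over all Markov controls. -/
noncomputable def valueFunction (lam : (i : S) → S → U i → ℝ)
    (c : ℝ≥0 → (i : S) → U i → ℝ) (g : S → ℝ) (θ : ℝ) (T : ℝ≥0) (t : ℝ≥0) (i : S) : ℝ :=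
  ⨅ u : MarkovControl U, expCost lam c g θ T u t i

end Control

section HJB

variable {S : Type*} {U : S → Type*}

/-- `θ c(t, i, u) φ(t, i) + ∑_j λ_{ij}(u) φ(t, j)`. -/
noncomputable def hjbTerm (lam : (i : S) → S → U i → ℝ) (c : ℝ≥0 → (i : S) → U i → ℝ)
    (θ : ℝ) (φ : ℝ≥0 → S → ℝ) (t : ℝ≥0) (i : S) (u : U i) : ℝ :=
  θ * c t i u * φ t i + ∑' j, lam i j u * φ t j

/-- `φ`, restricted to `[0, T] × S`, lies in `C_b([0, T] × S) ∩ C¹([0, T) × S)` and solves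
the HJB equation on `[0, T) × S` with terminal value `exp (θ g)`. The derivative in time is
one-sided at `t = 0`; values of `φ` at times after `T` play no role. -/
structure IsHJBSolution [TopologicalSpace S] (lam : (i : S) → S → U i → ℝ)
    (c : ℝ≥0 → (i : S) → U i → ℝ) (g : S → ℝ) (θ : ℝ) (T : ℝ≥0)
    (φ : ℝ≥0 → S → ℝ) : Prop where
  bounded : ∃ C, ∀ t ≤ T, ∀ i, |φ t i| ≤ C
  continuousOn : ContinuousOn (fun p : ℝ≥0 × S => φ p.1 p.2) (Iic T ×ˢ univ)
  contDiffOn : ∀ i, ContDiffOn ℝ 1 (fun r : ℝ => φ r.toNNReal i) (Ico 0 (T : ℝ))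
  equation : ∀ t < T, ∀ i,
    derivWithin (fun r : ℝ => φ r.toNNReal i) (Ico 0 (T : ℝ)) t
      + ⨅ u : U i, hjbTerm lam c θ φ t i u = 0
  terminal : ∀ i, φ T i = Real.exp (θ * g i)

/-- At every `(t, i) ∈ [0, T) × S` the action of the Markov control `u` attains the infimum
in the HJB equation for `φ`. -/
def IsPointwiseMinimiser [∀ i, MeasurableSpace (U i)] (lam : (i : S) → S → U i → ℝ)
    (c : ℝ≥0 → (i : S) → U i → ℝ) (θ : ℝ) (T : ℝ≥0) (φ : ℝ≥0 → S → ℝ)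
    (u : MarkovControl U) : Prop :=
  ∀ t < T, ∀ i, hjbTerm lam c θ φ t i (u.act t i) = ⨅ v : U i, hjbTerm lam c θ φ t i v

end HJB

/-!
Three facts carry the theorem.

*The martingale problem is well posed.* Existence is proved by uniformisation: by (A2) there is a
rate `M` that dominates all jump rates, and a chain that rings at the times of a Poisson process of
rate `M` and then jumps from `y` to `j` with probability `δ_{yj} + λ_{yj} / M`, at the action
prescribed by the control for that time, has the generator `Λ^u`. The chain is a measurable function
of an i.i.d. sequence of exponential waiting times and uniform marks
(`exists_measurable_sampler`, `fullChainPathSpace`). Its martingale property reduces, one waiting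
time after the other, to a compensation formula for a single exponential variable
(`integral_expMeasure_compensator`, `integral_indicator_mul_fullChainPath`). For uniqueness, the
one-dimensional laws of two solutions satisfy the same linear equation with bounded coefficients,
which determines them by iteration (`SolvesMartingaleProblem.integral_mul_eq_of_le`); inserting a
weight that is known at the initial time gives all finite-dimensional laws.

*The HJB equation has a solution.* By (A1) and (A3) the Hamiltonian maps bounded continuous
functions to continuous ones, and by (A2) it is Lipschitz for the supremum norm, so that Banach's
fixed point theorem applies to the integrated equation (`exists_isMildHJBSolution`).

*Every solution of the HJB equation is the value function.* Let `φ` be a solution. For any control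
the Hamiltonian is at most `θ c φ + Λ^u φ`, so that `exp (θ ∫ c) φ` increases in mean
(`SolvesMartingaleProblem.le_integral_exp_mul`); comparing the times `t` and `T` gives
`φ ≤ expCost`. For a control that minimises pointwise the inequality also holds for `-φ`, which
gives equality. Such a control exists by measurable selection (`exists_measurable_argmin`). Hence
`φ` is the value function, which is thereby the only solution, and all pointwise minimisers are
optimal. As the infimum of the costs is attained and positive, it commutes with the logarithm.

The monotonicity in mean is obtained without stochastic calculus for time-dependent functionals:
the increment over a short interval `[a, b]` is compared with the martingale of the fixed function
`φ (a, ·)`, and the error is of order `(b - a) ^ 2`, since the path moves in `[a, b]` only with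
probability of order `b - a`.
-/

/-! ### Bounds and continuity for the rates; selection of minimisers -/

section Rates

variable {S : Type*} {U : S → Type*} [∀ i, MetricSpace (U i)]
  {lam : (i : S) → S → U i → ℝ}

theorem RateAssumptions.hasSum_offDiag (h : RateAssumptions lam) (i : S) (u : U i) :
    HasSum (fun j : {j : S // j ≠ i} => lam i j.1 u) (-lam i i u) :=
  (h.conservative i).tendsto_at u

/-- The off-diagonal family extended by an arbitrary diagonal entry. -/
theorem HasSum.add_diag {i : S} {f : S → ℝ} {a : ℝ}
    (h : HasSum (fun j : {j : S // j ≠ i} => f j.1) a) : HasSum f (a + f i) := by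
  classical
  have h1 : HasSum (({j : S | j ≠ i}).indicator f) a :=
    (hasSum_subtype_iff_indicator (s := {j : S | j ≠ i})).1 h
  have h2 : HasSum (fun j => if j = i then f i else 0) (f i) := hasSum_ite_eq i (f i)
  refine (h1.add h2).congr_fun fun j => ?_
  by_cases hj : j = i
  · subst hj; simp
  · simp [hj]

theorem RateAssumptions.hasSum_abs (h : RateAssumptions lam) (i : S) (u : U i) :
    HasSum (fun j => |lam i j u|) (-lam i i u + |lam i i u|) := by
  apply HasSum.add_diag
  have h1 : (fun j : {j : S // j ≠ i} => |lam i j.1 u|) = fun j => lam i j.1 u :=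
    funext fun j => abs_of_nonneg (h.nonneg i j.1 j.2 u)
  rw [h1]
  exact h.hasSum_offDiag i u

theorem RateAssumptions.diag_nonpos (h : RateAssumptions lam) (i : S) (u : U i) :
    lam i i u ≤ 0 := by
  have := (h.hasSum_offDiag i u).nonneg fun j : {j : S // j ≠ i} => h.nonneg i j.1 j.2 u
  linarith

theorem RateAssumptions.hasSum_zero (h : RateAssumptions lam) (i : S) (u : U i) :
    HasSum (fun j => lam i j u) 0 := by
  simpa using (h.hasSum_offDiag i u).add_diag (f := fun j => lam i j u)

theorem RateAssumptions.exists_bound (h : RateAssumptions lam) :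
    ∃ M : ℝ, 0 < M ∧ ∀ i u, -lam i i u ≤ M := by
  obtain ⟨M, hM⟩ := h.bounded
  exact ⟨max M 1, by positivity, fun i u => (hM i u).trans (le_max_left _ _)⟩

theorem RateAssumptions.summable_mul (h : RateAssumptions lam) (i : S) (u : U i) {f : S → ℝ}
    {B : ℝ} (hf : ∀ j, |f j| ≤ B) : Summable fun j => lam i j u * f j := by
  refine Summable.of_norm_bounded ((h.hasSum_abs i u).summable.mul_right B) fun j => ?_
  rw [norm_mul, Real.norm_eq_abs, Real.norm_eq_abs]
  exact mul_le_mul_of_nonneg_left (hf j) (abs_nonneg _)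

theorem RateAssumptions.abs_tsum_le (h : RateAssumptions lam) {M : ℝ}
    (hM : ∀ i u, -lam i i u ≤ M) (i : S) (u : U i) {f : S → ℝ}
    {B : ℝ} (hf : ∀ j, |f j| ≤ B) : |∑' j, lam i j u * f j| ≤ 2 * M * B := by
  have hB : 0 ≤ B := (abs_nonneg _).trans (hf i)
  have h1 := tsum_of_norm_bounded (f := fun j => lam i j u * f j)
    ((h.hasSum_abs i u).mul_right B) fun j => by
      rw [norm_mul, Real.norm_eq_abs, Real.norm_eq_abs]
      exact mul_le_mul_of_nonneg_left (hf j) (abs_nonneg _)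
  rw [Real.norm_eq_abs] at h1
  refine h1.trans (mul_le_mul_of_nonneg_right ?_ hB)
  rw [abs_of_nonpos (h.diag_nonpos i u)]
  linarith [hM i u]

theorem RateAssumptions.tsum_sub (h : RateAssumptions lam) (i : S) (u : U i) {f g : S → ℝ}
    {B : ℝ} (hf : ∀ j, |f j| ≤ B) (hg : ∀ j, |g j| ≤ B) :
    (∑' j, lam i j u * f j) - ∑' j, lam i j u * g j = ∑' j, lam i j u * (f j - g j) := by
  rw [← (h.summable_mul i u hf).tsum_sub (h.summable_mul i u hg)]
  simp only [mul_sub]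

theorem RateAssumptions.continuous_rate (h : RateAssumptions lam) (i j : S) :
    Continuous (lam i j) := by
  by_cases hj : j = i
  · subst hj
    have : Continuous fun u => -lam j j u :=
      (h.conservative j).continuous <| Eventually.frequently <| Eventually.of_forall fun F =>
        continuous_finsetSum _ fun k _ => h.continuous j k.1 k.2
    simpa [Function.comp_def] using (continuous_neg.comp this)
  · exact h.continuous i j hj

/-- By the uniform convergence (A3), the generator applied to a uniformly bounded family of
functions that depends continuously on a parameter is jointly continuous. -/
theorem RateAssumptions.continuous_tsum (h : RateAssumptions lam) (i : S) {X : Type*}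
    [TopologicalSpace X] {a : X → U i} (ha : Continuous a) {F : X → S → ℝ}
    (hF : ∀ j, Continuous fun x => F x j) {B : ℝ} (hB : ∀ x j, |F x j| ≤ B) :
    Continuous fun x => ∑' j, lam i j (a x) * F x j := by
  have hsum : ∀ x, Summable fun j : {j : S // j ≠ i} => lam i j.1 (a x) * F x j.1 := fun x =>
    (h.summable_mul i (a x) (hB x)).subtype _
  have key : ∀ x, ∑' j, lam i j (a x) * F x j
      = (∑' j : {j : S // j ≠ i}, lam i j.1 (a x) * F x j.1) + lam i i (a x) * F x i :=
    fun x => ((hsum x).hasSum.add_diag (f := fun j => lam i j (a x) * F x j)).tsum_eq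
  simp_rw [key]
  refine Continuous.add ?_ (((h.continuous_rate i i).comp ha).mul (hF i))
  have hB0 : ∀ x : X, 0 ≤ B := fun x => (abs_nonneg _).trans (hB x i)
  have hu : TendstoUniformly
      (fun (s : Finset {j : S // j ≠ i}) (x : X) => ∑ j ∈ s, lam i j.1 (a x) * F x j.1)
      (fun x => ∑' j : {j : S // j ≠ i}, lam i j.1 (a x) * F x j.1) atTop := by
    rw [Metric.tendstoUniformly_iff]
    intro ε hε
    have h1 := Metric.tendstoUniformly_iff.1 (h.conservative i) (ε / (|B| + 1)) (by positivity)
    filter_upwards [h1] with s hs x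
    specialize hs (a x)
    -- the remainder of the series is at most `B` times the remainder of the series of rates
    have e1 := (hsum x).sum_add_tsum_compl (s := s)
    have e2 := (h.hasSum_offDiag i (a x)).summable.sum_add_tsum_compl (s := s)
    rw [(h.hasSum_offDiag i (a x)).tsum_eq] at e2
    have e3 : |∑' j : ((s : Set {j : S // j ≠ i})ᶜ : Set _), lam i j.1.1 (a x) * F x j.1.1|
        ≤ (∑' j : ((s : Set {j : S // j ≠ i})ᶜ : Set _), lam i j.1.1 (a x)) * B := by
      rw [← Real.norm_eq_abs]
      refine tsum_of_norm_bounded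
        (((h.hasSum_offDiag i (a x)).summable.subtype _).hasSum.mul_right B) fun j => ?_
      rw [norm_mul, Real.norm_eq_abs, Real.norm_eq_abs,
        abs_of_nonneg (h.nonneg i j.1.1 j.1.2 (a x))]
      exact mul_le_mul_of_nonneg_left (hB x _) (h.nonneg i j.1.1 j.1.2 (a x))
    rw [Real.dist_eq, ← e2, add_sub_cancel_left] at hs
    rw [Real.dist_eq, ← e1, add_sub_cancel_left]
    have h0 : 0 < |B| + 1 := by positivity
    rw [lt_div_iff₀ h0] at hs
    refine e3.trans_lt (lt_of_le_of_lt ?_ hs)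
    refine (le_abs_self _).trans ?_
    rw [abs_mul]
    exact mul_le_mul_of_nonneg_left (by linarith [abs_nonneg B]) (abs_nonneg _)
  exact hu.continuous <| Eventually.frequently <| Eventually.of_forall fun s =>
    continuous_finsetSum _ fun j _ => ((h.continuous_rate i j.1).comp ha).mul (hF j.1)

end Rates

section CompactInf

variable {X K : Type*} [TopologicalSpace X] [TopologicalSpace K] [CompactSpace K]

theorem exists_eq_iInf_of_compact [Nonempty K] {f : K → ℝ} (hf : Continuous f) :
    ∃ k, f k = ⨅ x, f x := by
  obtain ⟨k, -, hk⟩ := isCompact_univ.exists_isMinOn univ_nonempty hf.continuousOn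
  refine ⟨k, le_antisymm (le_ciInf fun x => hk (mem_univ x)) (ciInf_le ?_ k)⟩
  exact ⟨f k, by rintro _ ⟨x, rfl⟩; exact hk (mem_univ x)⟩

theorem continuous_iInf_of_compact {f : X → K → ℝ} (hf : Continuous fun p : X × K => f p.1 p.2) :
    Continuous fun x => ⨅ k, f x k := by
  have := isCompact_univ.continuous_sInf (K := (univ : Set K)) (f := fun x k => f x k) hf
  simpa [sInf_image', image_univ, sInf_range] using this

theorem abs_iInf_sub_iInf_le {ι : Type*} [Nonempty ι] {f g : ι → ℝ} {ε : ℝ}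
    (hf : BddBelow (range f)) (hg : BddBelow (range g)) (h : ∀ x, |f x - g x| ≤ ε) :
    |(⨅ x, f x) - ⨅ x, g x| ≤ ε := by
  rw [abs_le]
  constructor
  · have : (⨅ x, g x) - ε ≤ ⨅ x, f x := le_ciInf fun x => by
      have := (abs_le.1 (h x)).1; linarith [ciInf_le hg x]
    linarith
  · have : (⨅ x, f x) - ε ≤ ⨅ x, g x := le_ciInf fun x => by
      have := (abs_le.1 (h x)).2; linarith [ciInf_le hf x]
    linarith

/-- Measurable selection of minimisers. The compact metric space `K` is a continuous image of the
Cantor set, which is linearly ordered; the least point of the Cantor set that is mapped to a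
minimiser depends measurably on the parameter, since its sublevel sets are closed. -/
theorem exists_measurable_argmin {X K : Type*} [TopologicalSpace X] [MeasurableSpace X]
    [BorelSpace X] [MetricSpace K] [CompactSpace K] [Nonempty K] [MeasurableSpace K]
    [BorelSpace K] {f : X → K → ℝ} (hf : Continuous fun p : X × K => f p.1 p.2) :
    ∃ a : X → K, Measurable a ∧ ∀ x, f x (a x) = ⨅ k, f x k := by
  obtain ⟨p, hp, hps⟩ := exists_nat_bool_continuous_surjective_of_compact K
  let q : cantorSet → K := p ∘ cantorSetHomeomorphNatToBool
  have hq : Continuous q := hp.comp cantorSetHomeomorphNatToBool.continuous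
  have hqs : Function.Surjective q := hps.comp cantorSetHomeomorphNatToBool.surjective
  have : CompactSpace cantorSet := isCompact_iff_compactSpace.1 isCompact_cantorSet
  have hm := continuous_iInf_of_compact hf
  let Z : Set (X × cantorSet) := {z | f z.1 (q z.2) = ⨅ k, f z.1 k}
  have hZ : IsClosed Z := isClosed_eq
    (hf.comp (continuous_fst.prodMk (hq.comp continuous_snd))) (hm.comp continuous_fst)
  let A : X → Set cantorSet := fun x => {y | (x, y) ∈ Z}
  have hAc : ∀ x, IsCompact (A x) := fun x =>
    (hZ.preimage (Continuous.prodMk_right x)).isCompact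
  have hAn : ∀ x, (A x).Nonempty := fun x => by
    obtain ⟨k, hk⟩ := exists_eq_iInf_of_compact (f := f x) (hf.comp (Continuous.prodMk_right x))
    obtain ⟨y, rfl⟩ := hqs k
    exact ⟨y, hk⟩
  have hmin : ∀ x, ∃ y ∈ A x, ∀ y' ∈ A x, y.1 ≤ y'.1 := fun x => by
    obtain ⟨y, hy, hy'⟩ := (hAc x).exists_isMinOn (hAn x) continuous_subtype_val.continuousOn
    exact ⟨y, hy, fun y' h => hy' h⟩
  choose y hyA hymin using hmin
  have hymeas : Measurable y := by
    refine Measurable.subtype_mk (f := fun x => (y x).1) (measurable_of_Iic fun b => ?_)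
    have : (fun x => (y x).1) ⁻¹' Iic b = Prod.fst '' (Z ∩ {z | z.2.1 ≤ b}) := by
      ext x
      constructor
      · intro hx
        exact ⟨(x, y x), ⟨hyA x, hx⟩, rfl⟩
      · rintro ⟨⟨x', y'⟩, ⟨h1, h2⟩, rfl⟩
        exact (hymin x' y' h1).trans h2
    rw [this]
    refine (isClosedMap_fst_of_compactSpace _ (hZ.inter ?_)).measurableSet
    exact isClosed_le (continuous_subtype_val.comp continuous_snd) continuous_const
  exact ⟨fun x => q (y x), hq.measurable.comp hymeas, fun x => hyA x⟩

end CompactInf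

/-! ### The HJB equation in integrated form -/

section HJBExistence

variable {S : Type*} {U : S → Type*}
  {lam : (i : S) → S → U i → ℝ} {c : ℝ≥0 → (i : S) → U i → ℝ} {θ C M : ℝ}

/-- The Hamiltonian: the infimum of `hjbTerm` over all actions. -/
noncomputable def hamiltonian (lam : (i : S) → S → U i → ℝ) (c : ℝ≥0 → (i : S) → U i → ℝ)
    (θ : ℝ) (φ : ℝ≥0 → S → ℝ) (t : ℝ≥0) (i : S) : ℝ :=
  ⨅ u : U i, hjbTerm lam c θ φ t i u

theorem hjbTerm_congr {φ ψ : ℝ≥0 → S → ℝ} {t : ℝ≥0} (h : ∀ j, φ t j = ψ t j) (i : S) (u : U i) :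
    hjbTerm lam c θ φ t i u = hjbTerm lam c θ ψ t i u := by
  simp only [hjbTerm, h]

theorem hamiltonian_congr {φ ψ : ℝ≥0 → S → ℝ} {t : ℝ≥0} (h : ∀ j, φ t j = ψ t j) (i : S) :
    hamiltonian lam c θ φ t i = hamiltonian lam c θ ψ t i := by
  simp only [hamiltonian, hjbTerm_congr h]

variable [∀ i, MetricSpace (U i)]

theorem continuous_hjbTerm (hlam : RateAssumptions lam)
    (hc : ∀ i, Continuous fun p : ℝ≥0 × U i => c p.1 i p.2) {φ : ℝ≥0 → S → ℝ} {B : ℝ}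
    (hφ : ∀ j, Continuous fun t => φ t j) (hB : ∀ t j, |φ t j| ≤ B) (i : S) :
    Continuous fun p : ℝ≥0 × U i => hjbTerm lam c θ φ p.1 i p.2 := by
  refine Continuous.add ((continuous_const.mul (hc i)).mul ((hφ i).comp continuous_fst)) ?_
  exact hlam.continuous_tsum i continuous_snd (F := fun p : ℝ≥0 × U i => φ p.1)
    (fun j => (hφ j).comp continuous_fst) (fun p => hB p.1)

theorem abs_hjbTerm_sub_le (hlam : RateAssumptions lam) (hM : ∀ i u, -lam i i u ≤ M)
    (hθ : 0 ≤ θ) (hc : ∀ t i u, |c t i u| ≤ C) {φ ψ : ℝ≥0 → S → ℝ} {B ε : ℝ} {t : ℝ≥0}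
    (hφ : ∀ j, |φ t j| ≤ B) (hψ : ∀ j, |ψ t j| ≤ B) (hε : ∀ j, |φ t j - ψ t j| ≤ ε)
    (i : S) (u : U i) :
    |hjbTerm lam c θ φ t i u - hjbTerm lam c θ ψ t i u| ≤ (θ * C + 2 * M) * ε := by
  have h1 : hjbTerm lam c θ φ t i u - hjbTerm lam c θ ψ t i u
      = θ * c t i u * (φ t i - ψ t i) + ∑' j, lam i j u * (φ t j - ψ t j) := by
    rw [← hlam.tsum_sub i u hφ hψ]; simp only [hjbTerm]; ring
  rw [h1]
  refine (abs_add_le _ _).trans ?_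
  rw [add_mul]
  refine add_le_add ?_ (hlam.abs_tsum_le hM i u hε)
  rw [abs_mul, abs_mul, abs_of_nonneg hθ]
  have hC : 0 ≤ C := (abs_nonneg _).trans (hc t i u)
  exact mul_le_mul (mul_le_mul_of_nonneg_left (hc t i u) hθ) (hε i) (abs_nonneg _)
    (by positivity)

theorem abs_hjbTerm_le (hlam : RateAssumptions lam) (hM : ∀ i u, -lam i i u ≤ M)
    (hθ : 0 ≤ θ) (hc : ∀ t i u, |c t i u| ≤ C) {φ : ℝ≥0 → S → ℝ} {B : ℝ} {t : ℝ≥0}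
    (hφ : ∀ j, |φ t j| ≤ B) (i : S) (u : U i) :
    |hjbTerm lam c θ φ t i u| ≤ (θ * C + 2 * M) * B := by
  have hB : 0 ≤ B := (abs_nonneg _).trans (hφ i)
  simpa [hjbTerm] using abs_hjbTerm_sub_le hlam hM hθ hc (ψ := fun _ _ => 0) (ε := B)
    hφ (by simpa using fun _ : S => hB) (by simpa using hφ) i u

theorem continuous_hamiltonian [∀ i, CompactSpace (U i)] (hlam : RateAssumptions lam)
    (hc : ∀ i, Continuous fun p : ℝ≥0 × U i => c p.1 i p.2) {φ : ℝ≥0 → S → ℝ} {B : ℝ}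
    (hφ : ∀ j, Continuous fun t => φ t j) (hB : ∀ t j, |φ t j| ≤ B) (i : S) :
    Continuous fun t => hamiltonian lam c θ φ t i :=
  continuous_iInf_of_compact (continuous_hjbTerm hlam hc hφ hB i)

theorem abs_hamiltonian_sub_le [∀ i, Nonempty (U i)] (hlam : RateAssumptions lam)
    (hM : ∀ i u, -lam i i u ≤ M)
    (hθ : 0 ≤ θ) (hc : ∀ t i u, |c t i u| ≤ C) {φ ψ : ℝ≥0 → S → ℝ} {B ε : ℝ} {t : ℝ≥0}
    (hφ : ∀ j, |φ t j| ≤ B) (hψ : ∀ j, |ψ t j| ≤ B) (hε : ∀ j, |φ t j - ψ t j| ≤ ε)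
    (i : S) :
    |hamiltonian lam c θ φ t i - hamiltonian lam c θ ψ t i| ≤ (θ * C + 2 * M) * ε := by
  refine abs_iInf_sub_iInf_le ?_ ?_ fun u => abs_hjbTerm_sub_le hlam hM hθ hc hφ hψ hε i u
  · refine ⟨-((θ * C + 2 * M) * B), ?_⟩
    rintro _ ⟨u, rfl⟩
    exact (abs_le.1 (abs_hjbTerm_le hlam hM hθ hc hφ i u)).1
  · refine ⟨-((θ * C + 2 * M) * B), ?_⟩
    rintro _ ⟨u, rfl⟩
    exact (abs_le.1 (abs_hjbTerm_le hlam hM hθ hc hψ i u)).1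

theorem abs_hamiltonian_le [∀ i, Nonempty (U i)] (hlam : RateAssumptions lam)
    (hM : ∀ i u, -lam i i u ≤ M)
    (hθ : 0 ≤ θ) (hc : ∀ t i u, |c t i u| ≤ C) {φ : ℝ≥0 → S → ℝ} {B : ℝ} {t : ℝ≥0}
    (hφ : ∀ j, |φ t j| ≤ B) (i : S) :
    |hamiltonian lam c θ φ t i| ≤ (θ * C + 2 * M) * B := by
  have hB : 0 ≤ B := (abs_nonneg _).trans (hφ i)
  simpa [hamiltonian, hjbTerm] using abs_hamiltonian_sub_le hlam hM hθ hc
    (ψ := fun _ _ => 0) (ε := B) hφ (by simpa using fun _ : S => hB) (by simpa using hφ) i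

/-- A bounded continuous function that solves the HJB equation in integrated form on `[0, T]`.
Boundedness and continuity are asked for on the whole half-line, where a solution on `[0, T]` can
be continued by its terminal value. -/
structure IsMildHJBSolution (lam : (i : S) → S → U i → ℝ) (c : ℝ≥0 → (i : S) → U i → ℝ)
    (g : S → ℝ) (θ : ℝ) (T : ℝ≥0) (φ : ℝ≥0 → S → ℝ) : Prop where
  bounded : ∃ B, ∀ t i, |φ t i| ≤ B
  continuous : ∀ i, Continuous fun t => φ t i
  integral_eq : ∀ t ≤ T, ∀ i, φ t i = Real.exp (θ * g i)
    + ∫ r in (t : ℝ)..T, hamiltonian lam c θ φ r.toNNReal i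

theorem IsMildHJBSolution.isHJBSolution [∀ i, CompactSpace (U i)] [TopologicalSpace S]
    [DiscreteTopology S]
    (hlam : RateAssumptions lam) (hc : ∀ i, Continuous fun p : ℝ≥0 × U i => c p.1 i p.2)
    {g : S → ℝ} {T : ℝ≥0} {φ : ℝ≥0 → S → ℝ} (h : IsMildHJBSolution lam c g θ T φ) :
    IsHJBSolution lam c g θ T φ := by
  obtain ⟨B, hB⟩ := h.bounded
  have hH : ∀ i, Continuous fun r : ℝ => hamiltonian lam c θ φ r.toNNReal i := fun i =>
    (continuous_hamiltonian hlam hc h.continuous hB i).comp continuous_real_toNNReal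
  let F : S → ℝ → ℝ := fun i t => Real.exp (θ * g i)
    - ∫ r in (T : ℝ)..t, hamiltonian lam c θ φ r.toNNReal i
  have hF : ∀ i t, HasDerivAt (F i) (-hamiltonian lam c θ φ t.toNNReal i) t := fun i t =>
    ((intervalIntegral.integral_hasDerivAt_right ((hH i).intervalIntegrable _ _)
      ((hH i).stronglyMeasurableAtFilter _ _) (hH i).continuousAt)).const_sub _
  have hEq : ∀ i, ∀ r ∈ Ico 0 (T : ℝ), φ r.toNNReal i = F i r := fun i r hr => by
    rw [h.integral_eq _ (by rw [Real.toNNReal_le_iff_le_coe]; exact hr.2.le) i,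
      Real.coe_toNNReal r hr.1, intervalIntegral.integral_symm]
    simp [F]; ring
  refine ⟨⟨B, fun t _ i => hB t i⟩, ?_, fun i => ?_, fun t ht i => ?_, fun i => ?_⟩
  · refine Continuous.continuousOn ?_
    rw [continuous_prod_of_discrete_right]
    exact h.continuous
  · refine ContDiffOn.congr ?_ (hEq i)
    refine (contDiff_one_iff_deriv.2 ⟨fun t => (hF i t).differentiableAt, ?_⟩).contDiffOn
    rw [funext fun t => (hF i t).deriv]
    exact (hH i).neg
  · have ht' : (t : ℝ) ∈ Ico 0 (T : ℝ) := ⟨t.2, by exact_mod_cast ht⟩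
    rw [derivWithin_congr (hEq i) (hEq i _ ht'), (hF i t).hasDerivWithinAt.derivWithin
      (uniqueDiffOn_Ico _ _ _ ht'), Real.toNNReal_coe]
    exact neg_add_cancel _
  · rw [h.integral_eq T le_rfl i]; simp

theorem IsHJBSolution.isMildHJBSolution [∀ i, CompactSpace (U i)] [TopologicalSpace S]
    [DiscreteTopology S]
    (hlam : RateAssumptions lam) (hc : ∀ i, Continuous fun p : ℝ≥0 × U i => c p.1 i p.2)
    {g : S → ℝ} {T : ℝ≥0} {φ : ℝ≥0 → S → ℝ} (h : IsHJBSolution lam c g θ T φ) :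
    IsMildHJBSolution lam c g θ T fun t => φ (min t T) := by
  obtain ⟨B, hB⟩ := h.bounded
  have hB' : ∀ t i, |φ (min t T) i| ≤ B := fun t i => hB _ (min_le_right _ _) i
  have hcont : ∀ i, Continuous fun t => φ (min t T) i := fun i => by
    have h1 : Continuous fun t : ℝ≥0 => ((min t T, i) : ℝ≥0 × S) := by fun_prop
    exact h.continuousOn.comp_continuous h1 fun t => ⟨min_le_right t T, mem_univ _⟩
  refine ⟨⟨B, hB'⟩, hcont, fun t ht i => ?_⟩
  have hH : Continuous fun r : ℝ =>
      hamiltonian lam c θ (fun t => φ (min t T)) r.toNNReal i :=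
    (continuous_hamiltonian hlam hc hcont hB' i).comp continuous_real_toNNReal
  have ht' : (t : ℝ) ≤ T := by exact_mod_cast ht
  have key := intervalIntegral.integral_eq_sub_of_hasDeriv_right_of_le
    (f := fun r : ℝ => φ (min r.toNNReal T) i)
    (f' := fun r => -hamiltonian lam c θ (fun t => φ (min t T)) r.toNNReal i) ht'
    ((hcont i).comp continuous_real_toNNReal).continuousOn (fun r hr => ?_)
    (hH.neg.intervalIntegrable _ _)
  · simp only [Real.toNNReal_coe, min_self] at key
    rw [h.terminal, intervalIntegral.integral_neg] at key
    linarith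
  · have hr0 : 0 < r := lt_of_le_of_lt t.2 hr.1
    have hr' : r ∈ Ico 0 (T : ℝ) := ⟨hr0.le, hr.2⟩
    have hrT : r.toNNReal < T := by
      rw [← NNReal.coe_lt_coe, Real.coe_toNNReal r hr0.le]; exact hr.2
    have h1 := ((h.contDiffOn i).differentiableOn one_ne_zero r hr').hasDerivWithinAt
    have h2 := h.equation _ hrT i
    rw [Real.coe_toNNReal r hr0.le] at h2
    rw [eq_neg_of_add_eq_zero_left h2] at h1
    have h3 : (⨅ u : U i, hjbTerm lam c θ φ r.toNNReal i u)
        = hamiltonian lam c θ (fun t => φ (min t T)) r.toNNReal i :=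
      hamiltonian_congr (φ := φ) (ψ := fun t => φ (min t T))
        (fun j => by simp [min_eq_left hrT.le]) i
    rw [h3] at h1
    have h4 := h1.hasDerivAt (Ico_mem_nhds hr0 hr.2)
    refine (h4.congr_of_eventuallyEq ?_).hasDerivWithinAt
    filter_upwards [Ioo_mem_nhds hr0 hr.2] with x hx
    have : x.toNNReal ≤ T := by rw [Real.toNNReal_le_iff_le_coe]; exact hx.2.le
    rw [min_eq_left this]

/-- The HJB equation is an ordinary differential equation for a function with values in the bounded
functions on `S`, with Lipschitz right-hand side; it is solved by Banach's fixed point theorem in an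
exponentially weighted norm. -/
theorem exists_isMildHJBSolution [∀ i, CompactSpace (U i)]
    [∀ i, Nonempty (U i)] [TopologicalSpace S] [DiscreteTopology S]
    (hlam : RateAssumptions lam)
    (hθ : 0 ≤ θ) (hcC : ∀ t i u, |c t i u| ≤ C)
    (hc : ∀ i, Continuous fun p : ℝ≥0 × U i => c p.1 i p.2)
    {g : S → ℝ} {G : ℝ} (hg : ∀ i, g i ≤ G) (T : ℝ≥0) :
    ∃ φ, IsMildHJBSolution lam c g θ T φ := by
  obtain ⟨M, hM0, hM⟩ := hlam.exists_bound
  rcases isEmpty_or_nonempty S with hS | ⟨⟨i₀⟩⟩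
  · exact ⟨fun _ _ => 0, ⟨0, by simp⟩, fun i => hS.elim i, fun _ _ i => hS.elim i⟩
  have hC0 : 0 ≤ C := (abs_nonneg _).trans (hcC 0 i₀ (Classical.arbitrary _))
  set L := θ * C + 2 * M with hL
  have hL0 : 0 < L := by positivity
  let K := 2 * L
  -- the unknown is `exp (K t) * φ t`, which makes the integral operator a contraction
  let tw : BoundedContinuousFunction (ℝ≥0 × S) ℝ → ℝ≥0 → S → ℝ :=
    fun ψ t i => Real.exp (-(K * t)) * ψ (t, i)
  have hexp : ∀ t : ℝ≥0, Real.exp (-(K * t)) ≤ 1 := fun t =>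
    Real.exp_le_one_iff.2 (neg_nonpos.2 (by positivity))
  have htwB : ∀ ψ t i, |tw ψ t i| ≤ ‖ψ‖ := fun ψ t i => by
    simp only [tw, abs_mul, abs_of_pos (Real.exp_pos _)]
    have := ψ.norm_coe_le_norm (t, i)
    rw [Real.norm_eq_abs] at this
    nlinarith [hexp t, abs_nonneg (ψ (t, i)), Real.exp_pos (-(K * t))]
  have htwc : ∀ ψ i, Continuous fun t => tw ψ t i := fun ψ i => by
    simp only [tw]; fun_prop
  have hH : ∀ ψ i, Continuous fun r : ℝ => hamiltonian lam c θ (tw ψ) r.toNNReal i :=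
    fun ψ i => (continuous_hamiltonian hlam hc (htwc ψ) (htwB ψ) i).comp
      continuous_real_toNNReal
  let op : BoundedContinuousFunction (ℝ≥0 × S) ℝ → ℝ≥0 × S → ℝ := fun ψ p =>
    Real.exp (K * (min p.1 T : ℝ≥0)) * (Real.exp (θ * g p.2)
      + ∫ r in ((min p.1 T : ℝ≥0) : ℝ)..T, hamiltonian lam c θ (tw ψ) r.toNNReal p.2)
  have hop_cont : ∀ ψ, Continuous (op ψ) := fun ψ => by
    rw [continuous_prod_of_discrete_right]
    intro i
    have h1 : Continuous fun t : ℝ≥0 => ((min t T : ℝ≥0) : ℝ) := by fun_prop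
    have h2 : Continuous fun x : ℝ =>
        ∫ r in x..T, hamiltonian lam c θ (tw ψ) r.toNNReal i := by
      simp_rw [fun x : ℝ => intervalIntegral.integral_symm (μ := volume)
        (f := fun r : ℝ => hamiltonian lam c θ (tw ψ) r.toNNReal i) (T : ℝ) x]
      exact (intervalIntegral.continuous_primitive
        (fun a b => (hH ψ i).intervalIntegrable a b) T).neg
    exact (Real.continuous_exp.comp (continuous_const.mul h1)).mul
      ((continuous_const (y := Real.exp (θ * g i))).add (h2.comp h1))
  have hop_bdd : ∀ ψ p, ‖op ψ p‖ ≤ Real.exp (K * T)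
      * (Real.exp (θ * G) + L * ‖ψ‖ * T) := fun ψ p => by
    have hmin : ((min p.1 T : ℝ≥0) : ℝ) ≤ T := by exact_mod_cast min_le_right _ _
    have h1 : ‖∫ r in ((min p.1 T : ℝ≥0) : ℝ)..T,
        hamiltonian lam c θ (tw ψ) r.toNNReal p.2‖ ≤ L * ‖ψ‖ * |(T : ℝ) - (min p.1 T : ℝ≥0)| :=
      intervalIntegral.norm_integral_le_of_norm_le_const fun r _ =>
        abs_hamiltonian_le hlam hM hθ hcC (htwB ψ _) p.2
    have h2 : |(T : ℝ) - (min p.1 T : ℝ≥0)| ≤ T := by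
      rw [abs_of_nonneg (by linarith)]
      linarith [NNReal.coe_nonneg (min p.1 T)]
    rw [norm_mul, Real.norm_of_nonneg (Real.exp_pos _).le]
    refine mul_le_mul (Real.exp_le_exp.2 (by gcongr)) ?_ (norm_nonneg _) (Real.exp_pos _).le
    refine (norm_add_le _ _).trans (add_le_add ?_ (h1.trans (by gcongr)))
    rw [Real.norm_of_nonneg (Real.exp_pos _).le]
    exact Real.exp_le_exp.2 (mul_le_mul_of_nonneg_left (hg _) hθ)
  let Φ : BoundedContinuousFunction (ℝ≥0 × S) ℝ → BoundedContinuousFunction (ℝ≥0 × S) ℝ :=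
    fun ψ => BoundedContinuousFunction.ofNormedAddCommGroup (op ψ) (hop_cont ψ) _ (hop_bdd ψ)
  have hΦ : ContractingWith (1 / 2 : ℝ≥0) Φ := by
    refine ⟨by rw [← NNReal.coe_lt_coe]; norm_num, LipschitzWith.of_dist_le_mul fun ψ ψ' => ?_⟩
    rw [BoundedContinuousFunction.dist_le (by positivity)]
    intro p
    change dist (op ψ p) (op ψ' p) ≤ _
    set τ : ℝ := ((min p.1 T : ℝ≥0) : ℝ) with hτ
    have hτT : τ ≤ T := by exact_mod_cast min_le_right _ _
    have hτ0 : 0 ≤ τ := NNReal.coe_nonneg _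
    have e1 : op ψ p - op ψ' p = Real.exp (K * τ) *
        ∫ r in τ..T, (hamiltonian lam c θ (tw ψ) r.toNNReal p.2
          - hamiltonian lam c θ (tw ψ') r.toNNReal p.2) := by
      rw [intervalIntegral.integral_sub ((hH ψ _).intervalIntegrable _ _)
        ((hH ψ' _).intervalIntegrable _ _)]
      simp only [op, ← hτ]; ring
    have e2 : ‖∫ r in τ..T, (hamiltonian lam c θ (tw ψ) r.toNNReal p.2
          - hamiltonian lam c θ (tw ψ') r.toNNReal p.2)‖
        ≤ ∫ r in τ..T, L * dist ψ ψ' * Real.exp (-(K * r)) := by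
      refine intervalIntegral.norm_integral_le_of_norm_le hτT ?_
        (Continuous.intervalIntegrable (by fun_prop) _ _)
      refine Eventually.of_forall fun r hr => ?_
      have hr0 : 0 ≤ r := hτ0.trans hr.1.le
      rw [mul_assoc]
      refine abs_hamiltonian_sub_le hlam hM hθ hcC (B := max ‖ψ‖ ‖ψ'‖)
        (fun j => (htwB ψ _ j).trans (le_max_left _ _))
        (fun j => (htwB ψ' _ j).trans (le_max_right _ _)) (fun j => ?_) p.2
      simp only [tw, ← mul_sub, abs_mul, abs_of_pos (Real.exp_pos _), Real.coe_toNNReal r hr0]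
      rw [mul_comm]
      exact mul_le_mul_of_nonneg_right (by
        rw [← Real.dist_eq]; exact BoundedContinuousFunction.dist_coe_le_dist _)
        (Real.exp_pos _).le
    have e3 : ∫ r in τ..T, L * dist ψ ψ' * Real.exp (-(K * r))
        = L * dist ψ ψ' * ((Real.exp (-(K * τ)) - Real.exp (-(K * T))) / K) := by
      rw [intervalIntegral.integral_const_mul]
      congr 1
      have hK : K ≠ 0 := by positivity
      rw [intervalIntegral.integral_eq_sub_of_hasDerivAt
        (f := fun r => -Real.exp (-(K * r)) / K)]
      · ring
      · intro r _
        have : HasDerivAt (fun r => -(K * r)) (-K) r := by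
          simpa [Pi.neg_def] using ((hasDerivAt_id r).const_mul K).neg
        convert! (this.exp.neg.div_const K) using 1
        field_simp
      · exact Continuous.intervalIntegrable (by fun_prop) _ _
    rw [Real.dist_eq, e1, abs_mul, abs_of_pos (Real.exp_pos _)]
    rw [e3, Real.norm_eq_abs] at e2
    refine (mul_le_mul_of_nonneg_left e2 (Real.exp_pos _).le).trans ?_
    have e4 : Real.exp (K * τ) * Real.exp (-(K * τ)) = 1 := by rw [← Real.exp_add]; simp
    have e5 : Real.exp (K * τ) * (L * dist ψ ψ'
        * ((Real.exp (-(K * τ)) - Real.exp (-(K * T))) / K))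
        = (1 / 2) * dist ψ ψ' * (Real.exp (K * τ) * Real.exp (-(K * τ))
          - Real.exp (K * τ) * Real.exp (-(K * T))) := by
      simp only [K]; field_simp
    rw [e5, e4]
    have : 0 ≤ Real.exp (K * τ) * Real.exp (-(K * T)) := by positivity
    push_cast
    nlinarith [dist_nonneg (x := ψ) (y := ψ')]
  obtain ⟨ψ, hψ⟩ : ∃ ψ, Φ ψ = ψ := ⟨_, hΦ.fixedPoint_isFixedPt⟩
  refine ⟨tw ψ, ⟨‖ψ‖, htwB ψ⟩, htwc ψ, fun t ht i => ?_⟩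
  have h1 : ψ (t, i) = op ψ (t, i) := (DFunLike.congr_fun hψ (t, i)).symm
  simp only [tw] at h1 ⊢
  rw [h1]
  simp only [op, min_eq_left ht]
  rw [← mul_assoc, ← Real.exp_add]
  simp [tw]

end HJBExistence

/-! ### Functionals of the path and the martingale property -/

section PathSpaceMeasurability

variable {S : Type*} [TopologicalSpace S] {F : ℝ≥0 → S → ℝ} {B : ℝ}

/-- The path `ω` stopped at the deterministic time `r`. -/
def PathSpace.stopAt (r : ℝ≥0) (ω : PathSpace S) : PathSpace S :=
  ⟨fun q => ω.1 (min q r), fun t => by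
    refine ContinuousWithinAt.comp (t := Ici (min t r)) (ω.2.1 _)
      (by fun_prop) fun q hq => min_le_min_right r hq, fun t ht => by
    rcases le_or_gt t r with h | h
    · obtain ⟨l, hl⟩ := ω.2.2 t ht
      refine ⟨l, hl.congr' ?_⟩
      filter_upwards [self_mem_nhdsWithin] with q hq
      rw [min_eq_left ((le_of_lt hq).trans h)]
    · refine ⟨ω.1 r, tendsto_const_nhds.congr' ?_⟩
      filter_upwards [mem_nhdsWithin_of_mem_nhds (Ioi_mem_nhds h)] with q hq
      rw [min_eq_right (le_of_lt hq)]⟩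

/-- The additive functional `∫_a^b F(r, X r) dr` of the path. -/
noncomputable def pathIntegral (F : ℝ≥0 → S → ℝ) (a b : ℝ) (ω : PathSpace S) : ℝ :=
  ∫ r in a..b, F r.toNNReal (ω.1 r.toNNReal)

theorem abs_pathIntegral_le (hB : ∀ t x, |F t x| ≤ B) (a b : ℝ) (ω : PathSpace S) :
    |pathIntegral F a b ω| ≤ B * |b - a| :=
  intervalIntegral.norm_integral_le_of_norm_le_const
    (f := fun r : ℝ => F r.toNNReal (ω.1 r.toNNReal)) fun r _ => hB r.toNNReal _

theorem pathIntegral_stop {a b r : ℝ≥0} (ha : a ≤ r) (hb : b ≤ r) (ω : PathSpace S) :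
    pathIntegral F a b (ω.stopAt r) = pathIntegral F a b ω := by
  refine intervalIntegral.integral_congr fun q hq => ?_
  have hq' : q.toNNReal ≤ r := by
    rw [Real.toNNReal_le_iff_le_coe]
    exact hq.2.trans (by exact_mod_cast max_le ha hb)
  simp [PathSpace.stopAt, min_eq_left hq']

variable [MeasurableSpace S]

theorem PathSpace.measurable_eval (r : ℝ≥0) : Measurable fun ω : PathSpace S => ω.1 r :=
  (measurable_pi_apply r).comp measurable_subtype_coe

theorem PathSpace.measurable_stop (r : ℝ≥0) :
    Measurable[canonicalFiltration S r] (PathSpace.stopAt r : PathSpace S → PathSpace S) := by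
  refine @Measurable.subtype_mk (PathSpace S) (ℝ≥0 → S) (canonicalFiltration S r) _ IsCadlag
    (fun ω q => ω.1 (min q r))
    (@measurable_pi_lambda (PathSpace S) _ _ (canonicalFiltration S r) _ _ fun q => ?_) _
  rw [measurable_iff_comap_le]
  exact le_iSup_of_le (min q r) (le_iSup_of_le (min_le_right q r) le_rfl)

/-- A measurable functional of the path that only depends on the path up to time `r` is
`F r`-measurable. -/
theorem PathSpace.measurable_of_stop {β : Type*} [MeasurableSpace β] {r : ℝ≥0}
    {Φ : PathSpace S → β} (hΦ : Measurable Φ) (h : ∀ ω, Φ (ω.stopAt r) = Φ ω) :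
    Measurable[canonicalFiltration S r] Φ := by
  have : Φ = Φ ∘ PathSpace.stopAt r := funext fun ω => (h ω).symm
  rw [this]
  exact hΦ.comp (PathSpace.measurable_stop r)

variable [DiscreteTopology S] [BorelSpace S]

/-- By right-continuity the canonical process is jointly measurable in time and path. -/
theorem PathSpace.measurable_uncurry_eval :
    Measurable fun p : ℝ≥0 × PathSpace S => p.2.1 p.1 := by
  -- grid times, with values in a countable set, that converge to `q` from the right
  let a : ℕ → ℝ≥0 → ℝ≥0 := fun n q => (⌊(n + 1 : ℝ≥0) * q⌋₊ + 1 : ℝ≥0) / (n + 1)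
  have hlt : ∀ n q, q ≤ a n q := fun n q => by
    rw [le_div_iff₀ (by positivity), mul_comm]
    exact (Nat.lt_floor_add_one _).le
  have hle : ∀ n q, a n q ≤ q + 1 / (n + 1) := fun n q => by
    have h0 : (0 : ℝ≥0) < n + 1 := by positivity
    rw [div_le_iff₀ h0, add_mul q, div_mul_cancel₀ _ h0.ne', mul_comm q]
    exact add_le_add_left (Nat.floor_le (by positivity)) 1
  have hlim : ∀ q, Tendsto (fun n => a n q) atTop (𝓝[≥] q) := fun q => by
    refine tendsto_nhdsWithin_iff.2 ⟨?_, Eventually.of_forall fun n => hlt n q⟩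
    refine tendsto_of_tendsto_of_tendsto_of_le_of_le tendsto_const_nhds ?_
      (fun n => hlt n q) (fun n => hle n q)
    have : Tendsto (fun n : ℕ => (1 : ℝ≥0) / (n + 1)) atTop (𝓝 0) :=
      tendsto_one_div_add_atTop_nhds_zero_nat
    simpa using this.const_add q
  refine measurable_of_tendsto_metrizable (f := fun n (p : ℝ≥0 × PathSpace S) => p.2.1 (a n p.1))
    (fun n => ?_) (tendsto_pi_nhds.2 fun p => ?_)
  · have h1 : Measurable fun p : ℕ × PathSpace S => p.2.1 ((p.1 + 1 : ℝ≥0) / (n + 1)) :=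
      measurable_from_prod_countable_right fun k =>
        PathSpace.measurable_eval ((k + 1 : ℝ≥0) / (n + 1))
    have h2 : Measurable fun p : ℝ≥0 × PathSpace S => (⌊(n + 1 : ℝ≥0) * p.1⌋₊, p.2) :=
      (Nat.measurable_floor.comp (measurable_const.mul measurable_fst)).prodMk measurable_snd
    exact h1.comp h2
  · exact (p.2.2.1 p.1).tendsto.comp (hlim p.1)

variable [Countable S]

theorem measurable_path_uncurry (hF : ∀ x, Measurable fun t => F t x) :
    Measurable fun p : ℝ × PathSpace S => F p.1.toNNReal (p.2.1 p.1.toNNReal) := by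
  have h1 : Measurable fun p : ℝ≥0 × S => F p.1 p.2 :=
    measurable_from_prod_countable_left fun x => hF x
  have h2 : Measurable fun p : ℝ × PathSpace S => (p.1.toNNReal, p.2) :=
    (measurable_real_toNNReal.comp measurable_fst).prodMk measurable_snd
  exact h1.comp ((measurable_fst.comp h2).prodMk (PathSpace.measurable_uncurry_eval.comp h2))

theorem measurable_path (hF : ∀ x, Measurable fun t => F t x) (ω : PathSpace S) :
    Measurable fun r : ℝ => F r.toNNReal (ω.1 r.toNNReal) :=
  (measurable_path_uncurry hF).comp measurable_prodMk_right

theorem intervalIntegrable_path (hF : ∀ x, Measurable fun t => F t x) (hB : ∀ t x, |F t x| ≤ B)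
    (ω : PathSpace S) (a b : ℝ) :
    IntervalIntegrable (fun r : ℝ => F r.toNNReal (ω.1 r.toNNReal)) volume a b :=
  (intervalIntegrable_const (c := B)).mono_fun (measurable_path hF ω).aestronglyMeasurable
    (Eventually.of_forall fun r => by
      simpa using (hB _ _).trans (le_abs_self B))

theorem measurable_pathIntegral (hF : ∀ x, Measurable fun t => F t x) (a b : ℝ) :
    Measurable (pathIntegral F a b) := by
  have h1 := (measurable_path_uncurry hF).stronglyMeasurable
  have h2 : ∀ s : Set ℝ, Measurable fun ω : PathSpace S =>
      ∫ r in s, F r.toNNReal (ω.1 r.toNNReal) := fun s =>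
    (StronglyMeasurable.integral_prod_left (μ := volume.restrict s)
      (f := fun (r : ℝ) (ω : PathSpace S) => F r.toNNReal (ω.1 r.toNNReal)) h1).measurable
  exact (h2 _).sub (h2 _)

theorem pathIntegral_add_adjacent (hF : ∀ x, Measurable fun t => F t x)
    (hB : ∀ t x, |F t x| ≤ B) (a b d : ℝ) (ω : PathSpace S) :
    pathIntegral F a b ω + pathIntegral F b d ω = pathIntegral F a d ω :=
  intervalIntegral.integral_add_adjacent_intervals (intervalIntegrable_path hF hB ω a b)
    (intervalIntegrable_path hF hB ω b d)

theorem measurable_integral_path {P : Measure (PathSpace S)} [IsProbabilityMeasure P]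
    (hF : ∀ x, Measurable fun t => F t x) {ξ : PathSpace S → ℝ} (hξ : Measurable ξ) :
    Measurable fun r : ℝ => ∫ ω, ξ ω * F r.toNNReal (ω.1 r.toNNReal) ∂P := by
  have h1 : StronglyMeasurable fun p : ℝ × PathSpace S =>
      ξ p.2 * F p.1.toNNReal (p.2.1 p.1.toNNReal) :=
    ((hξ.comp measurable_snd).mul (measurable_path_uncurry hF)).stronglyMeasurable
  exact (h1.integral_prod_right (ν := P)).measurable

theorem abs_integral_le_of_abs_le {Ω : Type*} [MeasurableSpace Ω] {P : Measure Ω}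
    [IsProbabilityMeasure P] {f : Ω → ℝ} {B : ℝ} (h : ∀ ω, |f ω| ≤ B) : |∫ ω, f ω ∂P| ≤ B := by
  simpa using norm_integral_le_of_norm_le_const (μ := P) (f := f) (Eventually.of_forall h)

theorem integrable_of_abs_le {Ω : Type*} [MeasurableSpace Ω] {P : Measure Ω}
    [IsFiniteMeasure P] {f : Ω → ℝ} (hf : Measurable f) {B : ℝ} (h : ∀ ω, |f ω| ≤ B) :
    Integrable f P :=
  Integrable.of_bound hf.aestronglyMeasurable B (Eventually.of_forall h)

theorem integral_mul_pathIntegral {P : Measure (PathSpace S)} [IsProbabilityMeasure P]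
    (hF : ∀ x, Measurable fun t => F t x) (hB : ∀ t x, |F t x| ≤ B)
    {ξ : PathSpace S → ℝ} (hξ : Measurable ξ) {D : ℝ} (hD : ∀ ω, |ξ ω| ≤ D) {a b : ℝ}
    (hab : a ≤ b) :
    ∫ ω, ξ ω * pathIntegral F a b ω ∂P
      = ∫ r in a..b, ∫ ω, ξ ω * F r.toNNReal (ω.1 r.toNNReal) ∂P := by
  simp only [pathIntegral, intervalIntegral.integral_of_le hab, ← integral_const_mul]
  refine integral_integral_swap
    (f := fun (ω : PathSpace S) (r : ℝ) => ξ ω * F r.toNNReal (ω.1 r.toNNReal)) ?_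
  have h1 : Measurable fun p : PathSpace S × ℝ => ξ p.1 * F p.2.toNNReal (p.1.1 p.2.toNNReal) :=
    (hξ.comp measurable_fst).mul ((measurable_path_uncurry hF).comp measurable_swap)
  refine integrable_of_abs_le h1 (B := D * B) fun p => ?_
  rw [Function.uncurry_def, abs_mul]
  exact mul_le_mul (hD _) (hB _ _) (abs_nonneg _) ((abs_nonneg _).trans (hD p.1))

end PathSpaceMeasurability

section MartingaleProblem

variable {S : Type*} [Countable S] [TopologicalSpace S] [DiscreteTopology S]
  [MeasurableSpace S] [BorelSpace S]
  {U : S → Type*} [∀ i, MetricSpace (U i)] [∀ i, MeasurableSpace (U i)] [∀ i, BorelSpace (U i)]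
  {lam : (i : S) → S → U i → ℝ} {u : MarkovControl U} {M : ℝ}

omit [Countable S] [TopologicalSpace S] [DiscreteTopology S] [MeasurableSpace S] [BorelSpace S] in
theorem measurable_generator (hlam : RateAssumptions lam) {f : S → ℝ} {B : ℝ}
    (hf : ∀ j, |f j| ≤ B) (x : S) : Measurable fun t => generator lam u t f x :=
  (hlam.continuous_tsum x continuous_id (F := fun _ => f) (fun _ => continuous_const)
    (fun _ => hf)).measurable.comp (u.measurable_act x)

omit [Countable S] [DiscreteTopology S] [MeasurableSpace S] [BorelSpace S] [TopologicalSpace S]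
  [∀ i, BorelSpace (U i)] in
theorem abs_generator_le (hlam : RateAssumptions lam) (hM : ∀ i u, -lam i i u ≤ M) {f : S → ℝ}
    {B : ℝ} (hf : ∀ j, |f j| ≤ B) (t : ℝ≥0) (x : S) : |generator lam u t f x| ≤ 2 * M * B :=
  hlam.abs_tsum_le hM x _ hf

/-- The martingale property, tested against a bounded random variable known at time `a`. -/
theorem SolvesMartingaleProblem.integral_mul_increment (hlam : RateAssumptions lam)
    {s : ℝ≥0} {μ : Measure S} {P : Measure (PathSpace S)}
    (h : SolvesMartingaleProblem lam u s μ P) {a b : ℝ≥0} (hab : a ≤ b)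
    {ξ : PathSpace S → ℝ} (hξ : Measurable[canonicalFiltration S a] ξ) {D : ℝ}
    (hD : ∀ ω, |ξ ω| ≤ D) {f : S → ℝ} {B : ℝ} (hf : ∀ j, |f j| ≤ B) :
    ∫ ω, ξ ω * f (ω.1 b) ∂P = ∫ ω, ξ ω * f (ω.1 a) ∂P
      + ∫ ω, ξ ω * pathIntegral (fun t => generator lam u t f) (max s a : ℝ≥0) (max s b : ℝ≥0) ω
        ∂P := by
  have := h.isProbabilityMeasure
  obtain ⟨M, -, hM⟩ := hlam.exists_bound
  have hmart := h.martingale f ⟨B, hf⟩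
  set A : ℝ≥0 → PathSpace S → ℝ := fun t =>
    pathIntegral (fun t => generator lam u t f) s (max s t : ℝ≥0)
  set N : ℝ≥0 → PathSpace S → ℝ := fun t ω => f (ω.1 t) - A t ω
  have hN : Martingale N (canonicalFiltration S) P := hmart
  have hgm := fun x => measurable_generator (u := u) hlam hf x
  have hgb := fun t x => abs_generator_le (u := u) hlam hM hf t x
  have hξ' : Measurable ξ := hξ.mono ((canonicalFiltration S).le a) le_rfl
  have hfm : ∀ t, Measurable fun ω : PathSpace S => f (ω.1 t) := fun t =>
    (measurable_of_countable f).comp (PathSpace.measurable_eval t)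
  have i1 : ∀ t, Integrable (fun ω => ξ ω * f (ω.1 t)) P := fun t =>
    integrable_of_abs_le (hξ'.mul (hfm t)) (B := D * B) fun ω => by
      rw [abs_mul]
      exact mul_le_mul (hD _) (hf _) (abs_nonneg _) ((abs_nonneg _).trans (hD ω))
  have i2 : ∀ x y : ℝ, Integrable (fun ω => ξ ω *
      pathIntegral (fun t => generator lam u t f) x y ω) P := fun x y =>
    integrable_of_abs_le (hξ'.mul (measurable_pathIntegral hgm _ _))
      (B := D * (2 * M * B * |y - x|)) fun ω => by
      rw [abs_mul]
      exact mul_le_mul (hD _) (abs_pathIntegral_le hgb _ _ _) (abs_nonneg _)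
        ((abs_nonneg _).trans (hD ω))
  have i3 : ∀ t, Integrable (ξ * N t) P := fun t => by
    refine ((i1 t).sub (i2 s (max s t : ℝ≥0))).congr (Eventually.of_forall fun ω => ?_)
    simp [N, A, mul_sub]
  have key : ∫ ω, ξ ω * N b ω ∂P = ∫ ω, ξ ω * N a ω ∂P := by
    have e1 := condExp_mul_of_stronglyMeasurable_left (f := ξ) (m := canonicalFiltration S a)
      hξ.stronglyMeasurable (i3 b)
      (hN.integrable b)
    have e2 := hN.2 a b hab
    calc ∫ ω, ξ ω * N b ω ∂P = ∫ ω, (P[ξ * N b | canonicalFiltration S a]) ω ∂P :=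
          (integral_condExp ((canonicalFiltration S).le a)).symm
      _ = ∫ ω, ξ ω * N a ω ∂P := by
          refine integral_congr_ae ?_
          filter_upwards [e1, e2] with ω h1 h2
          rw [h1, Pi.mul_apply, h2]
  have e3 : ∀ t, ∫ ω, ξ ω * N t ω ∂P = ∫ ω, ξ ω * f (ω.1 t) ∂P - ∫ ω, ξ ω * A t ω ∂P :=
    fun t => by
      rw [← integral_sub (i1 t) (i2 _ _)]
      simp only [N, A, mul_sub]
  rw [e3, e3] at key
  have e4 : ∀ ω, pathIntegral (fun t => generator lam u t f) (max s a : ℝ≥0) (max s b : ℝ≥0) ω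
      = A b ω - A a ω := fun ω => by
    simp only [A]
    rw [← pathIntegral_add_adjacent hgm hgb s (max s a : ℝ≥0) (max s b : ℝ≥0) ω]
    ring
  simp only [e4, mul_sub]
  simp only [A] at key ⊢
  rw [integral_sub (i2 _ _) (i2 _ _)]
  linarith

end MartingaleProblem

/-! ### Uniqueness for the martingale problem -/

section Uniqueness

variable {S : Type*} [Countable S] [TopologicalSpace S] [DiscreteTopology S]
  [MeasurableSpace S] [BorelSpace S]
  {U : S → Type*} [∀ i, MetricSpace (U i)] [∀ i, MeasurableSpace (U i)] [∀ i, BorelSpace (U i)]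
  {lam : (i : S) → S → U i → ℝ} {u : MarkovControl U}
  {s : ℝ≥0} {μ ν : Measure S} {P Q : Measure (PathSpace S)}

theorem integral_pow_sub_div_factorial (a b K c : ℝ) (n : ℕ) :
    ∫ r in a..b, c * K * ((K * (r - a)) ^ n / n.factorial)
      = c * ((K * (b - a)) ^ (n + 1) / (n + 1).factorial) := by
  have h : ∀ r : ℝ, HasDerivAt (fun r => c * ((K * (r - a)) ^ (n + 1) / (n + 1).factorial))
      (c * K * ((K * (r - a)) ^ n / n.factorial)) r := fun r => by
    have h1 : HasDerivAt (fun r => K * (r - a)) K r := by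
      simpa using ((hasDerivAt_id r).sub_const a).const_mul K
    convert! ((h1.pow (n + 1)).div_const ((n + 1).factorial : ℝ)).const_mul c using 1
    rw [Nat.factorial_succ]
    push_cast
    have : (n.factorial : ℝ) ≠ 0 := by positivity
    field_simp
  rw [intervalIntegral.integral_eq_sub_of_hasDerivAt (fun r _ => h r)
    (Continuous.intervalIntegrable (by fun_prop) _ _)]
  simp

/-- If two solutions assign the same weighted one-dimensional law at time `a`, with a weight
known at time `a`, they do so at all later times: both satisfy the same forward equation, and
the `n`-th iterate of the resulting estimate is `O((K (b - a)) ^ n / n!)`. -/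
theorem SolvesMartingaleProblem.integral_mul_eq_of_le (hlam : RateAssumptions lam)
    (hP : SolvesMartingaleProblem lam u s μ P) (hQ : SolvesMartingaleProblem lam u s ν Q)
    {a : ℝ≥0} {ξ : PathSpace S → ℝ} (hξ : Measurable[canonicalFiltration S a] ξ) {D : ℝ}
    (hD : ∀ ω, |ξ ω| ≤ D)
    (h0 : ∀ (f : S → ℝ) (B : ℝ), (∀ j, |f j| ≤ B) →
      ∫ ω, ξ ω * f (ω.1 a) ∂P = ∫ ω, ξ ω * f (ω.1 a) ∂Q)
    {b : ℝ≥0} (hab : a ≤ b) {f : S → ℝ} {B : ℝ} (hf : ∀ j, |f j| ≤ B) :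
    ∫ ω, ξ ω * f (ω.1 b) ∂P = ∫ ω, ξ ω * f (ω.1 b) ∂Q := by
  have := hP.isProbabilityMeasure
  have := hQ.isProbabilityMeasure
  obtain ⟨M, hM0, hM⟩ := hlam.exists_bound
  have hξ' : Measurable ξ := hξ.mono ((canonicalFiltration S).le a) le_rfl
  set K := 2 * M with hK
  have hprod : ∀ (f : S → ℝ) (B : ℝ), (∀ j, |f j| ≤ B) → ∀ b (ω : PathSpace S),
      |ξ ω * f (ω.1 b)| ≤ D * B := fun f B hf b ω => by
    rw [abs_mul]
    exact mul_le_mul (hD _) (hf _) (abs_nonneg _) ((abs_nonneg _).trans (hD ω))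
  have key : ∀ (n : ℕ) (f : S → ℝ) (B : ℝ), (∀ j, |f j| ≤ B) → ∀ b, a ≤ b →
      |∫ ω, ξ ω * f (ω.1 b) ∂P - ∫ ω, ξ ω * f (ω.1 b) ∂Q|
        ≤ 2 * D * B * ((K * ((max s b : ℝ≥0) - (max s a : ℝ≥0))) ^ n / n.factorial) := by
    intro n
    induction n with
    | zero =>
      intro f B hf b hab
      have h1 := abs_integral_le_of_abs_le (P := P) (hprod f B hf b)
      have h2 := abs_integral_le_of_abs_le (P := Q) (hprod f B hf b)
      have h3 := abs_sub (∫ ω, ξ ω * f (ω.1 b) ∂P) (∫ ω, ξ ω * f (ω.1 b) ∂Q)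
      simp only [pow_zero, Nat.factorial_zero, Nat.cast_one, div_one, mul_one]
      linarith
    | succ n ih =>
      intro f B hf b hab
      have hgm := fun x => measurable_generator (u := u) hlam hf x
      have hgb := fun t x => abs_generator_le (u := u) hlam hM hf t x
      have hmax : ((max s a : ℝ≥0) : ℝ) ≤ (max s b : ℝ≥0) := by
        exact_mod_cast max_le_max_left s hab
      rw [hP.integral_mul_increment hlam hab hξ hD hf, hQ.integral_mul_increment hlam hab hξ hD hf,
        h0 f B hf, add_sub_add_left_eq_sub, integral_mul_pathIntegral hgm hgb hξ' hD hmax,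
        integral_mul_pathIntegral hgm hgb hξ' hD hmax]
      have hint : ∀ (ρ : Measure (PathSpace S)) [IsProbabilityMeasure ρ], IntervalIntegrable
          (fun r : ℝ => ∫ ω, ξ ω * generator lam u r.toNNReal f (ω.1 r.toNNReal) ∂ρ)
          volume (max s a : ℝ≥0) (max s b : ℝ≥0) := fun ρ _ => by
        refine (intervalIntegrable_const (c := D * (2 * M * B))).mono_fun
          (measurable_integral_path hgm hξ').aestronglyMeasurable (Eventually.of_forall fun r => ?_)
        exact (abs_integral_le_of_abs_le fun ω => hprod _ _ (hgb r.toNNReal) r.toNNReal ω).trans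
          (le_abs_self _)
      rw [← intervalIntegral.integral_sub (hint P) (hint Q),
        ← integral_pow_sub_div_factorial _ _ K (2 * D * B) n, ← Real.norm_eq_abs]
      have hcont : Continuous fun r : ℝ => 2 * D * B * K *
          ((K * (r - (max s a : ℝ≥0))) ^ n / n.factorial) := by fun_prop
      refine intervalIntegral.norm_integral_le_of_norm_le (μ := volume) hmax
        (Eventually.of_forall fun r hr => ?_)
        (hcont.intervalIntegrable _ _)
      have hr0 : 0 ≤ r := (NNReal.coe_nonneg _).trans hr.1.le
      have hsr : max s a ≤ r.toNNReal := by
        rw [← NNReal.coe_le_coe, Real.coe_toNNReal r hr0]; exact hr.1.le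
      have := ih (generator lam u r.toNNReal f) (2 * M * B) (hgb _) r.toNNReal
        ((le_max_right _ _).trans hsr)
      rw [max_eq_right ((le_max_left _ _).trans hsr), Real.coe_toNNReal r hr0] at this
      refine this.trans (le_of_eq ?_)
      rw [hK]; ring
  have hlim : Tendsto (fun n : ℕ => 2 * D * B *
      ((K * ((max s b : ℝ≥0) - (max s a : ℝ≥0))) ^ n / n.factorial)) atTop (𝓝 0) := by
    simpa using (FloorSemiring.tendsto_pow_div_factorial_atTop
      (K * ((max s b : ℝ≥0) - (max s a : ℝ≥0) : ℝ))).const_mul (2 * D * B)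
  have := ge_of_tendsto' hlim fun n => key n f B hf b hab
  exact sub_eq_zero.1 (abs_eq_zero.1 (le_antisymm this (abs_nonneg _)))

omit [∀ i, MetricSpace (U i)] [∀ i, BorelSpace (U i)] in
theorem SolvesMartingaleProblem.integral_initial {i : S} {r : ℝ≥0}
    (hP : SolvesMartingaleProblem lam u s (Measure.dirac i) P) (hr : r ≤ s) (f : S → ℝ) :
    ∫ ω, f (ω.1 r) ∂P = f i := by
  have h1 : ∫ ω, f (ω.1 r) ∂P = ∫ ω, f (ω.1 s) ∂P := by
    refine integral_congr_ae ?_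
    filter_upwards [hP.frozen] with ω hω
    rw [hω r hr]
  rw [h1, ← integral_map (PathSpace.measurable_eval s).aemeasurable
    (measurable_of_countable f).aestronglyMeasurable, hP.initial, integral_dirac]

/-- Two solutions with the same starting point have the same finite-dimensional laws: induction on
the largest time, with the factors of the earlier times as the weight. -/
theorem SolvesMartingaleProblem.integral_prod_eq (hlam : RateAssumptions lam) {i : S}
    (hP : SolvesMartingaleProblem lam u s (Measure.dirac i) P)
    (hQ : SolvesMartingaleProblem lam u s (Measure.dirac i) Q)
    {h : ℝ≥0 → S → ℝ} (hh : ∀ r x, |h r x| ≤ 1) (I : Finset ℝ≥0) :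
    ∀ b : ℝ≥0, (∀ r ∈ I, r ≤ b) → ∀ (f : S → ℝ) (B : ℝ), (∀ j, |f j| ≤ B) →
      ∫ ω, (∏ r ∈ I, h r (ω.1 r)) * f (ω.1 b) ∂P
        = ∫ ω, (∏ r ∈ I, h r (ω.1 r)) * f (ω.1 b) ∂Q := by
  induction I using Finset.induction_on_max with
  | empty =>
    intro b _ f B hf
    have h1 := hP.integral_mul_eq_of_le hlam hQ (a := 0) (ξ := fun _ => 1) (D := 1)
      measurable_const (by simp) (fun f B _ => by
        simp only [one_mul]
        rw [hP.integral_initial (zero_le) f, hQ.integral_initial (zero_le) f])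
      (zero_le : 0 ≤ b) hf
    simpa using h1
  | insert a I ha ih =>
    intro b hb f B hf
    have hnot : a ∉ I := fun h => lt_irrefl _ (ha a h)
    refine hP.integral_mul_eq_of_le hlam hQ (a := a) (D := 1) ?_ (fun ω => ?_)
      (fun f B hf => ?_) (hb a (Finset.mem_insert_self a I)) hf
    · refine PathSpace.measurable_of_stop ?_ fun ω => Finset.prod_congr rfl fun r hr => ?_
      · exact Finset.measurable_prod _ fun r _ =>
          (measurable_of_countable (h r)).comp (PathSpace.measurable_eval r)
      · have : r ≤ a := by
          rcases Finset.mem_insert.1 hr with rfl | hr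
          · exact le_rfl
          · exact (ha r hr).le
        simp [PathSpace.stopAt, min_eq_left this]
    · rw [Finset.abs_prod]
      exact Finset.prod_le_one (fun _ _ => abs_nonneg _) fun r _ => hh r _
    · have := ih a (fun r hr => (ha r hr).le) (fun x => h a x * f x) B fun j => by
        rw [abs_mul]
        nlinarith [hh a j, hf j, abs_nonneg (h a j), abs_nonneg (f j)]
      simp only [Finset.prod_insert hnot]
      convert this using 2 <;> (funext ω; ring)

/-- Uniqueness for the martingale problem: the `σ`-algebra of path space is generated by the
coordinates, so that a law is determined by its finite-dimensional marginals. -/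
theorem SolvesMartingaleProblem.unique (hlam : RateAssumptions lam) {i : S}
    (hP : SolvesMartingaleProblem lam u s (Measure.dirac i) P)
    (hQ : SolvesMartingaleProblem lam u s (Measure.dirac i) Q) : P = Q := by
  classical
  have := hP.isProbabilityMeasure
  have := hQ.isProbabilityMeasure
  have hval : Measurable (Subtype.val : PathSpace S → ℝ≥0 → S) := measurable_subtype_coe
  have hfd : ∀ I : Finset ℝ≥0, (P.map Subtype.val).map I.restrict
      = (Q.map Subtype.val).map I.restrict := by
    intro I
    rw [Measure.map_map (Finset.measurable_restrict I) hval,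
      Measure.map_map (Finset.measurable_restrict I) hval]
    have hmeas : Measurable (I.restrict ∘ (Subtype.val : PathSpace S → ℝ≥0 → S)) :=
      (Finset.measurable_restrict I).comp hval
    refine Measure.ext_of_singleton fun x => ?_
    rw [Measure.map_apply hmeas (measurableSet_singleton x),
      Measure.map_apply hmeas (measurableSet_singleton x)]
    set A : Set (PathSpace S) := (I.restrict ∘ Subtype.val) ⁻¹' {x}
    have hA : MeasurableSet A := hmeas (measurableSet_singleton x)
    let h : ℝ≥0 → S → ℝ := fun r y => if hr : r ∈ I then (if y = x ⟨r, hr⟩ then 1 else 0) else 0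
    have hind : ∀ ω : PathSpace S, A.indicator (fun _ => (1 : ℝ)) ω
        = (∏ r ∈ I, h r (ω.1 r)) * (fun _ : S => (1 : ℝ)) (ω.1 (I.sup id)) := fun ω => by
      rw [mul_one]
      by_cases hω : ω ∈ A
      · rw [indicator_of_mem hω]
        refine (Finset.prod_eq_one fun r hr => ?_).symm
        have : ω.1 r = x ⟨r, hr⟩ := congrFun (show (I.restrict ∘ Subtype.val) ω = x from hω) ⟨r, hr⟩
        simp [h, hr, this]
      · rw [indicator_of_notMem hω]
        have : ∃ r : I, ω.1 r ≠ x r := by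
          by_contra! hcon
          exact hω (show (I.restrict ∘ Subtype.val) ω = x from funext hcon)
        obtain ⟨⟨r, hr⟩, hne⟩ := this
        refine (Finset.prod_eq_zero hr ?_).symm
        simp [h, hr, hne]
    have heq : P.real A = Q.real A := by
      rw [← integral_indicator_one hA, ← integral_indicator_one hA]
      have := hP.integral_prod_eq hlam hQ (h := h) (fun r y => by
        simp only [h]; split_ifs <;> simp) I (I.sup id) (fun r hr => Finset.le_sup (f := id) hr)
        (fun _ => 1) 1 (by simp)
      calc ∫ ω, A.indicator 1 ω ∂P
          = ∫ ω, (∏ r ∈ I, h r (ω.1 r)) * (fun _ : S => (1 : ℝ)) (ω.1 (I.sup id)) ∂P :=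
            integral_congr_ae (Eventually.of_forall hind)
        _ = _ := this
        _ = ∫ ω, A.indicator 1 ω ∂Q := (integral_congr_ae (Eventually.of_forall hind)).symm
    exact (measureReal_eq_measureReal_iff).1 heq
  have hmap : P.map Subtype.val = Q.map Subtype.val := by
    have h1 : IsProjectiveLimit (P.map Subtype.val)
        (fun I : Finset ℝ≥0 => (P.map (Subtype.val : PathSpace S → ℝ≥0 → S)).map I.restrict) :=
      fun I => rfl
    have h2 : IsProjectiveLimit (Q.map Subtype.val)
        (fun I : Finset ℝ≥0 => (P.map (Subtype.val : PathSpace S → ℝ≥0 → S)).map I.restrict) :=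
      fun I => (hfd I).symm
    exact h1.unique h2
  refine Measure.ext fun A hA => ?_
  obtain ⟨B, hB, rfl⟩ := hA
  rw [← Measure.map_apply hval hB, hmap, Measure.map_apply hval hB]

end Uniqueness

/-! ### The Feynman–Kac inequality -/

section SmallIncrements

/-- A function whose increments over short intervals are at least `-A (b - a) ^ 2` is
non-decreasing. -/
theorem le_of_increment_ge_neg_sq {h : ℝ≥0 → ℝ} {t T : ℝ≥0} (htT : t ≤ T) {A δ : ℝ} (hδ : 0 < δ)
    (H : ∀ a b : ℝ≥0, t ≤ a → a ≤ b → b ≤ T → (b - a : ℝ) ≤ δ →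
      -(A * (b - a : ℝ) ^ 2) ≤ h b - h a) :
    h t ≤ h T := by
  obtain ⟨D, rfl⟩ := le_iff_exists_add.1 htT
  have key : ∀ n : ℕ, 0 < n → (D / n : ℝ) ≤ δ → h t - n * (A * (D / n : ℝ) ^ 2) ≤ h (t + D) := by
    intro n hn hnδ
    have hn' : (n : ℝ≥0) ≠ 0 := by exact_mod_cast hn.ne'
    have step : ∀ k : ℕ, k ≤ n →
        h t - k * (A * (D / n : ℝ) ^ 2) ≤ h (t + k * (D / n)) := by
      intro k
      induction k with
      | zero => simp
      | succ k ih =>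
        intro hk
        have hle : t + ((k + 1 : ℕ) : ℝ≥0) * (D / n) ≤ t + D := by
          gcongr
          calc ((k + 1 : ℕ) : ℝ≥0) * (D / n) ≤ n * (D / n) := by gcongr
            _ = D := mul_div_cancel₀ D hn'
        have hdiff : ((t + ((k + 1 : ℕ) : ℝ≥0) * (D / n) : ℝ≥0) : ℝ)
            - ((t + (k : ℝ≥0) * (D / n) : ℝ≥0) : ℝ) = D / n := by
          push_cast; ring
        have h1 := H (t + k * (D / n)) (t + ((k + 1 : ℕ) : ℝ≥0) * (D / n)) le_self_add
          (by gcongr; simp) hle (by rw [hdiff]; exact hnδ)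
        rw [hdiff] at h1
        have h2 := ih (Nat.le_of_succ_le hk)
        push_cast at h1 ⊢
        linarith
    have := step n le_rfl
    rwa [mul_div_cancel₀ D hn'] at this
  have hlim0 : Tendsto (fun n : ℕ => (D : ℝ) / n) atTop (𝓝 0) :=
    tendsto_const_div_atTop_nhds_zero_nat _
  have hlim : Tendsto (fun n : ℕ => h t - A * D * (D / n : ℝ)) atTop (𝓝 (h t)) := by
    simpa using (hlim0.const_mul (A * D)).const_sub (h t)
  refine le_of_tendsto hlim ?_
  filter_upwards [hlim0.eventually_le_const hδ, eventually_gt_atTop 0] with n h1 h2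
  refine le_trans (le_of_eq ?_) (key n h2 h1)
  have : (n : ℝ) ≠ 0 := by exact_mod_cast h2.ne'
  field_simp

variable {S : Type*} [Countable S] [TopologicalSpace S] [DiscreteTopology S]
  [MeasurableSpace S] [BorelSpace S]
  {U : S → Type*} [∀ i, MetricSpace (U i)] [∀ i, MeasurableSpace (U i)] [∀ i, BorelSpace (U i)]
  {lam : (i : S) → S → U i → ℝ} {u : MarkovControl U}
  {s : ℝ≥0} {μ : Measure S} {P : Measure (PathSpace S)} {M : ℝ}

open Classical in
/-- The indicator of the event that the path is in different states at times `q` and `b`, as a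
real-valued function of the path. -/
noncomputable def movedIndicator (b q : ℝ≥0) (ω : PathSpace S) : ℝ :=
  if ω.1 q = ω.1 b then 0 else 1

theorem measurable_movedIndicator (b : ℝ≥0) :
    Measurable fun p : ℝ × PathSpace S => movedIndicator b p.1.toNNReal p.2 := by
  classical
  have h1 : Measurable fun p : S × S => if p.1 = p.2 then (0 : ℝ) else 1 :=
    measurable_of_countable _
  have h2 : Measurable fun p : ℝ × PathSpace S => (p.2.1 p.1.toNNReal, p.2.1 b) :=
    (PathSpace.measurable_uncurry_eval.comp
      ((measurable_real_toNNReal.comp measurable_fst).prodMk measurable_snd)).prodMk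
      ((PathSpace.measurable_eval b).comp measurable_snd)
  convert h1.comp h2 using 1
  funext p
  simp [movedIndicator]

omit [Countable S] [DiscreteTopology S] [MeasurableSpace S] [BorelSpace S] in
theorem movedIndicator_mem (b q : ℝ≥0) (ω : PathSpace S) :
    0 ≤ movedIndicator b q ω ∧ movedIndicator b q ω ≤ 1 := by
  unfold movedIndicator; split_ifs <;> simp

/-- The probability of a move in `[q, b]` is of first order in `b - q`. -/
theorem SolvesMartingaleProblem.integral_movedIndicator_le (hlam : RateAssumptions lam)
    (hM : ∀ i u, -lam i i u ≤ M) (hP : SolvesMartingaleProblem lam u s μ P) {q b : ℝ≥0}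
    (hsq : s ≤ q) (hqb : q ≤ b) :
    ∫ ω, movedIndicator b q ω ∂P ≤ 2 * M * (b - q) := by
  classical
  have := hP.isProbabilityMeasure
  let A : S → Set (PathSpace S) := fun x => {ω | ω.1 q = x}
  have hA : ∀ x, MeasurableSet (A x) := fun x =>
    PathSpace.measurable_eval q (measurableSet_singleton x)
  have hAu : ⋃ x, A x = univ := eq_univ_of_forall fun ω => mem_iUnion.2 ⟨ω.1 q, rfl⟩
  have hAd : Pairwise (Function.onFun Disjoint A) := fun x y hxy =>
    disjoint_left.2 fun ω hx hy => hxy (hx.symm.trans hy)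
  have hm : Measurable fun ω : PathSpace S => movedIndicator b q ω := by
    have := (measurable_movedIndicator (S := S) b).comp (measurable_prodMk_left (x := (q : ℝ)))
    simpa [Function.comp_def] using this
  have hmi : Integrable (fun ω : PathSpace S => movedIndicator b q ω) P :=
    integrable_of_abs_le hm (B := 1) fun ω => by
      rw [abs_of_nonneg (movedIndicator_mem b q ω).1]; exact (movedIndicator_mem b q ω).2
  have h1 := hasSum_integral_iUnion hA hAd (μ := P) hmi.integrableOn
  have h2 := hasSum_integral_iUnion hA hAd (μ := P)
    (integrable_const (μ := P) (2 * M * (b - q : ℝ))).integrableOn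
  rw [hAu, setIntegral_univ] at h1 h2
  have hconst : ∫ _, 2 * M * (b - q : ℝ) ∂P = 2 * M * (b - q) := by simp
  rw [← hconst]
  refine hasSum_le (fun x => ?_) h1 h2
  -- on `{X q = x}` apply the martingale property to the indicator of the complement of `x`
  let f : S → ℝ := fun y => if y = x then 0 else 1
  have hf : ∀ y, |f y| ≤ 1 := fun y => by simp only [f]; split_ifs <;> simp
  let ξ : PathSpace S → ℝ := (A x).indicator 1
  have hξ0 : Measurable ξ := measurable_one.indicator (hA x)
  have hξ : Measurable[canonicalFiltration S q] ξ := by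
    refine PathSpace.measurable_of_stop hξ0 fun ω => ?_
    simp [ξ, A, indicator, PathSpace.stopAt]
  have hξb : ∀ ω, |ξ ω| ≤ 1 := fun ω => by
    simp only [ξ, indicator]; split_ifs <;> simp
  have key := hP.integral_mul_increment hlam hqb hξ hξb hf
  rw [max_eq_right hsq, max_eq_right (hsq.trans hqb)] at key
  have e1 : ∫ ω in A x, movedIndicator b q ω ∂P = ∫ ω, ξ ω * f (ω.1 b) ∂P := by
    rw [← integral_indicator (hA x)]
    refine integral_congr_ae (Eventually.of_forall fun ω => ?_)
    by_cases hω : ω.1 q = x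
    · simp [ξ, A, f, indicator, movedIndicator, hω, eq_comm]
    · simp [ξ, A, hω]
  have e2 : ∫ ω, ξ ω * f (ω.1 q) ∂P = 0 := by
    refine integral_eq_zero_of_ae (Eventually.of_forall fun ω => ?_)
    by_cases hω : ω.1 q = x
    · simp [f, hω]
    · simp [ξ, A, hω]
  have hqb' : (0 : ℝ) ≤ b - q := sub_nonneg.2 (by exact_mod_cast hqb)
  have hgm := fun x => measurable_generator (u := u) hlam hf x
  have hgb := fun t x => abs_generator_le (u := u) hlam hM hf t x
  rw [e1, key, e2, zero_add]
  rw [← integral_indicator (hA x)]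
  have hM' : (b : ℝ) - q = |(b : ℝ) - q| := (abs_of_nonneg hqb').symm
  refine integral_mono (integrable_of_abs_le (hξ0.mul (measurable_pathIntegral hgm _ _))
    (B := 1 * (2 * M * 1 * |(b : ℝ) - q|)) fun ω => ?_)
    ((integrable_const _).indicator (hA x)) fun ω => ?_
  · rw [abs_mul]
    exact mul_le_mul (hξb _) (abs_pathIntegral_le hgb _ _ _) (abs_nonneg _) zero_le_one
  · by_cases hω : ω ∈ A x
    · simp only [ξ, indicator_of_mem hω, Pi.one_apply, one_mul]
      have := (le_abs_self _).trans (abs_pathIntegral_le hgb (q : ℝ) b ω)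
      rwa [← hM', mul_one] at this
    · simp [ξ, indicator_of_notMem hω]

end SmallIncrements

section FeynmanKac

variable {S : Type*} [Countable S] [TopologicalSpace S] [DiscreteTopology S]
  [MeasurableSpace S] [BorelSpace S]
  {U : S → Type*} [∀ i, MetricSpace (U i)] [∀ i, MeasurableSpace (U i)] [∀ i, BorelSpace (U i)]
  {lam : (i : S) → S → U i → ℝ} {u : MarkovControl U}
  {s : ℝ≥0} {μ : Measure S} {P : Measure (PathSpace S)} {M : ℝ}

theorem intervalIntegrable_of_abs_le {f : ℝ → ℝ} (hf : Measurable f) {B : ℝ}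
    (hB : ∀ r, |f r| ≤ B) (a b : ℝ) : IntervalIntegrable f volume a b :=
  (intervalIntegrable_const (c := B)).mono_fun hf.aestronglyMeasurable
    (Eventually.of_forall fun r => by simpa using (hB _).trans (le_abs_self B))

theorem intervalIntegrable_movedIndicator (b : ℝ≥0) (ω : PathSpace S) (x y : ℝ) :
    IntervalIntegrable (fun q : ℝ => movedIndicator b q.toNNReal ω) volume x y :=
  intervalIntegrable_of_abs_le ((measurable_movedIndicator b).comp measurable_prodMk_right)
    (B := 1) (fun r => by
      rw [Function.comp_apply, abs_of_nonneg (movedIndicator_mem _ _ _).1]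
      exact (movedIndicator_mem _ _ _).2) x y

/-- The expected time spent in `[a, b]` away from the final state `X b` is of second order. -/
theorem SolvesMartingaleProblem.integral_integral_movedIndicator_le (hlam : RateAssumptions lam)
    (hM : ∀ i u, -lam i i u ≤ M) (hM0 : 0 ≤ M) (hP : SolvesMartingaleProblem lam u s μ P)
    {a b : ℝ≥0} (hsa : s ≤ a) (hab : a ≤ b) :
    Integrable (fun ω => ∫ q in (a : ℝ)..b, movedIndicator b q.toNNReal ω) P ∧
    ∫ ω, (∫ q in (a : ℝ)..b, movedIndicator b q.toNNReal ω) ∂P ≤ 2 * M * (b - a : ℝ) ^ 2 := by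
  have := hP.isProbabilityMeasure
  have hab' : (a : ℝ) ≤ b := by exact_mod_cast hab
  have hm : Measurable fun p : PathSpace S × ℝ => movedIndicator b p.2.toNNReal p.1 :=
    (measurable_movedIndicator b).comp measurable_swap
  have hi : Integrable (Function.uncurry fun (ω : PathSpace S) (q : ℝ) =>
      movedIndicator b q.toNNReal ω) (P.prod (volume.restrict (Ioc (a : ℝ) b))) :=
    integrable_of_abs_le hm (B := 1) fun p => by
      rw [Function.uncurry_def, abs_of_nonneg (movedIndicator_mem _ _ _).1]
      exact (movedIndicator_mem _ _ _).2
  simp only [intervalIntegral.integral_of_le hab']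
  refine ⟨hi.integral_prod_left, ?_⟩
  rw [integral_integral_swap hi]
  have h1 : ‖∫ q in Ioc (a : ℝ) b, ∫ ω, movedIndicator b q.toNNReal ω ∂P‖
      ≤ (2 * M * (b - a)) * volume.real (Ioc (a : ℝ) b) := by
    refine norm_setIntegral_le_of_norm_le_const (by simp) fun q hq => ?_
    have hq0 : 0 ≤ q := (NNReal.coe_nonneg _).trans hq.1.le
    have h2 := hP.integral_movedIndicator_le hlam hM (q := q.toNNReal) (b := b)
      (hsa.trans (by rw [← NNReal.coe_le_coe, Real.coe_toNNReal q hq0]; exact hq.1.le))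
      (by rw [Real.toNNReal_le_iff_le_coe]; exact hq.2)
    rw [Real.coe_toNNReal q hq0] at h2
    rw [Real.norm_of_nonneg (integral_nonneg fun ω => (movedIndicator_mem _ _ _).1)]
    refine h2.trans (mul_le_mul_of_nonneg_left (by linarith [hq.1]) (by positivity))
  refine (Real.le_norm_self _).trans (h1.trans (le_of_eq ?_))
  rw [Real.volume_real_Ioc_of_le hab']
  ring

/-- The pathwise estimate behind the Feynman–Kac inequality: replacing the states `X b`, `X q`
and the times `a`, `b`, `q` by each other costs an error of second order. -/
theorem exp_mul_sub_add_ge (hlam : RateAssumptions lam) (hM : ∀ i u, -lam i i u ≤ M)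
    {k ψ H : ℝ≥0 → S → ℝ} {C B K : ℝ} (hkm : ∀ x, Measurable fun t => k t x)
    (hk : ∀ t x, |k t x| ≤ C) (hψ : ∀ t x, |ψ t x| ≤ B) (hHm : ∀ x, Measurable fun t => H t x)
    (hH : ∀ t x, |H t x| ≤ K) {T : ℝ≥0}
    (hψH : ∀ a b : ℝ≥0, a ≤ b → b ≤ T → ∀ x, ψ b x - ψ a x = -∫ q in (a : ℝ)..b, H q.toNNReal x)
    (hL : ∀ q < T, ∀ x, H q x ≤ k q x * ψ q x + generator lam u q (ψ q) x)
    {a b : ℝ≥0} (hab : a ≤ b) (hbT : b ≤ T) (hC : C * (b - a) ≤ 1) (ω : PathSpace S) :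
    -((C ^ 2 * B + (C * K + 2 * M * K)) * (b - a : ℝ) ^ 2)
      - (2 * C * B + 2 * K) * ∫ q in (a : ℝ)..b, movedIndicator b q.toNNReal ω
    ≤ Real.exp (pathIntegral k a b ω) * ψ b (ω.1 b) - ψ a (ω.1 b)
      + pathIntegral (fun t => generator lam u t (ψ a)) a b ω := by
  have hab' : (a : ℝ) ≤ b := by exact_mod_cast hab
  have hd : (0 : ℝ) ≤ b - a := sub_nonneg.2 hab'
  set y := ω.1 b with hy
  have hC0 : 0 ≤ C := (abs_nonneg _).trans (hk 0 y)
  have hB0 : 0 ≤ B := (abs_nonneg _).trans (hψ 0 y)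
  have hK0 : 0 ≤ K := (abs_nonneg _).trans (hH 0 y)
  have hgm := fun x => measurable_generator (u := u) hlam (hψ a) x
  have hgb := fun t x => abs_generator_le (u := u) hlam hM (hψ a) t x
  set J := pathIntegral k a b ω with hJ
  have hJle : |J| ≤ C * (b - a) := by
    have := abs_pathIntegral_le hk a b ω
    rwa [abs_of_nonneg hd] at this
  have hexp : |Real.exp J - 1 - J| ≤ C ^ 2 * (b - a : ℝ) ^ 2 := by
    refine (Real.abs_exp_sub_one_sub_id_le (hJle.trans hC)).trans ?_
    rw [← sq_abs J, ← mul_pow]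
    exact pow_le_pow_left₀ (abs_nonneg _) hJle 2
  have hLip : ∀ p q : ℝ≥0, p ≤ q → q ≤ T → ∀ x, |ψ q x - ψ p x| ≤ K * (q - p) := by
    intro p q hpq hqT x
    have hpq' : (p : ℝ) ≤ q := by exact_mod_cast hpq
    rw [hψH p q hpq hqT x, abs_neg]
    have := intervalIntegral.norm_integral_le_of_norm_le_const (a := (p : ℝ)) (b := q)
      (f := fun r : ℝ => H r.toNNReal x) (C := K) fun r _ => hH _ _
    rwa [abs_of_nonneg (sub_nonneg.2 hpq')] at this
  -- the integrand of `k ψ + Λ ψ - H`, with `ψ` and the state taken at other times than `q`,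
  -- is bounded below up to first-order errors
  have hint1 := intervalIntegrable_path hkm hk ω a b
  have hint2 := intervalIntegrable_path hgm hgb ω a b
  have hint3 : IntervalIntegrable (fun q : ℝ => H q.toNNReal y) volume a b :=
    intervalIntegrable_of_abs_le ((hHm y).comp measurable_real_toNNReal) (fun r => hH _ _) _ _
  have hint4 := intervalIntegrable_movedIndicator b ω a b
  have e1 : J * ψ b y + pathIntegral (fun t => generator lam u t (ψ a)) a b ω
        - ∫ q in (a : ℝ)..b, H q.toNNReal y
      = ∫ q in (a : ℝ)..b, (k q.toNNReal (ω.1 q.toNNReal) * ψ b y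
        + generator lam u q.toNNReal (ψ a) (ω.1 q.toNNReal) - H q.toNNReal y) := by
    rw [intervalIntegral.integral_sub ((hint1.mul_const _).add hint2) hint3,
      intervalIntegral.integral_add (hint1.mul_const _) hint2,
      intervalIntegral.integral_mul_const]
    rfl
  have e2 : ∫ q in (a : ℝ)..b, (-((C * K + 2 * M * K) * (b - a))
        - (2 * C * B + 2 * K) * movedIndicator b q.toNNReal ω)
      = -((C * K + 2 * M * K) * (b - a : ℝ) ^ 2)
      - (2 * C * B + 2 * K) * ∫ q in (a : ℝ)..b, movedIndicator b q.toNNReal ω := by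
    rw [intervalIntegral.integral_sub intervalIntegrable_const (hint4.const_mul _),
      intervalIntegral.integral_const_mul, intervalIntegral.integral_const]
    rw [smul_eq_mul]; ring
  have e3 : ∫ q in (a : ℝ)..b, (-((C * K + 2 * M * K) * (b - a))
        - (2 * C * B + 2 * K) * movedIndicator b q.toNNReal ω)
      ≤ ∫ q in (a : ℝ)..b, (k q.toNNReal (ω.1 q.toNNReal) * ψ b y
        + generator lam u q.toNNReal (ψ a) (ω.1 q.toNNReal) - H q.toNNReal y) := by
    refine intervalIntegral.integral_mono_on_of_le_Ioo hab'
      (intervalIntegrable_const.sub (hint4.const_mul _))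
      (((hint1.mul_const _).add hint2).sub hint3) fun r hr => ?_
    have hr0 : 0 ≤ r := (NNReal.coe_nonneg a).trans hr.1.le
    have hrc : (r.toNNReal : ℝ) = r := Real.coe_toNNReal r hr0
    set q := r.toNNReal
    have haq : a ≤ q := by rw [← NNReal.coe_le_coe, hrc]; exact hr.1.le
    have hqb : q < b := by rw [← NNReal.coe_lt_coe, hrc]; exact hr.2
    set x := ω.1 q with hx
    -- `l2` and `l3` move the times `a` and `b` in `ψ` to `q`; `l4` moves the state `X b` to `X q`
    have l1 := hL q (hqb.trans_le hbT) x
    have l2 : |generator lam u q (ψ a) x - generator lam u q (ψ q) x|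
        ≤ 2 * M * (K * (q - a)) := by
      unfold generator
      rw [hlam.tsum_sub x _ (hψ a) (hψ q)]
      exact hlam.abs_tsum_le hM x _ fun j => by
        rw [abs_sub_comm]; exact hLip a q haq (hqb.le.trans hbT) j
    have l3 : |k q x * ψ b x - k q x * ψ q x| ≤ C * (K * (b - q)) := by
      rw [← mul_sub, abs_mul]
      exact mul_le_mul (hk _ _) (hLip q b hqb.le hbT x) (abs_nonneg _) hC0
    have l4 : |k q x * ψ b y - k q x * ψ b x| ≤ 2 * C * B * movedIndicator b q ω
        ∧ |H q y - H q x| ≤ 2 * K * movedIndicator b q ω := by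
      by_cases hxy : ω.1 q = ω.1 b
      · have : y = x := hxy.symm
        simp [movedIndicator, hxy, this]
      · simp only [movedIndicator, hxy, if_false, mul_one]
        constructor
        · rw [← mul_sub, abs_mul]
          have : |ψ b y - ψ b x| ≤ 2 * B := by
            refine (abs_sub _ _).trans ?_
            linarith [hψ b y, hψ b x]
          calc |k q x| * |ψ b y - ψ b x| ≤ C * (2 * B) :=
                mul_le_mul (hk _ _) this (abs_nonneg _) hC0
            _ = 2 * C * B := by ring
        · refine (abs_sub _ _).trans ?_
          linarith [hH q y, hH q x]
    have h2 := (abs_le.1 l2).1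
    have h3 := (abs_le.1 l3).1
    have h4 := (abs_le.1 l4.1).1
    have h5 := (abs_le.1 l4.2).2
    have hM0 : 0 ≤ M := by
      have := (abs_nonneg _).trans l2
      have h6 := hM x (u.act q x)
      linarith [hlam.diag_nonpos x (u.act q x)]
    rw [hrc] at h2 h3
    have h7 : 2 * M * (K * (r - a)) ≤ 2 * M * K * (b - a) := by
      rw [← mul_assoc]
      exact mul_le_mul_of_nonneg_left (by linarith [hr.2]) (by positivity)
    have h8 : C * (K * (b - r)) ≤ C * K * (b - a) := by
      rw [← mul_assoc]
      exact mul_le_mul_of_nonneg_left (by linarith [hr.1]) (by positivity)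
    linarith
  have e4 : ψ a y = ψ b y + ∫ q in (a : ℝ)..b, H q.toNNReal y := by
    have := hψH a b hab hbT y; linarith
  have e5 : -(C ^ 2 * B * (b - a : ℝ) ^ 2) ≤ (Real.exp J - 1 - J) * ψ b y := by
    have : |(Real.exp J - 1 - J) * ψ b y| ≤ C ^ 2 * (b - a : ℝ) ^ 2 * B := by
      rw [abs_mul]
      exact mul_le_mul hexp (hψ _ _) (abs_nonneg _) (by positivity)
    have := (abs_le.1 this).1
    linarith
  rw [e4]
  have e6 : Real.exp J * ψ b y - (ψ b y + ∫ q in (a : ℝ)..b, H q.toNNReal y)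
        + pathIntegral (fun t => generator lam u t (ψ a)) a b ω
      = (Real.exp J - 1 - J) * ψ b y + (J * ψ b y
        + pathIntegral (fun t => generator lam u t (ψ a)) a b ω
        - ∫ q in (a : ℝ)..b, H q.toNNReal y) := by ring
  rw [e6, e1]
  rw [e2] at e3
  linarith

/-- Feynman–Kac inequality for a subsolution: if `-H` is the time derivative of `ψ` and
`H ≤ k ψ + Λ ψ`, then `exp (∫ k) ψ` increases in mean along solutions of the martingale
problem. -/
theorem SolvesMartingaleProblem.le_integral_exp_mul (hlam : RateAssumptions lam) {i : S}
    (hP : SolvesMartingaleProblem lam u s (Measure.dirac i) P)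
    {k ψ H : ℝ≥0 → S → ℝ} {C B K : ℝ} (hkm : ∀ x, Measurable fun t => k t x)
    (hk : ∀ t x, |k t x| ≤ C) (hψ : ∀ t x, |ψ t x| ≤ B) (hHm : ∀ x, Measurable fun t => H t x)
    (hH : ∀ t x, |H t x| ≤ K) {T : ℝ≥0} (hsT : s ≤ T)
    (hψH : ∀ a b : ℝ≥0, a ≤ b → b ≤ T → ∀ x, ψ b x - ψ a x = -∫ q in (a : ℝ)..b, H q.toNNReal x)
    (hL : ∀ q < T, ∀ x, H q x ≤ k q x * ψ q x + generator lam u q (ψ q) x) :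
    ψ s i ≤ ∫ ω, Real.exp (pathIntegral k s T ω) * ψ T (ω.1 T) ∂P := by
  have := hP.isProbabilityMeasure
  obtain ⟨M, hM0, hM⟩ := hlam.exists_bound
  have hC0 : 0 ≤ C := (abs_nonneg _).trans (hk 0 i)
  have hB0 : 0 ≤ B := (abs_nonneg _).trans (hψ 0 i)
  have hK0 : 0 ≤ K := (abs_nonneg _).trans (hH 0 i)
  let W : ℝ≥0 → PathSpace S → ℝ := fun r ω => Real.exp (pathIntegral k s r ω)
  let w := Real.exp (C * T)
  have hWm : ∀ r, Measurable (W r) := fun r =>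
    Real.measurable_exp.comp (measurable_pathIntegral hkm _ _)
  have hW : ∀ r, s ≤ r → r ≤ T → ∀ ω, |W r ω| ≤ w := fun r hsr hrT ω => by
    rw [abs_of_pos (Real.exp_pos _)]
    refine Real.exp_le_exp.2 ((le_abs_self _).trans ((abs_pathIntegral_le hk _ _ _).trans ?_))
    refine mul_le_mul_of_nonneg_left ?_ hC0
    have h1 : (s : ℝ) ≤ r := by exact_mod_cast hsr
    have h2 : (r : ℝ) ≤ T := by exact_mod_cast hrT
    rw [abs_of_nonneg (by linarith)]
    linarith [NNReal.coe_nonneg s]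
  have hψm : ∀ r t, Measurable fun ω : PathSpace S => ψ r (ω.1 t) := fun r t =>
    (measurable_of_countable (ψ r)).comp (PathSpace.measurable_eval t)
  let h : ℝ≥0 → ℝ := fun r => ∫ ω, W r ω * ψ r (ω.1 r) ∂P
  have hWψ : ∀ r, s ≤ r → r ≤ T → ∀ p t, Integrable (fun ω => W r ω * ψ p (ω.1 t)) P :=
    fun r h1 h2 p t => integrable_of_abs_le ((hWm r).mul (hψm p t)) (B := w * B) fun ω => by
      rw [abs_mul]
      exact mul_le_mul (hW r h1 h2 ω) (hψ _ _) (abs_nonneg _) (Real.exp_pos _).le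
  have hs : h s = ψ s i := by
    have : h s = ∫ ω, ψ s (ω.1 s) ∂P :=
      integral_congr_ae (Eventually.of_forall fun ω => by simp [W, pathIntegral])
    rw [this, hP.integral_initial le_rfl]
  rw [← hs]
  let A := w * ((C ^ 2 * B + (C * K + 2 * M * K)) + (2 * C * B + 2 * K) * (2 * M))
  -- the increments of `h` are non-negative up to second-order errors, so that `h` is monotone
  refine le_of_increment_ge_neg_sq hsT (h := h) (δ := 1 / (C + 1)) (A := A) (by positivity)
    fun a b hsa hab hbT hδ => ?_
  have hab' : (a : ℝ) ≤ b := by exact_mod_cast hab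
  have hd : (0 : ℝ) ≤ b - a := sub_nonneg.2 hab'
  have hC : C * (b - a : ℝ) ≤ 1 := by
    rw [le_div_iff₀ (by positivity)] at hδ
    nlinarith
  have hgm := fun x => measurable_generator (u := u) hlam (hψ a) x
  have hgb := fun t x => abs_generator_le (u := u) hlam hM (hψ a) t x
  have hWa : Measurable[canonicalFiltration S a] (W a) :=
    PathSpace.measurable_of_stop (hWm a) fun ω => by
      simp only [W, pathIntegral_stop hsa le_rfl]
  have hMP := hP.integral_mul_increment hlam hab hWa (hW a hsa (hab.trans hbT)) (hψ a)
  rw [max_eq_right hsa, max_eq_right (hsa.trans hab)] at hMP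
  have hWI : Integrable (fun ω => W a ω
      * pathIntegral (fun t => generator lam u t (ψ a)) a b ω) P :=
    integrable_of_abs_le ((hWm a).mul (measurable_pathIntegral hgm _ _))
      (B := w * (2 * M * B * |(b : ℝ) - a|)) fun ω => by
      rw [abs_mul]
      exact mul_le_mul (hW a hsa (hab.trans hbT) ω) (abs_pathIntegral_le hgb _ _ _)
        (abs_nonneg _) (Real.exp_pos _).le
  obtain ⟨hmi, hmle⟩ := hP.integral_integral_movedIndicator_le hlam hM hM0.le hsa hab
  have hWs : Integrable (fun ω => W b ω * ψ b (ω.1 b) - W a ω * ψ a (ω.1 b)) P :=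
    (hWψ b (hsa.trans hab) hbT b b).sub (hWψ a hsa (hab.trans hbT) a b)
  have e1 : h b - h a = ∫ ω, (W b ω * ψ b (ω.1 b) - W a ω * ψ a (ω.1 b)
      + W a ω * pathIntegral (fun t => generator lam u t (ψ a)) a b ω) ∂P := by
    rw [integral_add hWs hWI,
      integral_sub (hWψ b (hsa.trans hab) hbT b b) (hWψ a hsa (hab.trans hbT) a b), hMP]
    simp only [h]; ring
  have e2 : ∫ ω, -(w * ((C ^ 2 * B + (C * K + 2 * M * K)) * (b - a : ℝ) ^ 2
      + (2 * C * B + 2 * K) * ∫ q in (a : ℝ)..b, movedIndicator b q.toNNReal ω)) ∂P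
      ≤ h b - h a := by
    rw [e1]
    refine integral_mono (((integrable_const _).add (hmi.const_mul _)).const_mul _).neg
      (hWs.add hWI) fun ω => ?_
    have p1 := exp_mul_sub_add_ge (u := u) hlam hM hkm hk hψ hHm hH hψH hL hab hbT hC ω
    have p2 : W b ω = W a ω * Real.exp (pathIntegral k a b ω) := by
      simp only [W]
      rw [← Real.exp_add, pathIntegral_add_adjacent hkm hk]
    have p3 : 0 ≤ ∫ q in (a : ℝ)..b, movedIndicator b q.toNNReal ω :=
      intervalIntegral.integral_nonneg hab' fun q _ => (movedIndicator_mem _ _ _).1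
    have p4 : W a ω ≤ w := (le_abs_self _).trans (hW a hsa (hab.trans hbT) ω)
    have p5 : 0 ≤ W a ω := (Real.exp_pos _).le
    set N := ∫ q in (a : ℝ)..b, movedIndicator b q.toNNReal ω
    set Y := Real.exp (pathIntegral k a b ω) * ψ b (ω.1 b) - ψ a (ω.1 b)
      + pathIntegral (fun t => generator lam u t (ψ a)) a b ω with hY
    set E := (C ^ 2 * B + (C * K + 2 * M * K)) * (b - a : ℝ) ^ 2 + (2 * C * B + 2 * K) * N
    have hE : 0 ≤ E := by positivity
    have p6 : -E ≤ Y := by linarith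
    change -(w * E) ≤ W b ω * ψ b (ω.1 b) - W a ω * ψ a (ω.1 b)
      + W a ω * pathIntegral (fun t => generator lam u t (ψ a)) a b ω
    have p7 : W b ω * ψ b (ω.1 b) - W a ω * ψ a (ω.1 b)
      + W a ω * pathIntegral (fun t => generator lam u t (ψ a)) a b ω = W a ω * Y := by
      rw [p2, hY]; ring
    rw [p7]
    nlinarith
  refine le_trans ?_ e2
  rw [integral_neg, integral_const_mul, integral_add (integrable_const _) (hmi.const_mul _)]
  simp only [integral_const_mul, integral_const, probReal_univ, one_smul]
  have hw : 0 < w := Real.exp_pos _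
  have : (2 * C * B + 2 * K) * ∫ ω, (∫ q in (a : ℝ)..b, movedIndicator b q.toNNReal ω) ∂P
      ≤ (2 * C * B + 2 * K) * (2 * M * (b - a : ℝ) ^ 2) :=
    mul_le_mul_of_nonneg_left hmle (by positivity)
  have := mul_le_mul_of_nonneg_left this hw.le
  simp only [A]
  linarith

end FeynmanKac

/-! ### The uniformised jump chain: one step -/

section Sampling

variable {S : Type*} [Countable S] [TopologicalSpace S] [DiscreteTopology S]
  [MeasurableSpace S] [BorelSpace S]
  {U : S → Type*} [∀ i, MetricSpace (U i)] [∀ i, MeasurableSpace (U i)] [∀ i, BorelSpace (U i)]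
  {lam : (i : S) → S → U i → ℝ} {u : MarkovControl U} {M : ℝ}

open Classical in
/-- The jump probabilities of the uniformised chain: at rate `M` the chain jumps from `y` to `j`
with probability `δ_{yj} + λ_{yj} / M`; a jump from `y` to itself is not visible. -/
noncomputable def jumpWeight (lam : (i : S) → S → U i → ℝ) (u : MarkovControl U) (M : ℝ)
    (p : ℝ≥0 × S) (j : S) : ℝ :=
  (if j = p.2 then 1 else 0) + lam p.2 j (u.act p.1 p.2) / M

omit [Countable S] [TopologicalSpace S] [DiscreteTopology S] [MeasurableSpace S]
  [BorelSpace S] [∀ i, BorelSpace (U i)] in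
theorem jumpWeight_nonneg (hlam : RateAssumptions lam) (hM0 : 0 < M)
    (hM : ∀ i u, -lam i i u ≤ M) (p : ℝ≥0 × S) (j : S) : 0 ≤ jumpWeight lam u M p j := by
  unfold jumpWeight
  by_cases h : j = p.2
  · rw [if_pos h, h]
    have := hM p.2 (u.act p.1 p.2)
    have h2 : -1 ≤ lam p.2 p.2 (u.act p.1 p.2) / M := by
      rw [le_div_iff₀ hM0]; linarith
    linarith
  · rw [if_neg h, zero_add]
    exact div_nonneg (hlam.nonneg _ _ h _) hM0.le

omit [Countable S] [TopologicalSpace S] [DiscreteTopology S] [MeasurableSpace S]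
  [BorelSpace S] [∀ i, BorelSpace (U i)] in
theorem hasSum_jumpWeight_mul (hlam : RateAssumptions lam) (p : ℝ≥0 × S) {f : S → ℝ} {B : ℝ}
    (hf : ∀ j, |f j| ≤ B) :
    HasSum (fun j => jumpWeight lam u M p j * f j) (f p.2 + generator lam u p.1 f p.2 / M) := by
  classical
  have h1 : HasSum (fun j => if j = p.2 then f p.2 else 0) (f p.2) := hasSum_ite_eq _ _
  have h2 := (hlam.summable_mul p.2 (u.act p.1 p.2) hf).hasSum.div_const M
  refine (h1.add h2).congr_fun fun j => ?_
  unfold jumpWeight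
  by_cases h : j = p.2
  · simp [h]; ring
  · simp [h]; ring

theorem measurable_jumpWeight (hlam : RateAssumptions lam) (j : S) :
    Measurable fun p => jumpWeight lam u M p j := by
  classical
  refine measurable_from_prod_countable_left fun y => ?_
  convert (measurable_const (a := ite (j = y) (1 : ℝ) 0)).add
    (((hlam.continuous_rate y j).measurable.comp (u.measurable_act y)).div_const M) using 1
  funext t
  simp [jumpWeight]

/-- The jump probabilities as a Markov kernel, realised by a measurable function of a uniform
random variable. -/
theorem exists_measurable_sampler [Nonempty S] (hlam : RateAssumptions lam) (u : MarkovControl U)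
    (hM0 : 0 < M) (hM : ∀ i u, -lam i i u ≤ M) :
    ∃ G : ℝ≥0 × S → unitInterval → S, Measurable (Function.uncurry G) ∧
      ∀ (p : ℝ≥0 × S) (f : S → ℝ) (B : ℝ), (∀ j, |f j| ≤ B) →
        ∫ v, f (G p v) = f p.2 + generator lam u p.1 f p.2 / M := by
  have hw0 := fun p j => jumpWeight_nonneg (u := u) hlam hM0 hM p j
  let κ : Kernel (ℝ≥0 × S) S :=
    { toFun := fun p => Measure.sum fun j => ENNReal.ofReal (jumpWeight lam u M p j) •
        Measure.dirac j
      measurable' := by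
        refine Measure.measurable_of_measurable_coe _ fun A hA => ?_
        simp only [Measure.sum_apply _ hA, Measure.smul_apply, smul_eq_mul]
        exact Measurable.tsum fun j =>
          (measurable_jumpWeight hlam j).ennreal_ofReal.mul_const _ }
  have hκ : ∀ p, κ p = Measure.sum fun j => ENNReal.ofReal (jumpWeight lam u M p j) •
        Measure.dirac j := fun p => rfl
  have hmarkov : IsMarkovKernel κ := ⟨fun p => ⟨by
    have h1 : HasSum (fun j => jumpWeight lam u M p j) 1 := by
      have := hasSum_jumpWeight_mul (u := u) (M := M) hlam p (f := fun _ => 1) (B := 1) (by simp)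
      have h2 : generator lam u p.1 (fun _ => 1) p.2 = 0 := by
        simpa [generator] using (hlam.hasSum_zero p.2 (u.act p.1 p.2)).tsum_eq
      simpa [h2] using this
    rw [hκ, Measure.sum_apply _ MeasurableSet.univ]
    simp only [Measure.smul_apply, measure_univ, smul_eq_mul, mul_one]
    rw [← ENNReal.ofReal_tsum_of_nonneg (hw0 p) h1.summable, h1.tsum_eq, ENNReal.ofReal_one]⟩⟩
  obtain ⟨G, hG, hGκ⟩ := Kernel.exists_measurable_map_eq_unitInterval κ
  refine ⟨G, hG, fun p f B hf => ?_⟩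
  have hfm : Measurable f := measurable_of_countable f
  have h1 : ∫ v, f (G p v) = ∫ x, f x ∂(κ p) := by
    rw [← hGκ p, integral_map hG.of_uncurry_left.aemeasurable hfm.aestronglyMeasurable]
  have h2 : Integrable f (κ p) := integrable_of_abs_le hfm hf
  have h3 := hasSum_integral_measure (μ := fun j => ENNReal.ofReal (jumpWeight lam u M p j) •
    Measure.dirac j) (f := f) (hκ p ▸ h2)
  rw [h1, hκ]
  refine h3.unique ?_
  simp only [integral_smul_measure, integral_dirac, smul_eq_mul,
    ENNReal.toReal_ofReal (hw0 p _)]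
  exact hasSum_jumpWeight_mul hlam p hf

end Sampling

section Exponential

variable {M : ℝ}

theorem expMeasure_real_Ioi (hM : 0 < M) {x : ℝ} (hx : 0 ≤ x) :
    (expMeasure M).real (Ioi x) = Real.exp (-(M * x)) := by
  have := isProbabilityMeasure_expMeasure hM
  have h1 := cdf_expMeasure_eq hM x
  rw [if_pos hx, cdf_eq_real] at h1
  rw [← compl_Iic, probReal_compl_eq_one_sub measurableSet_Iic, h1]
  ring

theorem ae_pos_expMeasure (hM : 0 < M) : ∀ᵐ x ∂(expMeasure M), 0 < x := by
  have := isProbabilityMeasure_expMeasure hM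
  have h1 := expMeasure_real_Ioi hM (le_refl (0 : ℝ))
  rw [mul_zero, neg_zero, Real.exp_zero] at h1
  refine (prob_compl_eq_zero_iff measurableSet_Ioi).2 ?_
  rw [measureReal_def] at h1
  exact (ENNReal.toReal_eq_one_iff _).1 h1

theorem integral_expMeasure (hM : 0 < M) (f : ℝ → ℝ) :
    ∫ x, f x ∂(expMeasure M) = ∫ x, (if 0 ≤ x then M * Real.exp (-(M * x)) else 0) * f x := by
  have h1 : expMeasure M = volume.withDensity (exponentialPDF M) := rfl
  rw [h1, integral_withDensity_eq_integral_toReal_smul]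
  · refine integral_congr_ae (Eventually.of_forall fun x => ?_)
    simp only [exponentialPDF_eq, smul_eq_mul]
    rw [ENNReal.toReal_ofReal]
    split_ifs
    · positivity
    · exact le_rfl
  · exact (measurable_exponentialPDFReal M).ennreal_ofReal
  · exact Eventually.of_forall fun x => ENNReal.ofReal_lt_top

/-- The compensation formula for a single exponential waiting time: the rate of the jump at time
`τ + x`, integrated over the law of `x`, agrees with the rate integrated over the time before
the jump. -/
theorem integral_expMeasure_compensator (hM : 0 < M) {φ : ℝ → ℝ} (hφ : Measurable φ) {B : ℝ}
    (hB : ∀ r, |φ r| ≤ B) (τ : ℝ) {a b : ℝ} (hab : a ≤ b) :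
    ∫ x, (if a < τ + x ∧ τ + x ≤ b then φ (τ + x) / M else 0) ∂(expMeasure M)
      = ∫ x, (∫ r in a..b, if τ ≤ r ∧ r < τ + x then φ r else 0) ∂(expMeasure M) := by
  have := isProbabilityMeasure_expMeasure hM
  have hR : ∫ x, (∫ r in a..b, if τ ≤ r ∧ r < τ + x then φ r else 0) ∂(expMeasure M)
      = ∫ r in Ioc a b, if τ ≤ r then φ r * Real.exp (-(M * (r - τ))) else 0 := by
    simp only [intervalIntegral.integral_of_le hab]
    rw [integral_integral_swap]
    · refine integral_congr_ae (Eventually.of_forall fun r => ?_)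
      by_cases hr : τ ≤ r
      · simp only [hr, true_and, if_true]
        have h1 : (fun x : ℝ => if r < τ + x then φ r else 0)
            = (Ioi (r - τ)).indicator fun _ => φ r := by
          funext x
          simp only [indicator, mem_Ioi, sub_lt_iff_lt_add']
        rw [h1, integral_indicator measurableSet_Ioi, setIntegral_const,
          expMeasure_real_Ioi hM (sub_nonneg.2 hr), smul_eq_mul, mul_comm]
      · simp [hr]
    · refine integrable_of_abs_le (B := B) ?_ fun p => ?_
      · refine Measurable.ite ?_ (hφ.comp measurable_snd) measurable_const
        exact (measurableSet_le measurable_const measurable_snd).inter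
          (measurableSet_lt measurable_snd (measurable_const.add measurable_fst))
      · rw [Function.uncurry_def]
        dsimp only
        split_ifs
        · exact hB _
        · simpa using (abs_nonneg _).trans (hB 0)
  rw [hR, integral_expMeasure hM, ← integral_indicator measurableSet_Ioc,
    ← integral_add_left_eq_self ((Ioc a b).indicator fun r =>
      if τ ≤ r then φ r * Real.exp (-(M * (r - τ))) else 0) τ]
  refine integral_congr_ae (Eventually.of_forall fun x => ?_)
  simp only [indicator, mem_Ioc, le_add_iff_nonneg_right, add_sub_cancel_left]
  by_cases hx : 0 ≤ x
  · simp only [hx, if_true]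
    split_ifs
    · field_simp
    · simp
  · simp [hx]

end Exponential

section InfiniteProduct

theorem measurable_update_prod {E : Type*} [MeasurableSpace E] (n : ℕ) :
    Measurable fun p : (ℕ → E) × E => Function.update p.1 n p.2 := by
  refine measurable_pi_lambda _ fun k => ?_
  by_cases hk : k = n
  · subst hk; simpa using measurable_snd
  · simpa [hk, Function.comp_def] using
      (measurable_pi_apply k).comp (measurable_fst (α := ℕ → E) (β := E))

/-- Resampling one coordinate preserves the law of an i.i.d. sequence. -/
theorem map_update_infinitePi {E : Type*} [MeasurableSpace E] (ν : Measure E)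
    [IsProbabilityMeasure ν] (n : ℕ) :
    ((Measure.infinitePi fun _ : ℕ => ν).prod ν).map (fun p => Function.update p.1 n p.2)
      = Measure.infinitePi fun _ : ℕ => ν := by
  have hmeas := measurable_update_prod (E := E) n
  refine Measure.eq_infinitePi _ fun I t ht => ?_
  rw [Measure.map_apply hmeas (MeasurableSet.pi I.countable_toSet fun k _ => ht k)]
  by_cases hn : n ∈ I
  · have : (fun p : (ℕ → E) × E => Function.update p.1 n p.2) ⁻¹' (Set.pi I t)
        = (Set.pi (I.erase n : Finset ℕ) t) ×ˢ t n := by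
      ext p
      simp only [mem_preimage, Set.mem_pi, mem_prod, Finset.coe_erase]
      constructor
      · intro h
        refine ⟨fun k hk => ?_, by simpa using h n hn⟩
        have := h k hk.1
        rwa [Function.update_of_ne (by simpa using hk.2)] at this
      · rintro ⟨h1, h2⟩ k hk
        by_cases hkn : k = n
        · subst hkn; simpa using h2
        · rw [Function.update_of_ne hkn]; exact h1 k ⟨hk, by simpa using hkn⟩
    rw [this, Measure.prod_prod, Measure.infinitePi_pi _ (fun k _ => ht k),
      Finset.prod_erase_mul _ _ hn]
  · have : (fun p : (ℕ → E) × E => Function.update p.1 n p.2) ⁻¹' (Set.pi I t)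
        = (Set.pi (I : Set ℕ) t) ×ˢ univ := by
      ext p
      simp only [mem_preimage, Set.mem_pi, mem_prod, mem_univ, and_true]
      refine forall₂_congr fun k hk => ?_
      rw [Function.update_of_ne (by rintro rfl; exact hn hk)]
    rw [this, Measure.prod_prod, Measure.infinitePi_pi _ (fun k _ => ht k), measure_univ, mul_one]

end InfiniteProduct

/-! ### The uniformised jump chain: paths -/

section JumpChain

variable {S : Type*} (G : ℝ≥0 × S → unitInterval → S) (s : ℝ≥0) (i : S)

/-- The jump times and the states after the jumps of the uniformised chain started at time `s`
in `i`, driven by the sequence `ω` of waiting times and uniform marks. -/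
noncomputable def chainStep (ω : ℕ → ℝ × unitInterval) : ℕ → ℝ × S
  | 0 => (s, i)
  | n + 1 => ((chainStep ω n).1 + (ω n).1,
      G (((chainStep ω n).1 + (ω n).1).toNNReal, (chainStep ω n).2) (ω n).2)

open Classical in
/-- The path that performs only the first `n` jumps of the chain. -/
noncomputable def chainPath (ω : ℕ → ℝ × unitInterval) : ℕ → ℝ≥0 → S
  | 0, _ => i
  | n + 1, r => if (chainStep G s i ω (n + 1)).1 ≤ r then (chainStep G s i ω (n + 1)).2
      else chainPath ω n r

/-- The driving sequences with positive waiting times for which the jump times diverge. -/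
def regularSeq : Set (ℕ → ℝ × unitInterval) :=
  {ω | (∀ n, 0 < (ω n).1) ∧ ∀ k : ℕ, ∃ n, (k : ℝ) < (chainStep G s i ω n).1}

variable {G s i} {ω : ℕ → ℝ × unitInterval}

theorem chainStep_update (e : ℝ × unitInterval) {k n : ℕ} (hkn : k ≤ n) :
    chainStep G s i (Function.update ω n e) k = chainStep G s i ω k := by
  induction k with
  | zero => rfl
  | succ k ih =>
    have hk : k ≠ n := by omega
    simp only [chainStep, ih (by omega), Function.update_of_ne hk]

theorem chainPath_update (e : ℝ × unitInterval) {k n : ℕ} (hkn : k ≤ n) :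
    chainPath G s i (Function.update ω n e) k = chainPath G s i ω k := by
  induction k with
  | zero => rfl
  | succ k ih =>
    funext r
    simp only [chainPath, ih (by omega), chainStep_update e hkn]

theorem chainPath_of_le {n : ℕ} {r : ℝ≥0} (h : (chainStep G s i ω n).1 ≤ r) :
    chainPath G s i ω n r = (chainStep G s i ω n).2 := by
  cases n with
  | zero => rfl
  | succ n => simp only [chainPath, h, if_true]

theorem chainPath_succ_of_lt {n : ℕ} {r : ℝ≥0} (h : (r : ℝ) < (chainStep G s i ω (n + 1)).1) :
    chainPath G s i ω (n + 1) r = chainPath G s i ω n r := by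
  simp only [chainPath, not_le.2 h, if_false]

theorem chainStep_fst_mono (hω : ∀ n, 0 < (ω n).1) :
    Monotone fun n => (chainStep G s i ω n).1 :=
  monotone_nat_of_le_succ fun n => by simpa [chainStep] using (hω n).le

theorem chainStep_fst_lt_succ (hω : ∀ n, 0 < (ω n).1) (n : ℕ) :
    (chainStep G s i ω n).1 < (chainStep G s i ω (n + 1)).1 := by simpa [chainStep] using hω n

theorem chainPath_eq_of_lt (hω : ∀ n, 0 < (ω n).1) {n m : ℕ} (hnm : n ≤ m) {r : ℝ≥0}
    (h : (r : ℝ) < (chainStep G s i ω (n + 1)).1) :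
    chainPath G s i ω m r = chainPath G s i ω n r := by
  induction m, hnm using Nat.le_induction with
  | base => rfl
  | succ m hm ih =>
    rw [chainPath_succ_of_lt (h.trans_le (chainStep_fst_mono hω (by omega))), ih]

theorem exists_lt_chainStep (hω : ω ∈ regularSeq G s i) (r : ℝ≥0) :
    ∃ n, (r : ℝ) < (chainStep G s i ω (n + 1)).1 := by
  obtain ⟨k, hk⟩ := exists_nat_gt (r : ℝ)
  obtain ⟨n, hn⟩ := hω.2 k
  exact ⟨n, (hk.trans hn).trans (chainStep_fst_lt_succ hω.1 n)⟩

theorem isCadlag_chainPath [TopologicalSpace S] (ω : ℕ → ℝ × unitInterval) (n : ℕ) :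
    IsCadlag (chainPath G s i ω n) := by
  induction n with
  | zero => exact ⟨fun t => continuousWithinAt_const, fun t _ => ⟨i, tendsto_const_nhds⟩⟩
  | succ n ih =>
    set τ := (chainStep G s i ω (n + 1)).1 with hτ
    refine ⟨fun t => ?_, fun t ht => ?_⟩
    · by_cases h : τ ≤ t
      · refine (continuousWithinAt_const (b := (chainStep G s i ω (n + 1)).2)).congr
          (fun r hr => ?_) ?_
        · exact chainPath_of_le (h.trans (by exact_mod_cast hr))
        · exact chainPath_of_le h
      · push Not at h
        refine (ih.1 t).congr_of_eventuallyEq ?_ (chainPath_succ_of_lt h)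
        have h1 : ∀ᶠ r : ℝ≥0 in 𝓝 t, (r : ℝ) < τ :=
          NNReal.continuous_coe.continuousAt.eventually_lt_const h
        filter_upwards [mem_nhdsWithin_of_mem_nhds h1] with r hr using chainPath_succ_of_lt hr
    · by_cases h : τ < t
      · refine ⟨(chainStep G s i ω (n + 1)).2, tendsto_const_nhds.congr' ?_⟩
        have h1 : ∀ᶠ r : ℝ≥0 in 𝓝 t, τ < (r : ℝ) :=
          NNReal.continuous_coe.continuousAt.eventually_const_lt h
        filter_upwards [mem_nhdsWithin_of_mem_nhds h1] with r hr using (chainPath_of_le hr.le).symm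
      · push Not at h
        obtain ⟨l, hl⟩ := ih.2 t ht
        refine ⟨l, hl.congr' ?_⟩
        filter_upwards [self_mem_nhdsWithin] with r hr
        exact (chainPath_succ_of_lt (lt_of_lt_of_le (by exact_mod_cast hr) h)).symm

open Classical in
/-- The path of the chain; it is constant off the null set of irregular driving sequences. -/
noncomputable def fullChainPath (G : ℝ≥0 × S → unitInterval → S) (s : ℝ≥0) (i : S)
    (ω : ℕ → ℝ × unitInterval) (r : ℝ≥0) : S :=
  if h : ω ∈ regularSeq G s i then chainPath G s i ω (exists_lt_chainStep h r).choose r else i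

theorem fullChainPath_eq (hω : ω ∈ regularSeq G s i) {n : ℕ} {r : ℝ≥0}
    (h : (r : ℝ) < (chainStep G s i ω (n + 1)).1) :
    fullChainPath G s i ω r = chainPath G s i ω n r := by
  rw [fullChainPath, dif_pos hω]
  have h1 := (exists_lt_chainStep hω r).choose_spec
  rcases le_total n (exists_lt_chainStep hω r).choose with h2 | h2
  · exact chainPath_eq_of_lt hω.1 h2 h
  · exact (chainPath_eq_of_lt hω.1 h2 h1).symm

theorem fullChainPath_of_le {r : ℝ≥0} (hr : r ≤ s) : fullChainPath G s i ω r = i := by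
  by_cases hω : ω ∈ regularSeq G s i
  · have : (r : ℝ) < (chainStep G s i ω (0 + 1)).1 :=
      lt_of_le_of_lt (b := (s : ℝ)) (by exact_mod_cast hr) (chainStep_fst_lt_succ hω.1 0)
    rw [fullChainPath_eq hω this]
    rfl
  · rw [fullChainPath, dif_neg hω]

theorem isCadlag_fullChainPath [TopologicalSpace S] (ω : ℕ → ℝ × unitInterval) :
    IsCadlag (fullChainPath G s i ω) := by
  by_cases hω : ω ∈ regularSeq G s i
  · have key : ∀ t : ℝ≥0, ∃ n, ∀ᶠ r : ℝ≥0 in 𝓝 t,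
        chainPath G s i ω n r = fullChainPath G s i ω r := fun t => by
      obtain ⟨n, hn⟩ := exists_lt_chainStep hω t
      refine ⟨n, ?_⟩
      filter_upwards [NNReal.continuous_coe.continuousAt.eventually_lt_const hn] with r hr
      exact (fullChainPath_eq hω hr).symm
    refine ⟨fun t => ?_, fun t ht => ?_⟩
    · obtain ⟨n, hn⟩ := key t
      exact ((isCadlag_chainPath (G := G) (s := s) (i := i) ω n).1 t).congr_of_eventuallyEq
        (mem_nhdsWithin_of_mem_nhds (hn.mono fun _ h => Eq.symm h)) hn.self_of_nhds.symm
    · obtain ⟨n, hn⟩ := key t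
      obtain ⟨l, hl⟩ := (isCadlag_chainPath (G := G) (s := s) (i := i) ω n).2 t ht
      exact ⟨l, hl.congr' (mem_nhdsWithin_of_mem_nhds hn)⟩
  · have : fullChainPath G s i ω = fun _ => i := funext fun r => by
      rw [fullChainPath, dif_neg hω]
    rw [this]
    exact ⟨fun t => continuousWithinAt_const, fun t _ => ⟨i, tendsto_const_nhds⟩⟩

variable [MeasurableSpace S]

theorem measurable_chainStep (hG : Measurable (Function.uncurry G)) (n : ℕ) :
    Measurable fun ω => chainStep G s i ω n := by
  induction n with
  | zero => exact measurable_const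
  | succ n ih =>
    have h1 : Measurable fun ω : ℕ → ℝ × unitInterval => (chainStep G s i ω n).1 + (ω n).1 :=
      (measurable_fst.comp ih).add (measurable_fst.comp (measurable_pi_apply n))
    refine h1.prodMk ?_
    exact hG.comp (((measurable_real_toNNReal.comp h1).prodMk (measurable_snd.comp ih)).prodMk
      (measurable_snd.comp (measurable_pi_apply n)))

theorem measurable_chainPath (hG : Measurable (Function.uncurry G)) (n : ℕ) :
    Measurable fun p : (ℕ → ℝ × unitInterval) × ℝ≥0 => chainPath G s i p.1 n p.2 := by
  induction n with
  | zero => exact measurable_const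
  | succ n ih =>
    have h1 : Measurable fun p : (ℕ → ℝ × unitInterval) × ℝ≥0 =>
        chainStep G s i p.1 (n + 1) := (measurable_chainStep hG (n + 1)).comp measurable_fst
    refine Measurable.ite ?_ (measurable_snd.comp h1) ih
    exact measurableSet_le (measurable_fst.comp h1)
      (measurable_coe_nnreal_real.comp measurable_snd)

theorem measurableSet_regularSeq (hG : Measurable (Function.uncurry G)) :
    MeasurableSet (regularSeq G s i) := by
  have h1 : ∀ n, MeasurableSet {ω : ℕ → ℝ × unitInterval | 0 < (ω n).1} := fun n =>
    measurableSet_lt measurable_const (measurable_fst.comp (measurable_pi_apply n))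
  have h2 : ∀ k n : ℕ, MeasurableSet {ω | (k : ℝ) < (chainStep G s i ω n).1} := fun k n =>
    measurableSet_lt measurable_const (measurable_fst.comp (measurable_chainStep hG n))
  have : regularSeq G s i = (⋂ n, {ω | 0 < (ω n).1}) ∩
      ⋂ k : ℕ, ⋃ n, {ω | (k : ℝ) < (chainStep G s i ω n).1} := by
    ext ω; simp [regularSeq]
  rw [this]
  exact (MeasurableSet.iInter h1).inter (MeasurableSet.iInter fun k => MeasurableSet.iUnion (h2 k))

variable [TopologicalSpace S]

/-- The path with `n` jumps as an element of path space. -/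
noncomputable def chainPathSpace (G : ℝ≥0 × S → unitInterval → S) (s : ℝ≥0) (i : S) (n : ℕ)
    (ω : ℕ → ℝ × unitInterval) : PathSpace S :=
  ⟨chainPath G s i ω n, isCadlag_chainPath ω n⟩

/-- The path of the chain as an element of path space. -/
noncomputable def fullChainPathSpace (G : ℝ≥0 × S → unitInterval → S) (s : ℝ≥0) (i : S)
    (ω : ℕ → ℝ × unitInterval) : PathSpace S :=
  ⟨fullChainPath G s i ω, isCadlag_fullChainPath ω⟩

theorem measurable_chainPathSpace (hG : Measurable (Function.uncurry G)) (n : ℕ) :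
    Measurable (chainPathSpace G s i n) :=
  (measurable_pi_lambda _ fun r =>
    (measurable_chainPath hG n).comp (measurable_prodMk_right (y := r))).subtype_mk

theorem measurable_fullChainPathSpace [DiscreteTopology S] [BorelSpace S]
    (hG : Measurable (Function.uncurry G)) : Measurable (fullChainPathSpace G s i) := by
  classical
  refine (measurable_pi_lambda _ fun r => ?_).subtype_mk
  refine measurable_of_tendsto_metrizable
    (f := fun n ω => if ω ∈ regularSeq G s i then chainPath G s i ω n r else i) (fun n => ?_)
    (tendsto_pi_nhds.2 fun ω => ?_)
  · exact Measurable.ite (measurableSet_regularSeq hG)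
      ((measurable_chainPath hG n).comp (measurable_prodMk_right (y := r))) measurable_const
  · by_cases hω : ω ∈ regularSeq G s i
    · simp only [hω, if_true]
      obtain ⟨n, hn⟩ := exists_lt_chainStep hω r
      refine tendsto_const_nhds.congr' ?_
      filter_upwards [eventually_ge_atTop n] with m hm
      rw [fullChainPath_eq hω hn, chainPath_eq_of_lt hω.1 hm hn]
    · simp only [hω, if_false]
      rw [fullChainPath, dif_neg hω]
      exact tendsto_const_nhds

/-- An event of the canonical `σ`-algebra at time `r` does not see the path after `r`. -/
theorem mem_iff_of_eqOn {r : ℝ≥0} {A : Set (PathSpace S)}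
    (hA : MeasurableSet[canonicalFiltration S r] A) {ω ω' : PathSpace S}
    (h : ∀ q ≤ r, ω.1 q = ω'.1 q) : ω ∈ A ↔ ω' ∈ A := by
  have key : ∀ η : PathSpace S, η ∈ A ↔ η.stopAt r ∈ A := by
    have hle : canonicalFiltration S r ≤ MeasurableSpace.invariants (PathSpace.stopAt r) := by
      refine iSup_le fun q => iSup_le fun hq => ?_
      rintro _ ⟨B, hB, rfl⟩
      refine MeasurableSpace.measurableSet_invariants.2 ⟨PathSpace.measurable_eval q hB, ?_⟩
      ext η
      simp [PathSpace.stopAt, min_eq_left hq]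
    intro η
    have := (MeasurableSpace.measurableSet_invariants.1 (hle A hA)).2
    conv_lhs => rw [← this]
    rfl
  have hpath : ω.stopAt r = ω'.stopAt r := Subtype.ext (funext fun q => h _ (min_le_right q r))
  rw [key ω, key ω', hpath]

end JumpChain

/-! ### The uniformised jump chain: the martingale identity -/

section ChainLaw

variable {S : Type*} {G : ℝ≥0 × S → unitInterval → S} {s : ℝ≥0} {i : S}
  {ν : Measure (ℝ × unitInterval)} [IsProbabilityMeasure ν]

/-- Fubini for resampling one coordinate. -/
theorem integral_infinitePi_update {E : Type*} [MeasurableSpace E] {ν : Measure E}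
    [IsProbabilityMeasure ν] (n : ℕ) {h : (ℕ → E) → ℝ} (hm : Measurable h) {B : ℝ}
    (hB : ∀ ω, |h ω| ≤ B) :
    ∫ ω, h ω ∂(Measure.infinitePi fun _ : ℕ => ν)
      = ∫ ω, ∫ e, h (Function.update ω n e) ∂ν ∂(Measure.infinitePi fun _ : ℕ => ν) := by
  have hmeas := measurable_update_prod (E := E) n
  conv_lhs => rw [← map_update_infinitePi ν n]
  rw [integral_map hmeas.aemeasurable hm.aestronglyMeasurable]
  exact integral_prod (fun p : (ℕ → E) × E => h (Function.update p.1 n p.2))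
    (integrable_of_abs_le (hm.comp hmeas) fun p => hB _)

theorem lintegral_infinitePi_update {E : Type*} [MeasurableSpace E] {ν : Measure E}
    [IsProbabilityMeasure ν] (n : ℕ) {h : (ℕ → E) → ENNReal} (hm : Measurable h) :
    ∫⁻ ω, h ω ∂(Measure.infinitePi fun _ : ℕ => ν)
      = ∫⁻ ω, ∫⁻ e, h (Function.update ω n e) ∂ν ∂(Measure.infinitePi fun _ : ℕ => ν) := by
  have hmeas := measurable_update_prod (E := E) n
  conv_lhs => rw [← map_update_infinitePi ν n]
  rw [lintegral_map hm hmeas]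
  exact lintegral_prod (fun p : (ℕ → E) × E => h (Function.update p.1 n p.2))
    (hm.comp hmeas).aemeasurable

variable [MeasurableSpace S]

/-- The jump times diverge almost surely, since `E exp (-T n)` decays geometrically. -/
theorem ae_mem_regularSeq (hG : Measurable (Function.uncurry G)) (hpos : ∀ᵐ e ∂ν, 0 < e.1) :
    ∀ᵐ ω ∂(Measure.infinitePi fun _ : ℕ => ν), ω ∈ regularSeq G s i := by
  set Q := Measure.infinitePi fun _ : ℕ => ν with hQ
  have h1 : ∀ᵐ ω ∂Q, ∀ n, 0 < (ω n).1 := ae_all_iff.2 fun n =>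
    (measurePreserving_eval_infinitePi (fun _ : ℕ => ν) n).quasiMeasurePreserving.ae hpos
  let ex : ℝ → ENNReal := fun x => ENNReal.ofReal (Real.exp (-x))
  have hex : Measurable ex := (Real.measurable_exp.comp measurable_neg).ennreal_ofReal
  set ρ := ∫⁻ e, ex e.1 ∂ν with hρ
  have hρ1 : ρ < 1 := by
    have : ∫⁻ _ : ℝ × unitInterval, 1 ∂ν = 1 := by simp
    have hlt : ∀ᵐ e ∂ν, ex e.1 < 1 := hpos.mono fun e he => by
      rw [← ENNReal.ofReal_one]
      exact (ENNReal.ofReal_lt_ofReal_iff one_pos).2 (by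
        rw [← Real.exp_zero]; exact Real.exp_lt_exp.2 (by linarith))
    rw [hρ, ← this]
    refine lintegral_strict_mono (IsProbabilityMeasure.ne_zero ν) aemeasurable_const ?_ hlt
    exact ((lintegral_mono_ae (hlt.mono fun e he => he.le)).trans_lt (by simp)).ne
  have hT : ∀ n, Measurable fun ω => ex (chainStep G s i ω n).1 := fun n =>
    hex.comp (measurable_fst.comp (measurable_chainStep hG n))
  have hpow : ∀ n, ∫⁻ ω, ex (chainStep G s i ω n).1 ∂Q ≤ ρ ^ n := by
    intro n
    induction n with
    | zero =>
      have : ∀ ω : ℕ → ℝ × unitInterval, ex (chainStep G s i ω 0).1 ≤ 1 := fun ω => by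
        simp only [ex, chainStep]
        rw [ENNReal.ofReal_le_one, Real.exp_le_one_iff]
        simp
      simpa using lintegral_mono (μ := Q) this
    | succ n ih =>
      rw [lintegral_infinitePi_update n (hT (n + 1))]
      have : ∀ (ω : ℕ → ℝ × unitInterval) e,
          ex (chainStep G s i (Function.update ω n e) (n + 1)).1
            = ex (chainStep G s i ω n).1 * ex e.1 := fun ω e => by
        simp only [ex, chainStep, chainStep_update e le_rfl, Function.update_self]
        rw [← ENNReal.ofReal_mul (Real.exp_pos _).le, ← Real.exp_add, neg_add]
      have hexm : Measurable fun e : ℝ × unitInterval => ex e.1 := hex.comp measurable_fst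
      calc ∫⁻ ω, ∫⁻ e, ex (chainStep G s i (Function.update ω n e) (n + 1)).1 ∂ν ∂Q
          = ∫⁻ ω, ex (chainStep G s i ω n).1 * ρ ∂Q := by
            refine lintegral_congr fun ω => ?_
            rw [lintegral_congr (this ω), lintegral_const_mul _ hexm]
        _ = (∫⁻ ω, ex (chainStep G s i ω n).1 ∂Q) * ρ := lintegral_mul_const _ (hT n)
        _ ≤ ρ ^ (n + 1) := by rw [pow_succ]; gcongr
  have h2 : ∀ᵐ ω ∂Q, ∀ k : ℕ, ∃ n, (k : ℝ) < (chainStep G s i ω n).1 := by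
    refine ae_all_iff.2 fun k => ?_
    rw [ae_iff]
    push Not
    have hle : ∀ n, ex k * Q {ω | ∀ n, (chainStep G s i ω n).1 ≤ k} ≤ ρ ^ n := fun n => by
      refine le_trans ?_ (hpow n)
      refine le_trans ?_ (mul_meas_ge_le_lintegral (hT n) (ex k))
      refine mul_le_mul_right (measure_mono fun ω hω => ?_) _
      exact ENNReal.ofReal_le_ofReal (Real.exp_le_exp.2 (neg_le_neg (hω n)))
    have h0 : ex k * Q {ω | ∀ n, (chainStep G s i ω n).1 ≤ k} = 0 :=
      le_antisymm (ge_of_tendsto' (ENNReal.tendsto_pow_atTop_nhds_zero_of_lt_one hρ1) hle)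
        bot_le
    rcases mul_eq_zero.1 h0 with h | h
    · exact absurd h (by simp only [ex]; exact (ENNReal.ofReal_pos.2 (Real.exp_pos _)).ne')
    · exact h
  filter_upwards [h1, h2] with ω a b using ⟨a, b⟩

open Classical in
/-- The contribution of the `n`-th waiting time to the increment over `(a, b]` of the candidate
martingale `f (X t) - ∫ F (r, X r) dr`. -/
noncomputable def chainIncrement (G : ℝ≥0 × S → unitInterval → S) (s : ℝ≥0) (i : S)
    (f : S → ℝ) (F : ℝ≥0 → S → ℝ) (a b : ℝ) (n : ℕ) (ω : ℕ → ℝ × unitInterval) : ℝ :=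
  (if a < (chainStep G s i ω (n + 1)).1 ∧ (chainStep G s i ω (n + 1)).1 ≤ b then
    f (chainStep G s i ω (n + 1)).2 - f (chainStep G s i ω n).2 else 0)
  - ∫ r in a..b, if (chainStep G s i ω n).1 ≤ r ∧ r < (chainStep G s i ω (n + 1)).1 then
      F r.toNNReal (chainStep G s i ω n).2 else 0

variable {f : S → ℝ} {F : ℝ≥0 → S → ℝ} {Bf BF : ℝ} {a b : ℝ≥0}

omit [MeasurableSpace S] in
theorem abs_chainIncrement_le (hf : ∀ j, |f j| ≤ Bf) (hF : ∀ t j, |F t j| ≤ BF) (n : ℕ)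
    (ω : ℕ → ℝ × unitInterval) :
    |chainIncrement G s i f F a b n ω| ≤ 2 * Bf + BF * |(b : ℝ) - a| := by
  classical
  have h1 : 0 ≤ Bf := (abs_nonneg _).trans (hf i)
  have h2 : 0 ≤ BF := (abs_nonneg _).trans (hF 0 i)
  refine (abs_sub _ _).trans (add_le_add ?_ ?_)
  · split_ifs
    · refine (abs_sub _ _).trans ?_
      linarith [hf (chainStep G s i ω (n + 1)).2, hf (chainStep G s i ω n).2]
    · simpa using h1
  · rw [← Real.norm_eq_abs]
    refine intervalIntegral.norm_integral_le_of_norm_le_const fun r _ => ?_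
    rw [Real.norm_eq_abs]
    split_ifs
    · exact hF _ _
    · simpa using h2

theorem measurable_comp_chainStep [Countable S] [MeasurableSingletonClass S]
    (hG : Measurable (Function.uncurry G)) (hF : ∀ x, Measurable fun t => F t x) (n : ℕ) :
    Measurable fun p : (ℕ → ℝ × unitInterval) × ℝ =>
      F p.2.toNNReal (chainStep G s i p.1 n).2 := by
  have h1 : Measurable fun p : ℝ≥0 × S => F p.1 p.2 :=
    measurable_from_prod_countable_left fun x => hF x
  exact h1.comp ((measurable_real_toNNReal.comp measurable_snd).prodMk
    (measurable_snd.comp ((measurable_chainStep hG n).comp measurable_fst)))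

theorem measurable_chainIncrement [Countable S] [MeasurableSingletonClass S]
    (hG : Measurable (Function.uncurry G)) (hF : ∀ x, Measurable fun t => F t x) (n : ℕ) :
    Measurable (chainIncrement G s i f F a b n) := by
  classical
  have hT : ∀ n, Measurable fun ω => (chainStep G s i ω n).1 := fun n =>
    measurable_fst.comp (measurable_chainStep hG n)
  have hY : ∀ n, Measurable fun ω => f (chainStep G s i ω n).2 := fun n =>
    (measurable_of_countable f).comp (measurable_snd.comp (measurable_chainStep hG n))
  refine Measurable.sub ?_ ?_
  · exact Measurable.ite ((measurableSet_lt measurable_const (hT _)).inter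
      (measurableSet_le (hT _) measurable_const)) ((hY _).sub (hY _)) measurable_const
  · have h1 : Measurable fun p : (ℕ → ℝ × unitInterval) × ℝ =>
        if (chainStep G s i p.1 n).1 ≤ p.2 ∧ p.2 < (chainStep G s i p.1 (n + 1)).1 then
          F p.2.toNNReal (chainStep G s i p.1 n).2 else 0 :=
      Measurable.ite ((measurableSet_le ((hT _).comp measurable_fst) measurable_snd).inter
        (measurableSet_lt measurable_snd ((hT _).comp measurable_fst)))
        (measurable_comp_chainStep hG hF n) measurable_const
    have h2 : ∀ A : Set ℝ, Measurable fun ω : ℕ → ℝ × unitInterval => ∫ r in A,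
        if (chainStep G s i ω n).1 ≤ r ∧ r < (chainStep G s i ω (n + 1)).1 then
          F r.toNNReal (chainStep G s i ω n).2 else 0 := fun A =>
      (h1.stronglyMeasurable.integral_prod_right (ν := volume.restrict A)).measurable
    exact (h2 _).sub (h2 _)

/-- The contributions of the first `n` waiting times add up to the increment of the process
stopped after `n` jumps. -/
theorem sum_chainIncrement [Countable S] [MeasurableSingletonClass S]
    (hG : Measurable (Function.uncurry G))
    (hFm : ∀ x, Measurable fun t => F t x) (hF : ∀ t j, |F t j| ≤ BF)
    {ω : ℕ → ℝ × unitInterval} (hω : ∀ n, 0 < (ω n).1) (hsa : s ≤ a) (hab : a ≤ b) (n : ℕ) :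
    ∑ m ∈ Finset.range n, chainIncrement G s i f F a b m ω
      = f (chainPath G s i ω n b) - f (chainPath G s i ω n a)
        - ∫ r in (a : ℝ)..b, if r < (chainStep G s i ω n).1 then
            F r.toNNReal (chainPath G s i ω n r.toNNReal) else 0 := by
  classical
  have hab' : (a : ℝ) ≤ b := by exact_mod_cast hab
  have hBF : 0 ≤ BF := (abs_nonneg _).trans (hF 0 i)
  have hFm' : Measurable fun p : ℝ≥0 × S => F p.1 p.2 :=
    measurable_from_prod_countable_left fun x => hFm x
  have hint : ∀ (A : Set ℝ) (_ : MeasurableSet A) (g : ℝ → S), Measurable g →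
      IntervalIntegrable (fun r => if r ∈ A then F r.toNNReal (g r) else 0) volume a b := by
    intro A hA g hg
    refine intervalIntegrable_of_abs_le (Measurable.ite hA
      (hFm'.comp (measurable_real_toNNReal.prodMk hg)) measurable_const) (B := BF)
      (fun r => ?_) _ _
    split_ifs
    · exact hF _ _
    · simpa using hBF
  have hpath : ∀ n, Measurable fun r : ℝ => chainPath G s i ω n r.toNNReal := fun n =>
    (measurable_chainPath (s := s) (i := i) hG n).comp
      (measurable_const.prodMk measurable_real_toNNReal)
  induction n with
  | zero =>
    have h0 : ∫ r in (a : ℝ)..b, (if r < (chainStep G s i ω 0).1 then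
        F r.toNNReal (chainPath G s i ω 0 r.toNNReal) else 0) = 0 := by
      refine (intervalIntegral.integral_congr (g := fun _ => (0 : ℝ)) fun r hr => ?_).trans
        (by simp)
      rw [uIcc_of_le hab'] at hr
      have : ¬ r < (chainStep G s i ω 0).1 := not_lt.2
        (le_trans (by simpa [chainStep] using hsa) hr.1)
      simp only [this, if_false]
    rw [h0]
    simp [chainPath]
  | succ n ih =>
    rw [Finset.sum_range_succ, ih, chainIncrement]
    have hlt := chainStep_fst_lt_succ (G := G) (s := s) (i := i) hω n
    set τ := (chainStep G s i ω n).1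
    set τ' := (chainStep G s i ω (n + 1)).1
    have e1 : ∫ r in (a : ℝ)..b, (if r < τ' then
          F r.toNNReal (chainPath G s i ω (n + 1) r.toNNReal) else 0)
        = (∫ r in (a : ℝ)..b, if r < τ then
            F r.toNNReal (chainPath G s i ω n r.toNNReal) else 0)
          + ∫ r in (a : ℝ)..b, if τ ≤ r ∧ r < τ' then
            F r.toNNReal (chainStep G s i ω n).2 else 0 := by
      have i1 := hint (Iio τ) measurableSet_Iio _ (hpath n)
      have i2 := hint (Ico τ τ') measurableSet_Ico (fun _ => (chainStep G s i ω n).2)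
        measurable_const
      simp only [mem_Iio, mem_Ico] at i1 i2
      rw [← intervalIntegral.integral_add i1 i2]
      refine intervalIntegral.integral_congr fun r hr => ?_
      rw [uIcc_of_le hab'] at hr
      have hr0 : (r.toNNReal : ℝ) = r := Real.coe_toNNReal r ((NNReal.coe_nonneg _).trans hr.1)
      by_cases h1 : r < τ'
      · rw [if_pos h1, chainPath_succ_of_lt (by rw [hr0]; exact h1)]
        by_cases h2 : r < τ
        · simp [h2, not_le.2 h2]
        · have h3 := not_lt.1 h2
          simp only [h2, if_false, h3, h1, and_self, if_true, zero_add]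
          rw [chainPath_of_le (by rw [hr0]; exact h3)]
      · simp only [h1, if_false, and_false, not_lt.2 (hlt.le.trans (not_lt.1 h1)), add_zero]
    have e2 : f (chainPath G s i ω (n + 1) b) - f (chainPath G s i ω (n + 1) a)
        = f (chainPath G s i ω n b) - f (chainPath G s i ω n a)
          + if (a : ℝ) < τ' ∧ τ' ≤ b then
            f (chainStep G s i ω (n + 1)).2 - f (chainStep G s i ω n).2 else 0 := by
      by_cases h1 : τ' ≤ a
      · have h2 : τ' ≤ b := h1.trans hab'
        rw [chainPath_of_le h1, chainPath_of_le h2,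
          chainPath_of_le (n := n) (hlt.le.trans h1), chainPath_of_le (n := n) (hlt.le.trans h2)]
        simp [not_lt.2 h1]
      · have h1' := not_le.1 h1
        rw [chainPath_succ_of_lt h1']
        by_cases h2 : τ' ≤ b
        · rw [chainPath_of_le h2, chainPath_of_le (n := n) (hlt.le.trans h2)]
          simp [h1', h2]
        · rw [chainPath_succ_of_lt (not_le.1 h2)]
          simp [h2]
    rw [e1, e2]
    ring

variable [TopologicalSpace S] [DiscreteTopology S] [BorelSpace S] [Countable S]

/-- The increments are orthogonal to all events that are decided by the earlier waiting times. -/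
theorem integral_indicator_mul_chainIncrement (hG : Measurable (Function.uncurry G))
    (hf : ∀ j, |f j| ≤ Bf) (hFm : ∀ x, Measurable fun t => F t x) (hF : ∀ t j, |F t j| ≤ BF)
    (hstep : ∀ (τ : ℝ) (y : S), ∫ e : ℝ × unitInterval,
      ((if (a : ℝ) < τ + e.1 ∧ τ + e.1 ≤ b then f (G ((τ + e.1).toNNReal, y) e.2) - f y else 0)
        - ∫ r in (a : ℝ)..b, if τ ≤ r ∧ r < τ + e.1 then F r.toNNReal y else 0) ∂ν = 0)
    (n : ℕ) {A : Set (PathSpace S)} (hA : MeasurableSet A) :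
    ∫ ω, (chainPathSpace G s i n ⁻¹' A).indicator 1 ω * chainIncrement G s i f F a b n ω
      ∂(Measure.infinitePi fun _ : ℕ => ν) = 0 := by
  have hA' := measurable_chainPathSpace (s := s) (i := i) hG n hA
  rw [integral_infinitePi_update n (h := fun ω => (chainPathSpace G s i n ⁻¹' A).indicator 1 ω
    * chainIncrement G s i f F a b n ω) ((measurable_one.indicator hA').mul
    (measurable_chainIncrement hG hFm n)) (B := 2 * Bf + BF * |(b : ℝ) - a|)]
  · refine integral_eq_zero_of_ae (Eventually.of_forall fun ω => ?_)
    have h1 : ∀ e, (chainPathSpace G s i n ⁻¹' A).indicator (1 : (ℕ → ℝ × unitInterval) → ℝ)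
        (Function.update ω n e) = (chainPathSpace G s i n ⁻¹' A).indicator 1 ω := fun e => by
      have : chainPathSpace G s i n (Function.update ω n e) = chainPathSpace G s i n ω :=
        Subtype.ext (chainPath_update e le_rfl)
      have hiff : Function.update ω n e ∈ chainPathSpace G s i n ⁻¹' A
          ↔ ω ∈ chainPathSpace G s i n ⁻¹' A := by rw [mem_preimage, mem_preimage, this]
      by_cases h : ω ∈ chainPathSpace G s i n ⁻¹' A
      · rw [indicator_of_mem h, indicator_of_mem (hiff.2 h)]
        rfl
      · rw [indicator_of_notMem h, indicator_of_notMem (mt hiff.1 h)]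
    simp only [h1, integral_const_mul]
    refine mul_eq_zero_of_right _ ?_
    rw [← hstep (chainStep G s i ω n).1 (chainStep G s i ω n).2]
    refine integral_congr_ae (Eventually.of_forall fun e => ?_)
    simp only [chainIncrement, chainStep, chainStep_update e le_rfl, Function.update_self]
  · intro ω
    have h0 : 0 ≤ 2 * Bf + BF * |(b : ℝ) - a| :=
      (abs_nonneg _).trans (abs_chainIncrement_le (G := G) (s := s) (i := i) hf hF n ω)
    by_cases h : ω ∈ chainPathSpace G s i n ⁻¹' A
    · rw [indicator_of_mem h, Pi.one_apply, one_mul]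
      exact abs_chainIncrement_le hf hF n ω
    · rw [indicator_of_notMem h, zero_mul, abs_zero]; exact h0

/-- The martingale identity for the chain, provided that it holds for each single step `hstep`: the
increment over `[a, b]` is the sum of the contributions of the waiting times, and each of these is
orthogonal to the events known at time `a`. -/
theorem integral_indicator_mul_fullChainPath (hG : Measurable (Function.uncurry G))
    (hpos : ∀ᵐ e ∂ν, 0 < e.1)
    (hf : ∀ j, |f j| ≤ Bf) (hFm : ∀ x, Measurable fun t => F t x) (hF : ∀ t j, |F t j| ≤ BF)
    (hsa : s ≤ a) (hab : a ≤ b)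
    (hstep : ∀ (τ : ℝ) (y : S), ∫ e : ℝ × unitInterval,
      ((if (a : ℝ) < τ + e.1 ∧ τ + e.1 ≤ b then f (G ((τ + e.1).toNNReal, y) e.2) - f y else 0)
        - ∫ r in (a : ℝ)..b, if τ ≤ r ∧ r < τ + e.1 then F r.toNNReal y else 0) ∂ν = 0)
    {A : Set (PathSpace S)} (hA : MeasurableSet[canonicalFiltration S a] A) :
    ∫ ω, (fullChainPathSpace G s i ⁻¹' A).indicator 1 ω * (f (fullChainPath G s i ω b)
      - f (fullChainPath G s i ω a) - pathIntegral F a b (fullChainPathSpace G s i ω))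
      ∂(Measure.infinitePi fun _ : ℕ => ν) = 0 := by
  classical
  set Q := Measure.infinitePi fun _ : ℕ => ν with hQ
  have hab' : (a : ℝ) ≤ b := by exact_mod_cast hab
  have hA' : MeasurableSet A := (canonicalFiltration S).le a A hA
  have hreg := ae_mem_regularSeq (s := s) (i := i) hG hpos
  have hBF : 0 ≤ BF := (abs_nonneg _).trans (hF 0 i)
  have hpA := measurable_fullChainPathSpace (s := s) (i := i) hG hA'
  have hincI : ∀ (D : Set (ℕ → ℝ × unitInterval)) (_ : MeasurableSet D) (n : ℕ), Integrable
      (fun ω => D.indicator (1 : (ℕ → ℝ × unitInterval) → ℝ) ω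
        * chainIncrement G s i f F a b n ω) Q := fun D hD n =>
    integrable_of_abs_le ((measurable_one.indicator hD).mul (measurable_chainIncrement hG hFm n))
      (B := 1 * (2 * Bf + BF * |(b : ℝ) - a|)) fun ω => by
      rw [abs_mul]
      refine mul_le_mul ?_ (abs_chainIncrement_le hf hF n ω) (abs_nonneg _) zero_le_one
      by_cases h : ω ∈ D <;> simp [h]
  -- either the `n`-th waiting time ends before `a` and contributes nothing, or the event `A` is
  -- decided by the path with `n` jumps
  have hone : ∀ n, ∫ ω, (fullChainPathSpace G s i ⁻¹' A).indicator 1 ω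
      * chainIncrement G s i f F a b n ω ∂Q = 0 := fun n => by
    rw [← integral_indicator_mul_chainIncrement (s := s) (i := i) hG hf hFm hF hstep n hA']
    refine integral_congr_ae ?_
    filter_upwards [hreg] with ω hω
    by_cases h : (chainStep G s i ω (n + 1)).1 ≤ a
    · have : chainIncrement G s i f F a b n ω = 0 := by
        have h0 : ∫ r in (a : ℝ)..b, (if (chainStep G s i ω n).1 ≤ r ∧
            r < (chainStep G s i ω (n + 1)).1 then
            F r.toNNReal (chainStep G s i ω n).2 else 0) = 0 := by
          refine (intervalIntegral.integral_congr (g := fun _ => (0 : ℝ)) fun r hr => ?_).trans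
            (by simp)
          rw [uIcc_of_le hab'] at hr
          simp only [not_lt.2 (h.trans hr.1), and_false, if_false]
        rw [chainIncrement, h0]
        simp [not_lt.2 h]
      simp [this]
    · have hiff : fullChainPathSpace G s i ω ∈ A ↔ chainPathSpace G s i n ω ∈ A :=
        mem_iff_of_eqOn hA fun q hq => fullChainPath_eq hω
          (lt_of_le_of_lt (by exact_mod_cast hq) (not_le.1 h))
      simp only [indicator, mem_preimage, hiff]
  have hzero : ∀ n, ∫ ω, (fullChainPathSpace G s i ⁻¹' A).indicator 1 ω
      * ∑ m ∈ Finset.range n, chainIncrement G s i f F a b m ω ∂Q = 0 := fun n => by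
    simp only [Finset.mul_sum]
    rw [integral_finsetSum _ fun m _ => hincI _ hpA m]
    exact Finset.sum_eq_zero fun m _ => hone m
  have hlim := tendsto_integral_of_dominated_convergence (μ := Q)
    (F := fun n ω => (fullChainPathSpace G s i ⁻¹' A).indicator 1 ω
      * ∑ m ∈ Finset.range n, chainIncrement G s i f F a b m ω)
    (f := fun ω => (fullChainPathSpace G s i ⁻¹' A).indicator 1 ω * (f (fullChainPath G s i ω b)
      - f (fullChainPath G s i ω a) - pathIntegral F a b (fullChainPathSpace G s i ω)))
    (fun _ => 2 * Bf + BF * |(b : ℝ) - a|) (fun n => ?_) (integrable_const _) (fun n => ?_) ?_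
  · simp only [hzero] at hlim
    exact (tendsto_nhds_unique hlim tendsto_const_nhds)
  · exact ((measurable_one.indicator hpA).mul (Finset.measurable_sum _ fun m _ =>
      measurable_chainIncrement hG hFm m)).aestronglyMeasurable
  · filter_upwards [hreg] with ω hω
    have h1 : |∑ m ∈ Finset.range n, chainIncrement G s i f F a b m ω|
        ≤ 2 * Bf + BF * |(b : ℝ) - a| := by
      rw [sum_chainIncrement hG hFm hF hω.1 hsa hab n]
      refine (abs_sub _ _).trans (add_le_add ?_ ?_)
      · refine (abs_sub _ _).trans ?_
        linarith [hf (chainPath G s i ω n b), hf (chainPath G s i ω n a)]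
      · rw [← Real.norm_eq_abs]
        refine intervalIntegral.norm_integral_le_of_norm_le_const fun r _ => ?_
        rw [Real.norm_eq_abs]
        split_ifs
        · exact hF _ _
        · simpa using hBF
    rw [norm_mul, Real.norm_eq_abs, Real.norm_eq_abs]
    by_cases h : ω ∈ fullChainPathSpace G s i ⁻¹' A
    · simpa [h] using h1
    · simpa [h] using (abs_nonneg _).trans h1
  · filter_upwards [hreg] with ω hω
    obtain ⟨N, hN⟩ := exists_lt_chainStep hω b
    refine tendsto_const_nhds.congr' ?_
    filter_upwards [eventually_ge_atTop (N + 1)] with n hn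
    have hbn : (b : ℝ) < (chainStep G s i ω n).1 := hN.trans_le (chainStep_fst_mono hω.1 hn)
    have hlt : ∀ r : ℝ≥0, r ≤ b → fullChainPath G s i ω r = chainPath G s i ω n r := fun r hr =>
      fullChainPath_eq hω (lt_of_le_of_lt (b := (b : ℝ)) (by exact_mod_cast hr)
        (hbn.trans (chainStep_fst_lt_succ hω.1 n)))
    rw [sum_chainIncrement hG hFm hF hω.1 hsa hab n, hlt b le_rfl, hlt a hab]
    congr 2
    refine intervalIntegral.integral_congr fun r hr => ?_
    rw [uIcc_of_le hab'] at hr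
    have hr' : r.toNNReal ≤ b := by rw [Real.toNNReal_le_iff_le_coe]; exact hr.2
    simp only [lt_of_le_of_lt hr.2 hbn, if_true]
    rw [← hlt _ hr']
    rfl

end ChainLaw

/-! ### Existence for the martingale problem -/

section Existence

variable {S : Type*} [Countable S] [TopologicalSpace S] [DiscreteTopology S]
  [MeasurableSpace S] [BorelSpace S]
  {U : S → Type*} [∀ i, MetricSpace (U i)] [∀ i, MeasurableSpace (U i)] [∀ i, BorelSpace (U i)]
  {lam : (i : S) → S → U i → ℝ} {u : MarkovControl U} {M : ℝ}

/-- One step of the uniformised chain: the expected change of `f` at the next jump is compensated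
by the integral of the generator up to that jump. -/
theorem integral_chain_step_eq_zero (hlam : RateAssumptions lam) (hM0 : 0 < M)
    (hM : ∀ i u, -lam i i u ≤ M) {G : ℝ≥0 × S → unitInterval → S}
    (hG : Measurable (Function.uncurry G))
    (hGu : ∀ (p : ℝ≥0 × S) (f : S → ℝ) (B : ℝ), (∀ j, |f j| ≤ B) →
      ∫ v, f (G p v) = f p.2 + generator lam u p.1 f p.2 / M)
    {f : S → ℝ} {B : ℝ} (hf : ∀ j, |f j| ≤ B) {a b : ℝ} (hab : a ≤ b) (τ : ℝ) (y : S) :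
    ∫ e : ℝ × unitInterval,
      ((if a < τ + e.1 ∧ τ + e.1 ≤ b then f (G ((τ + e.1).toNNReal, y) e.2) - f y else 0)
        - ∫ r in a..b, if τ ≤ r ∧ r < τ + e.1 then generator lam u r.toNNReal f y else 0)
      ∂((expMeasure M).prod volume) = 0 := by
  classical
  have := isProbabilityMeasure_expMeasure hM0
  have hB0 : 0 ≤ B := (abs_nonneg _).trans (hf y)
  have hgm : Measurable fun r : ℝ => generator lam u r.toNNReal f y :=
    (measurable_generator hlam hf y).comp measurable_real_toNNReal
  have hgb : ∀ r : ℝ, |generator lam u r.toNNReal f y| ≤ 2 * M * B := fun r =>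
    abs_generator_le hlam hM hf _ _
  have hfG : Measurable fun e : ℝ × unitInterval => f (G ((τ + e.1).toNNReal, y) e.2) :=
    (measurable_of_countable f).comp (hG.comp (((measurable_real_toNNReal.comp
      (measurable_const.add measurable_fst)).prodMk measurable_const).prodMk measurable_snd))
  have hA : Integrable (fun e : ℝ × unitInterval =>
      if a < τ + e.1 ∧ τ + e.1 ≤ b then f (G ((τ + e.1).toNNReal, y) e.2) - f y else 0)
      ((expMeasure M).prod volume) := by
    refine integrable_of_abs_le (B := 2 * B) (Measurable.ite
      ((measurableSet_lt measurable_const (measurable_const.add measurable_fst)).inter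
        (measurableSet_le (measurable_const.add measurable_fst) measurable_const))
      (hfG.sub measurable_const) measurable_const) fun e => ?_
    split_ifs
    · refine (abs_sub _ _).trans ?_
      linarith [hf (G ((τ + e.1).toNNReal, y) e.2), hf y]
    · simpa using hB0
  have hIm : Measurable fun x : ℝ =>
      ∫ r in a..b, if τ ≤ r ∧ r < τ + x then generator lam u r.toNNReal f y else 0 := by
    have h1 : Measurable fun p : ℝ × ℝ =>
        if τ ≤ p.2 ∧ p.2 < τ + p.1 then generator lam u p.2.toNNReal f y else 0 :=
      Measurable.ite ((measurableSet_le measurable_const measurable_snd).inter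
        (measurableSet_lt measurable_snd (measurable_const.add measurable_fst)))
        (hgm.comp measurable_snd) measurable_const
    have h2 : ∀ A : Set ℝ, Measurable fun x : ℝ => ∫ r in A,
        if τ ≤ r ∧ r < τ + x then generator lam u r.toNNReal f y else 0 := fun A =>
      (h1.stronglyMeasurable.integral_prod_right (ν := volume.restrict A)).measurable
    exact (h2 _).sub (h2 _)
  have hI : Integrable (fun e : ℝ × unitInterval =>
      ∫ r in a..b, if τ ≤ r ∧ r < τ + e.1 then generator lam u r.toNNReal f y else 0)
      ((expMeasure M).prod volume) := by
    refine integrable_of_abs_le (B := 2 * M * B * |b - a|) (hIm.comp measurable_fst) fun e => ?_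
    rw [← Real.norm_eq_abs]
    refine intervalIntegral.norm_integral_le_of_norm_le_const fun r _ => ?_
    rw [Real.norm_eq_abs]
    split_ifs
    · exact hgb r
    · simpa using (abs_nonneg _).trans (hgb 0)
  rw [integral_sub hA hI, integral_prod _ hA, integral_prod _ hI, sub_eq_zero]
  have hc : ∀ x : ℝ, ∫ _ : unitInterval, (∫ r in a..b,
      if τ ≤ r ∧ r < τ + x then generator lam u r.toNNReal f y else 0)
      = ∫ r in a..b, if τ ≤ r ∧ r < τ + x then generator lam u r.toNNReal f y else 0 :=
    fun x => by rw [integral_const, probReal_univ, one_smul]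
  refine Eq.trans ?_ (integral_congr_ae (Eventually.of_forall fun x => hc x)).symm
  rw [← integral_expMeasure_compensator hM0 hgm hgb τ hab]
  refine integral_congr_ae (Eventually.of_forall fun x => ?_)
  dsimp only
  split_ifs
  · have h1 : Integrable (fun v : unitInterval => f (G ((τ + x).toNNReal, y) v)) volume :=
      integrable_of_abs_le (hfG.comp measurable_prodMk_left) fun v => hf _
    rw [integral_sub h1 (integrable_const _), hGu _ f B hf]
    simp
  · simp

omit [Countable S] [BorelSpace S] in
/-- By right-continuity it suffices to compare the path with its value at time `s` at each fixed
time before `s`. -/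
theorem PathSpace.ae_eq_of_forall_ae_eq {P : Measure (PathSpace S)} {s : ℝ≥0}
    (h : ∀ r ≤ s, ∀ᵐ ω ∂P, ω.1 r = ω.1 s) : ∀ᵐ ω ∂P, ∀ r ≤ s, ω.1 r = ω.1 s := by
  have h1 : ∀ᵐ ω ∂P, ∀ n, TopologicalSpace.denseSeq ℝ≥0 n ≤ s →
      ω.1 (TopologicalSpace.denseSeq ℝ≥0 n) = ω.1 s := by
    refine ae_all_iff.2 fun n => ?_
    by_cases hn : TopologicalSpace.denseSeq ℝ≥0 n ≤ s
    · filter_upwards [h _ hn] with ω hω _ using hω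
    · exact Eventually.of_forall fun ω h => absurd h hn
  filter_upwards [h1] with ω hω r hr
  rcases hr.eq_or_lt with rfl | hr
  · rfl
  have h2 : ∀ᶠ q in 𝓝[≥] r, ω.1 q = ω.1 r :=
    (ω.2.1 r).eventually (p := fun x => x = ω.1 r) (by rw [nhds_discrete]; rfl)
  obtain ⟨v, hv, hv'⟩ := (mem_nhdsGE_iff_exists_Ico_subset' hr).1 h2
  obtain ⟨n, hn⟩ := (TopologicalSpace.denseRange_denseSeq ℝ≥0).exists_mem_open
    (isOpen_Ioo (a := r) (b := min v s)) (nonempty_Ioo.2 (lt_min hv hr))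
  have h3 : ω.1 (TopologicalSpace.denseSeq ℝ≥0 n) = ω.1 r :=
    hv' ⟨hn.1.le, hn.2.trans_le (min_le_left v s)⟩
  rw [← h3]
  exact hω n (hn.2.le.trans (min_le_right v s))

/-- The uniformised chain solves the martingale problem. -/
theorem exists_solvesMartingaleProblem (hlam : RateAssumptions lam) (u : MarkovControl U)
    (s : ℝ≥0) (i : S) : ∃ P, SolvesMartingaleProblem lam u s (Measure.dirac i) P := by
  have : Nonempty S := ⟨i⟩
  obtain ⟨M, hM0, hM⟩ := hlam.exists_bound
  obtain ⟨G, hG, hGu⟩ := exists_measurable_sampler hlam u hM0 hM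
  have := isProbabilityMeasure_expMeasure hM0
  set ν : Measure (ℝ × unitInterval) := (expMeasure M).prod volume with hν
  set Q := Measure.infinitePi fun _ : ℕ => ν with hQ
  have hY := measurable_fullChainPathSpace (s := s) (i := i) hG
  have hP : IsProbabilityMeasure (Q.map (fullChainPathSpace G s i)) :=
    Measure.isProbabilityMeasure_map hY.aemeasurable
  refine ⟨Q.map (fullChainPathSpace G s i), hP, ?_, ?_, ?_⟩
  · have h : ∀ ω : ℕ → ℝ × unitInterval, ∀ r ≤ s,
        (fullChainPathSpace G s i ω).1 r = (fullChainPathSpace G s i ω).1 s := fun ω r hr =>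
      (fullChainPath_of_le hr).trans (fullChainPath_of_le le_rfl).symm
    exact PathSpace.ae_eq_of_forall_ae_eq fun r hr => (ae_map_iff hY.aemeasurable
      (measurableSet_eq_fun (PathSpace.measurable_eval r) (PathSpace.measurable_eval s))).2
      (Eventually.of_forall fun ω => h ω r hr)
  · rw [Measure.map_map (PathSpace.measurable_eval s) hY]
    have h : (fun ω : PathSpace S => ω.1 s) ∘ fullChainPathSpace G s i = fun _ => i :=
      funext fun ω => fullChainPath_of_le le_rfl
    rw [h, Measure.map_const, measure_univ, one_smul]
  · rintro f ⟨B, hf⟩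
    have hFm := measurable_generator (u := u) hlam hf
    have hF := abs_generator_le (u := u) hlam hM hf
    set N : ℝ≥0 → PathSpace S → ℝ := fun t ω =>
      f (ω.1 t) - pathIntegral (fun t => generator lam u t f) s (max s t : ℝ≥0) ω with hN
    have hNm : ∀ t, Measurable (N t) := fun t =>
      ((measurable_of_countable f).comp (PathSpace.measurable_eval t)).sub
        (measurable_pathIntegral hFm _ _)
    have hNa : ∀ t, Measurable[canonicalFiltration S t] (N t) := fun t =>
      PathSpace.measurable_of_stop (hNm t) fun ω => by
        have h1 : (ω.stopAt t).1 t = ω.1 t := by simp [PathSpace.stopAt]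
        simp only [hN, h1]
        rcases le_total s t with h | h
        · rw [max_eq_right h, pathIntegral_stop h le_rfl]
        · rw [max_eq_left h]
          simp [pathIntegral]
    have hNi : ∀ t, Integrable (N t) (Q.map (fullChainPathSpace G s i)) := fun t =>
      integrable_of_abs_le (hNm t) fun ω => (abs_sub _ _).trans
        (add_le_add (hf _) (abs_pathIntegral_le hF _ _ ω))
    -- along the chain, which rests up to time `s`, the process does not move before time `s`
    have hNs : ∀ t ω, N t (fullChainPathSpace G s i ω) = f (fullChainPath G s i ω (max s t))
        - pathIntegral (fun t => generator lam u t f) s (max s t : ℝ≥0)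
          (fullChainPathSpace G s i ω) := fun t ω => by
      have h1 : fullChainPath G s i ω t = fullChainPath G s i ω (max s t) := by
        rcases le_total s t with h | h
        · rw [max_eq_right h]
        · rw [max_eq_left h, fullChainPath_of_le h, fullChainPath_of_le le_rfl]
      rw [← h1]
      rfl
    refine ⟨fun t => (hNa t).stronglyMeasurable, fun a b hab => ?_⟩
    refine (ae_eq_condExp_of_forall_setIntegral_eq ((canonicalFiltration S).le a) (hNi b)
      (fun D _ _ => (hNi a).integrableOn) (fun D hD _ => ?_)
      (hNa a).stronglyMeasurable.aestronglyMeasurable).symm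
    have hab' : max s a ≤ max s b := max_le_max_left s hab
    have hD' : MeasurableSet D := (canonicalFiltration S).le a D hD
    have hkey := integral_indicator_mul_fullChainPath (ν := ν) (s := s) (i := i) hG ?_ hf hFm hF
      (le_max_left s a) hab'
      (integral_chain_step_eq_zero hlam hM0 hM hG hGu hf (by exact_mod_cast hab'))
      ((canonicalFiltration S).mono (le_max_right s a) D hD)
    · rw [eq_comm, ← sub_eq_zero, ← integral_sub (hNi b).integrableOn (hNi a).integrableOn,
        ← integral_indicator hD']
      change ∫ ω, D.indicator (N b - N a) ω ∂_ = 0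
      rw [integral_map hY.aemeasurable ((((hNm b).sub (hNm a)).indicator hD').aestronglyMeasurable),
        ← hkey]
      refine integral_congr_ae (Eventually.of_forall fun ω => ?_)
      by_cases h : fullChainPathSpace G s i ω ∈ D
      · have h2 := pathIntegral_add_adjacent hFm hF s (max s a : ℝ≥0) (max s b : ℝ≥0)
          (fullChainPathSpace G s i ω)
        simp only [indicator, mem_preimage, h, if_true, Pi.one_apply, one_mul, Pi.sub_apply, hNs]
        linarith
      · simp only [indicator, mem_preimage, h, if_false, zero_mul]
    · have h1 : ∀ᵐ x ∂(ν.map Prod.fst), 0 < x := by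
        rw [hν, Measure.map_fst_prod, measure_univ, one_smul]
        exact ae_pos_expMeasure hM0
      exact ae_of_ae_map measurable_fst.aemeasurable h1

end Existence

/-! ### Verification -/

section Verification

variable {S : Type*} {U : S → Type*} {lam : (i : S) → S → U i → ℝ}
  {c : ℝ≥0 → (i : S) → U i → ℝ} {g : S → ℝ} {θ C : ℝ} {T : ℝ≥0} {φ ψ : ℝ≥0 → S → ℝ}

theorem IsHJBSolution.congr [TopologicalSpace S] (hφ : IsHJBSolution lam c g θ T φ)
    (h : ∀ t ≤ T, ∀ i, φ t i = ψ t i) : IsHJBSolution lam c g θ T ψ := by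
  have h' : ∀ i, EqOn (fun r : ℝ => ψ r.toNNReal i) (fun r : ℝ => φ r.toNNReal i)
      (Ico 0 (T : ℝ)) := fun i r hr =>
    (h _ (Real.toNNReal_le_iff_le_coe.2 hr.2.le) i).symm
  obtain ⟨B, hB⟩ := hφ.bounded
  refine ⟨⟨B, fun t ht i => h t ht i ▸ hB t ht i⟩, ?_, fun i => (hφ.contDiffOn i).congr (h' i),
    fun t ht i => ?_, fun i => (h T le_rfl i).symm.trans (hφ.terminal i)⟩
  · exact hφ.continuousOn.congr fun p hp => (h p.1 hp.1 p.2).symm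
  · rw [derivWithin_congr (h' i) (by simpa using (h t ht.le i).symm)]
    simpa only [hjbTerm_congr fun j => h t ht.le j] using hφ.equation t ht i

theorem IsPointwiseMinimiser.congr [∀ i, MeasurableSpace (U i)] {u : MarkovControl U}
    (hu : IsPointwiseMinimiser lam c θ T φ u) (h : ∀ t ≤ T, ∀ i, φ t i = ψ t i) :
    IsPointwiseMinimiser lam c θ T ψ u := fun t ht i => by
  have := hu t ht i
  simpa only [hjbTerm_congr fun j => h t ht.le j] using this

theorem IsMildHJBSolution.terminal (hφ : IsMildHJBSolution lam c g θ T φ) (i : S) :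
    φ T i = Real.exp (θ * g i) := by
  rw [hφ.integral_eq T le_rfl, intervalIntegral.integral_same, add_zero]

theorem expCost_eq_integral_exp_mul [∀ i, MeasurableSpace (U i)] [TopologicalSpace S]
    [MeasurableSpace S] {u : MarkovControl U} (t : ℝ≥0) (i : S) :
    expCost lam c g θ T u t i = ∫ ω, Real.exp
      (pathIntegral (fun q x => θ * c q x (u.act q x)) t T ω) * Real.exp (θ * g (ω.1 T))
      ∂(controlledLaw lam u t i) := by
  refine integral_congr_ae (Eventually.of_forall fun ω => ?_)
  simp only [pathIntegral, intervalIntegral.integral_const_mul, mul_add, Real.exp_add]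

variable [∀ i, MetricSpace (U i)]

theorem IsMildHJBSolution.sub_eq_neg_integral [∀ i, CompactSpace (U i)]
    (hlam : RateAssumptions lam)
    (hc : ∀ i, Continuous fun p : ℝ≥0 × U i => c p.1 i p.2)
    (hφ : IsMildHJBSolution lam c g θ T φ) {a b : ℝ≥0} (hab : a ≤ b) (hb : b ≤ T) (i : S) :
    φ b i - φ a i = -∫ q in (a : ℝ)..b, hamiltonian lam c θ φ q.toNNReal i := by
  obtain ⟨B, hB⟩ := hφ.bounded
  have hH : Continuous fun r : ℝ => hamiltonian lam c θ φ r.toNNReal i :=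
    (continuous_hamiltonian hlam hc hφ.continuous hB i).comp continuous_real_toNNReal
  rw [hφ.integral_eq b hb, hφ.integral_eq a (hab.trans hb),
    ← intervalIntegral.integral_add_adjacent_intervals (hH.intervalIntegrable (a : ℝ) b)
      (hH.intervalIntegrable (b : ℝ) T)]
  ring

variable [∀ i, MeasurableSpace (U i)] [∀ i, BorelSpace (U i)] {u : MarkovControl U}

theorem measurable_runningCost [∀ i, CompactSpace (U i)]
    (hc : ∀ i, Continuous fun p : ℝ≥0 × U i => c p.1 i p.2) (i : S) :
    Measurable fun t => θ * c t i (u.act t i) :=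
  ((hc i).measurable.comp (measurable_id.prodMk (u.measurable_act i))).const_mul θ

/-- A measurable selection of minimisers in the HJB equation. -/
theorem IsMildHJBSolution.exists_markovControl [∀ i, CompactSpace (U i)]
    [∀ i, Nonempty (U i)] (hlam : RateAssumptions lam)
    (hc : ∀ i, Continuous fun p : ℝ≥0 × U i => c p.1 i p.2)
    (hφ : IsMildHJBSolution lam c g θ T φ) :
    ∃ u : MarkovControl U, IsPointwiseMinimiser lam c θ T φ u := by
  obtain ⟨B, hB⟩ := hφ.bounded
  choose a ha hmin using fun i => exists_measurable_argmin
    (f := fun t u => hjbTerm lam c θ φ t i u) (continuous_hjbTerm hlam hc hφ.continuous hB i)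
  exact ⟨⟨fun t i => a i t, ha⟩, fun t _ i => hmin i t⟩

variable [Countable S] [TopologicalSpace S] [DiscreteTopology S] [MeasurableSpace S]
  [BorelSpace S]

theorem solvesMartingaleProblem_controlledLaw (hlam : RateAssumptions lam) (u : MarkovControl U)
    (s : ℝ≥0) (i : S) :
    SolvesMartingaleProblem lam u s (Measure.dirac i) (controlledLaw lam u s i) :=
  Classical.epsilon_spec (exists_solvesMartingaleProblem hlam u s i)

variable [∀ i, CompactSpace (U i)]

/-- Verification, lower bound: no control does better than the solution of the HJB equation. -/
theorem IsMildHJBSolution.le_expCost [∀ i, Nonempty (U i)] (hlam : RateAssumptions lam) (hθ : 0 ≤ θ)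
    (hc : ∀ i, Continuous fun p : ℝ≥0 × U i => c p.1 i p.2) (hC : ∀ t i u, |c t i u| ≤ C)
    (hφ : IsMildHJBSolution lam c g θ T φ) (u : MarkovControl U) {t : ℝ≥0} (ht : t ≤ T) (i : S) :
    φ t i ≤ expCost lam c g θ T u t i := by
  obtain ⟨B, hB⟩ := hφ.bounded
  obtain ⟨M, hM0, hM⟩ := hlam.exists_bound
  have hk : ∀ (t : ℝ≥0) (x : S), |θ * c t x (u.act t x)| ≤ θ * C := fun t x => by
    rw [abs_mul, abs_of_nonneg hθ]
    exact mul_le_mul_of_nonneg_left (hC _ _ _) hθ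
  have h := (solvesMartingaleProblem_controlledLaw hlam u t i).le_integral_exp_mul hlam
    (measurable_runningCost (θ := θ) hc) hk hB
    (fun x => (continuous_hamiltonian hlam hc hφ.continuous hB x).measurable)
    (fun q x => abs_hamiltonian_le hlam hM hθ hC (hB q) x) ht
    (fun a b hab hb x => hφ.sub_eq_neg_integral hlam hc hab hb x)
    (fun q _ x => ciInf_le ⟨-((θ * C + 2 * M) * B), by
      rintro _ ⟨v, rfl⟩
      exact (abs_le.1 (abs_hjbTerm_le hlam hM hθ hC (hB q) x v)).1⟩ (u.act q x))
  rw [expCost_eq_integral_exp_mul]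
  simpa only [hφ.terminal] using h

/-- Verification, attainment: for a control that minimises pointwise, the Hamiltonian inequality
also holds for `-φ`. -/
theorem IsMildHJBSolution.expCost_le [∀ i, Nonempty (U i)] (hlam : RateAssumptions lam) (hθ : 0 ≤ θ)
    (hc : ∀ i, Continuous fun p : ℝ≥0 × U i => c p.1 i p.2) (hC : ∀ t i u, |c t i u| ≤ C)
    (hφ : IsMildHJBSolution lam c g θ T φ) (hu : IsPointwiseMinimiser lam c θ T φ u)
    {t : ℝ≥0} (ht : t ≤ T) (i : S) :
    expCost lam c g θ T u t i ≤ φ t i := by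
  obtain ⟨B, hB⟩ := hφ.bounded
  obtain ⟨M, hM0, hM⟩ := hlam.exists_bound
  have hk : ∀ (t : ℝ≥0) (x : S), |θ * c t x (u.act t x)| ≤ θ * C := fun t x => by
    rw [abs_mul, abs_of_nonneg hθ]
    exact mul_le_mul_of_nonneg_left (hC _ _ _) hθ
  have h := (solvesMartingaleProblem_controlledLaw hlam u t i).le_integral_exp_mul hlam
    (ψ := fun q x => -φ q x) (H := fun q x => -hamiltonian lam c θ φ q x)
    (measurable_runningCost (θ := θ) hc) hk (fun q x => (abs_neg _).trans_le (hB q x))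
    (fun x => (continuous_hamiltonian hlam hc hφ.continuous hB x).measurable.neg)
    (fun q x => (abs_neg _).trans_le (abs_hamiltonian_le hlam hM hθ hC (hB q) x)) ht
    (fun a b hab hb x => by
      rw [intervalIntegral.integral_neg, ← hφ.sub_eq_neg_integral hlam hc hab hb x]
      ring)
    (fun q hq x => by
      have h1 : hamiltonian lam c θ φ q x = _ := (hu q hq x).symm
      rw [h1, hjbTerm, generator]
      simp only [mul_neg, tsum_neg]
      exact le_of_eq (by ring))
  rw [expCost_eq_integral_exp_mul]
  simp only [hφ.terminal, mul_neg, integral_neg] at h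
  linarith

theorem one_le_expCost (hlam : RateAssumptions lam) (hθ : 0 ≤ θ)
    (hc : ∀ i, Continuous fun p : ℝ≥0 × U i => c p.1 i p.2) (hC : ∀ t i u, |c t i u| ≤ C)
    (hc0 : ∀ t i u, 0 ≤ c t i u) (hg0 : ∀ i, 0 ≤ g i) {G : ℝ} (hG : ∀ i, g i ≤ G)
    (u : MarkovControl U) {t : ℝ≥0} (ht : t ≤ T) (i : S) :
    1 ≤ expCost lam c g θ T u t i := by
  have := (solvesMartingaleProblem_controlledLaw hlam u t i).isProbabilityMeasure
  have hkm : ∀ x, Measurable fun t => c t x (u.act t x) := fun x => by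
    simpa using measurable_runningCost (θ := 1) (u := u) hc x
  have hi0 : ∀ ω : PathSpace S, 0 ≤ pathIntegral (fun q x => c q x (u.act q x)) t T ω := fun ω =>
    intervalIntegral.integral_nonneg (by exact_mod_cast ht) fun r _ => hc0 _ _ _
  have hm : Measurable fun ω : PathSpace S => Real.exp (θ *
      (pathIntegral (fun q x => c q x (u.act q x)) t T ω + g (ω.1 T))) :=
    Real.measurable_exp.comp (((measurable_pathIntegral hkm _ _).add
      ((measurable_of_countable g).comp (PathSpace.measurable_eval T))).const_mul θ)
  have h1 : ∫ _ : PathSpace S, (1 : ℝ) ∂(controlledLaw lam u t i) = 1 := by simp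
  rw [← h1]
  refine integral_mono (integrable_const _) (integrable_of_abs_le hm
    (B := Real.exp (θ * (C * |(T : ℝ) - t| + G))) fun ω => ?_) fun ω => ?_
  · rw [abs_of_pos (Real.exp_pos _)]
    refine Real.exp_le_exp.2 (mul_le_mul_of_nonneg_left (add_le_add ?_ (hG _)) hθ)
    exact (le_abs_self _).trans (abs_pathIntegral_le
      (F := fun q x => c q x (u.act q x)) (fun q x => hC _ _ _) _ _ ω)
  · exact Real.one_le_exp (mul_nonneg hθ (add_nonneg (hi0 ω) (hg0 _)))

/-- A solution of the HJB equation agrees with the value function. -/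
theorem IsHJBSolution.eq_valueFunction [∀ i, Nonempty (U i)] (hlam : RateAssumptions lam)
    (hθ : 0 ≤ θ) (hc : ∀ i, Continuous fun p : ℝ≥0 × U i => c p.1 i p.2)
    (hC : ∀ t i u, |c t i u| ≤ C) (hφ : IsHJBSolution lam c g θ T φ) {t : ℝ≥0} (ht : t ≤ T)
    (i : S) : φ t i = valueFunction lam c g θ T t i := by
  have hmild := hφ.isMildHJBSolution hlam hc
  obtain ⟨u, hu⟩ := hmild.exists_markovControl hlam hc
  have hle := fun v : MarkovControl U => hmild.le_expCost hlam hθ hc hC v ht i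
  have hge := hmild.expCost_le hlam hθ hc hC hu ht i
  rw [min_eq_left ht] at hge
  simp only [min_eq_left ht] at hle
  have : Nonempty (MarkovControl U) := ⟨u⟩
  exact le_antisymm (le_ciInf hle) ((ciInf_le ⟨_, by rintro _ ⟨v, rfl⟩; exact hle v⟩ u).trans hge)

end Verification

/-! ### The value function -/

theorem theorem2p3
    {S : Type*} [Countable S] [TopologicalSpace S] [DiscreteTopology S]
    [MeasurableSpace S] [BorelSpace S]
    {U : S → Type*} [∀ i, MetricSpace (U i)] [∀ i, CompactSpace (U i)] [∀ i, Nonempty (U i)]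
    [∀ i, MeasurableSpace (U i)] [∀ i, BorelSpace (U i)]
    (lam : (i : S) → S → U i → ℝ) (hlam : RateAssumptions lam)
    (c : ℝ≥0 → (i : S) → U i → ℝ)
    (hc_nonneg : ∀ t i u, 0 ≤ c t i u)
    (hc_bdd : ∃ C : ℝ, ∀ t i u, c t i u ≤ C)
    (hc_cont : ∀ i, Continuous fun p : ℝ≥0 × U i => c p.1 i p.2)
    (g : S → ℝ) (hg_nonneg : ∀ i, 0 ≤ g i) (hg_bdd : ∃ C : ℝ, ∀ i, g i ≤ C)
    (θ : ℝ) (hθ_pos : 0 < θ) (hθ_lt : θ < 1) (T : ℝ≥0) (hT : 0 < T) :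
    -- the law of the controlled chain is well defined
    (∀ (u : MarkovControl U) (s : ℝ≥0) (i : S),
      ∃! P : Measure (PathSpace S), SolvesMartingaleProblem lam u s (Measure.dirac i) P) ∧
    -- the value function is the unique solution of the HJB equation
    IsHJBSolution lam c g θ T (valueFunction lam c g θ T) ∧
    (∀ φ : ℝ≥0 → S → ℝ, IsHJBSolution lam c g θ T φ →
      ∀ t ≤ T, ∀ i, φ t i = valueFunction lam c g θ T t i) ∧
    -- a measurable pointwise minimiser exists, and each one is optimal
    (∃ u : MarkovControl U, IsPointwiseMinimiser lam c θ T (valueFunction lam c g θ T) u) ∧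
    (∀ u : MarkovControl U, IsPointwiseMinimiser lam c θ T (valueFunction lam c g θ T) u →
      ∀ t ≤ T, ∀ i, expCost lam c g θ T u t i = valueFunction lam c g θ T t i) ∧
    -- the same for the risk-sensitive (logarithmic) cost
    (∀ t ≤ T, ∀ i, θ⁻¹ * Real.log (valueFunction lam c g θ T t i)
      = ⨅ u : MarkovControl U, θ⁻¹ * Real.log (expCost lam c g θ T u t i)) ∧
    (∀ u : MarkovControl U, IsPointwiseMinimiser lam c θ T (valueFunction lam c g θ T) u →
      ∀ t ≤ T, ∀ i, θ⁻¹ * Real.log (expCost lam c g θ T u t i)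
        = ⨅ v : MarkovControl U, θ⁻¹ * Real.log (expCost lam c g θ T v t i)) := by
  obtain ⟨C, hC⟩ := hc_bdd
  obtain ⟨G, hG⟩ := hg_bdd
  have hCabs : ∀ t i u, |c t i u| ≤ C := fun t i u =>
    (abs_of_nonneg (hc_nonneg t i u)).trans_le (hC t i u)
  obtain ⟨φ, hφ⟩ := exists_isMildHJBSolution hlam hθ_pos.le hCabs hc_cont hG T
  have hV : IsHJBSolution lam c g θ T (valueFunction lam c g θ T) :=
    (hφ.isHJBSolution hlam hc_cont).congr fun t ht i =>
      (hφ.isHJBSolution hlam hc_cont).eq_valueFunction hlam hθ_pos.le hc_cont hCabs ht i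
  have heq : ∀ t ≤ T, ∀ i, φ t i = valueFunction lam c g θ T t i := fun t ht i =>
    (hφ.isHJBSolution hlam hc_cont).eq_valueFunction hlam hθ_pos.le hc_cont hCabs ht i
  have hlower : ∀ (u : MarkovControl U), ∀ t ≤ T, ∀ i,
      valueFunction lam c g θ T t i ≤ expCost lam c g θ T u t i := fun u t ht i => by
    rw [← heq t ht i]
    exact hφ.le_expCost hlam hθ_pos.le hc_cont hCabs u ht i
  have hopt : ∀ u : MarkovControl U, IsPointwiseMinimiser lam c θ T (valueFunction lam c g θ T) u →
      ∀ t ≤ T, ∀ i, expCost lam c g θ T u t i = valueFunction lam c g θ T t i :=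
    fun u hu t ht i => le_antisymm
      ((hφ.expCost_le hlam hθ_pos.le hc_cont hCabs
        (hu.congr fun t ht i => (heq t ht i).symm) ht i).trans_eq (heq t ht i))
      (hlower u t ht i)
  obtain ⟨u₀, hu₀⟩ := hφ.exists_markovControl hlam hc_cont
  have hu₀' := hu₀.congr heq
  have : Nonempty (MarkovControl U) := ⟨u₀⟩
  have hpos : ∀ t ≤ T, ∀ i, 0 < valueFunction lam c g θ T t i := fun t ht i => by
    rw [← hopt u₀ hu₀' t ht i]
    exact one_pos.trans_le
      (one_le_expCost hlam hθ_pos.le hc_cont hCabs hc_nonneg hg_nonneg hG u₀ ht i)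
  -- the infimum of the costs is attained by `u₀`, so that it commutes with the logarithm
  have hlog : ∀ t ≤ T, ∀ i, θ⁻¹ * Real.log (valueFunction lam c g θ T t i)
      = ⨅ u : MarkovControl U, θ⁻¹ * Real.log (expCost lam c g θ T u t i) := fun t ht i => by
    have hle : ∀ u : MarkovControl U, θ⁻¹ * Real.log (valueFunction lam c g θ T t i)
        ≤ θ⁻¹ * Real.log (expCost lam c g θ T u t i) := fun u =>
      mul_le_mul_of_nonneg_left (Real.log_le_log (hpos t ht i) (hlower u t ht i))
        (inv_nonneg.2 hθ_pos.le)
    refine le_antisymm (le_ciInf hle) ?_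
    rw [← hopt u₀ hu₀' t ht i]
    exact ciInf_le ⟨_, by rintro _ ⟨v, rfl⟩; exact hle v⟩ u₀
  refine ⟨fun u s i => ?_, hV, fun ψ hψ t ht i =>
    hψ.eq_valueFunction hlam hθ_pos.le hc_cont hCabs ht i, ⟨u₀, hu₀'⟩, hopt, hlog,
    fun u hu t ht i => ?_⟩
  · obtain ⟨P, hP⟩ := exists_solvesMartingaleProblem hlam u s i
    exact ⟨P, hP, fun Q hQ => hQ.unique hlam hP⟩
  · rw [hopt u hu t ht i]
    exact hlog t ht i
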